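/- Let $d\ge 1$, $N,m\ge 0$ be integers, let $\mathcal A\subset\mathbb R^m$ be open, and for $a\in\mathcal A$ let $L(a,\tilde\xi)=\sum_{j=0}^d\tilde\xi_jA_j(a)$, $\tilde\xi\in\mathbb R^{1+d}$, where the $A_j(a)$ are complex $N\times N$ matrices, uniformly bounded on $\mathcal A$. Let $\nu_a\in\mathbb R^{1+d}$, $a\in\mathcal A$, be directions, and let $\mathbb E\subset\mathbb R^{1+d}$ be a linear subspace such that $\mathbb R^{1+d}=\mathbb E\oplus\mathbb R\nu_a$ for all $a\in\mathcal A$ and such that all $\nu_a$ lie in a compact set $K$ with $K\cap\mathbb E=\emptyset$. Write $(f,u)=\sum_i f_i\overline{u_i}$ for the hermitian product of $\mathbb C^N$; "homogeneous of degree $0$" means invariant under multiplication of the variable by any $t>0$. A uniform family of symmetrizers in the directions $\nu_a$ is a uniformly bounded family of $N\times N$ matrices $S(a,\xi)$, $a\in\mathcal A$, $\xi\in\mathbb E\setminus\{0\}$, homogeneous of degree $0$ in $\xi$, such that $S(a,\xi)L(a,\xi)$ and $S(a,\xi)L(a,\nu_a)$ are self-adjoint and, for some $c>0$ independent of $a$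 and $\xi$, $(S(a,\xi)L(a,\nu_a)u,u)\ge c|u|^2$ for all $u\in\mathbb C^N$. A bounded family of full symmetrizers, uniformly positive in the directions $\nu_a$, is a uniformly bounded family of $N\times N$ matrices $\mathbf S(a,\tilde\xi)$, $a\in\mathcal A$, $\tilde\xi\in\mathbb R^{1+d}\setminus\{0\}$, homogeneous of degree $0$ in $\tilde\xi$, such that $\mathbf S(a,\tilde\xi)L(a,\tilde\xi)$ is self-adjoint and, for some $c>0$ independent of $a$ and $\tilde\xi$, $\mathrm{Re}\,(\mathbf S(a,\tilde\xi)L(a,\nu_a)u,u)\ge c|u|^2$ for all $u\in\ker L(a,\tilde\xi)$. Suppose that the coefficients $A_j$ and the map $a\mapsto\nu_a$ are continuous [resp. $W^{1,\infty}$] [resp. $C^\infty$] on $\mathcal A$. (Elements of $W^{1,\infty}$ are identified with their continuous representatives.) (i) If there is a uniform family of symmetrizers $S(a,\xi)$ in the directions $\nu_a$ which is continuous [resp. $W^{1,\infty}$] [resp. $C^\infty$] on $\mathcal A\times S^{d-1}$, where $S^{d-1}$ is the unit sphere of $\mathbb E$, then there is a bounded family of full symmetrizers $\mathbf S(a,\tilde\xi)$,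 uniformly positive in the directions $\nu_a$, which is continuous [resp. $W^{1,\infty}$] [resp. $C^\infty$] on $\mathcal A\times S^{d}$, where $S^d$ is the unit sphere of $\mathbb R^{1+d}$. (ii) Conversely, suppose in addition that for every $a\in\mathcal A$ the system $L(a,\cdot)$ is hyperbolic in the direction $\nu_a$: $\det L(a,\nu_a)\ne0$ and there is $\gamma_0$, possibly depending on $a$, such that $\det L(a,\tilde\xi+i\tau\nu_a)\ne0$ for all $\tilde\xi\in\mathbb R^{1+d}$ and all real $\tau$ with $|\tau|>\gamma_0$. If there is a bounded family of full symmetrizers, uniformly positive in the directions $\nu_a$, which is continuous [resp. $W^{1,\infty}$] [resp. $C^\infty$] on $\mathcal A\times S^d$, then there is a uniform family of symmetrizers in the directions $\nu_a$ which is continuous [resp. $W^{1,\infty}$] [resp. $C^\infty$] on $\mathcal A\times S^{d-1}$. In particular, when each $L(a,\cdot)$ is hyperbolic in the direction $\nu_a$, the two existence statements are equivalent. -/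

import Mathlib

open MeasureTheory
open scoped ContDiff ENNReal Matrix

/-- The dual space `ℝ^{1+d}` of space-time frequencies `ξ̃`, with the Euclidean norm. -/
abbrev Freq (d : ℕ) : Type := EuclideanSpace ℝ (Fin (d + 1))

/-- Complex `N × N` matrices. -/
abbrev CMat (N : ℕ) : Type := Matrix (Fin N) (Fin N) ℂ

/-- The symbol `L(ξ̃) = ∑ⱼ ξ̃ⱼ Aⱼ` of a first order system with coefficients `A₀, …, A_d`. -/
noncomputable def symbol {d N : ℕ} (A : Fin (d + 1) → CMat N) (ξ : Freq d) : CMat N :=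
  ∑ j, ((ξ j : ℝ) : ℂ) • A j

/-- The characteristic determinant `p(ζ) = det (∑ⱼ i ζⱼ Aⱼ + B)`, for complex `ζ`.
Its principal part is the one with `B = 0`. -/
noncomputable def charDet {d N : ℕ} (A : Fin (d + 1) → CMat N) (B : CMat N)
    (ζ : Fin (d + 1) → ℂ) : ℂ :=
  (∑ j, (Complex.I * ζ j) • A j + B).det

/-- The operator `∑ⱼ Aⱼ ∂ⱼ + B` is hyperbolic in the direction `ν`: the principal part of
the characteristic determinant does not vanish at `ν`, and `p(iτν + ξ̃) ≠ 0` for all real `ξ̃`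
and all real `τ` with `|τ| > γ₀`, for some `γ₀`. -/
def IsHyperbolicInDirection {d N : ℕ} (A : Fin (d + 1) → CMat N) (B : CMat N) (ν : Freq d) : Prop :=
  charDet A 0 (fun j => ((ν j : ℝ) : ℂ)) ≠ 0 ∧
    ∃ γ₀ : ℝ, ∀ (ξ : Freq d) (τ : ℝ), γ₀ < |τ| →
      charDet A B (fun j => Complex.I * ((τ * ν j : ℝ) : ℂ) + ((ξ j : ℝ) : ℂ)) ≠ 0

/-- The hermitian product `(f, u) = ∑ᵢ fᵢ ūᵢ` on `ℂᴺ`. -/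
noncomputable def herm {N : ℕ} (f u : Fin N → ℂ) : ℂ := ∑ i, f i * star (u i)

/-- The squared norm `|u|²` on `ℂᴺ`. -/
noncomputable def normSqVec {N : ℕ} (u : Fin N → ℂ) : ℝ := ∑ i, ‖u i‖ ^ 2

section Regularity

variable {V F : Type*} [NormedAddCommGroup V] [NormedSpace ℝ V] [FiniteDimensional ℝ V]
  [MeasurableSpace V] [BorelSpace V] [NormedAddCommGroup F] [NormedSpace ℝ F]

/-- `g` is the weak (distributional) differential of `f` on the open set `Ω`: for every test
function `φ ∈ C_c^∞(Ω)` and every vector `v`, `∫_Ω (∂_v φ) f = - ∫_Ω φ (g v)`, the integrals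
being taken with respect to Lebesgue (Haar) measure. -/
def HasWeakDifferentialOn (f : V → F) (g : V → V →L[ℝ] F) (Ω : Set V) : Prop :=
  ∀ φ : V → ℝ, ContDiff ℝ ∞ φ → HasCompactSupport φ → tsupport φ ⊆ Ω → ∀ v : V,
    ∫ x in Ω, (fderiv ℝ φ x v) • f x ∂Measure.addHaar
      = - ∫ x in Ω, φ x • g x v ∂Measure.addHaar

/-- `f` is (the continuous representative of) an element of `W^{1,∞}(Ω)`: it is continuous on
`Ω`, and both `f` and a weak differential of `f` are in `L^∞(Ω)`. -/
def MemW1Infty (f : V → F) (Ω : Set V) : Prop :=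
  ContinuousOn f Ω ∧ MemLp f ∞ (Measure.addHaar.restrict Ω) ∧
    ∃ g : V → V →L[ℝ] F, MemLp g ∞ (Measure.addHaar.restrict Ω) ∧ HasWeakDifferentialOn f g Ω

end Regularity

/-- The three classes of regularity: continuous, `W^{1,∞}`, `C^∞`. -/
inductive Regularity : Type
  | continuous
  | w1infty
  | smooth

/-- `f` has the regularity `r` on the open set `Ω`. -/
def Regularity.On {V F : Type*} [NormedAddCommGroup V] [NormedSpace ℝ V]
    [FiniteDimensional ℝ V] [MeasurableSpace V] [BorelSpace V]
    [NormedAddCommGroup F] [NormedSpace ℝ F]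
    (r : Regularity) (f : V → F) (Ω : Set V) : Prop :=
  match r with
  | .continuous => ContinuousOn f Ω
  | .w1infty => MemW1Infty f Ω
  | .smooth => ContDiffOn ℝ ∞ f Ω

/-- The open shell `{1/2 < |ξ| < 2}` around the unit sphere. -/
def shell (W : Type*) [Norm W] : Set W := {ξ | 1 / 2 < ‖ξ‖ ∧ ‖ξ‖ < 2}

/-- The matrix function `S(a, ξ)`, homogeneous of degree `0` in `ξ ≠ 0`, has regularity `r` on
`𝒜 × {|ξ| = 1}`. Homogeneous functions of degree `0` on `W \ {0}` are identified with functions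
on the unit sphere, and the regularity on `𝒜 × {|ξ| = 1}` is expressed, entry by entry, as
regularity of the homogeneous function on the open set `𝒜 × {1/2 < |ξ| < 2}`. -/
def HomogRegularOn {m N : ℕ} {W : Type*} [NormedAddCommGroup W] [InnerProductSpace ℝ W]
    [FiniteDimensional ℝ W] [MeasurableSpace W] [BorelSpace W]
    (r : Regularity) (𝒜 : Set (EuclideanSpace ℝ (Fin m)))
    (S : EuclideanSpace ℝ (Fin m) → W → CMat N) : Prop :=
  ∀ i j : Fin N,
    r.On (fun x : EuclideanSpace ℝ (Fin m) × W => S x.1 x.2 i j) (𝒜 ×ˢ shell W)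

/-- `S` is a full symmetrizer of the system `L(ξ̃) = ∑ ξ̃ⱼ Aⱼ`, bounded by `C`. -/
structure IsFullSymmetrizer {d N : ℕ} (A : Fin (d + 1) → CMat N) (S : Freq d → CMat N)
    (C : ℝ) : Prop where
  bounded : ∀ ξ : Freq d, ξ ≠ 0 → ∀ i j, ‖S ξ i j‖ ≤ C
  homog : ∀ ξ : Freq d, ξ ≠ 0 → ∀ t : ℝ, 0 < t → S (t • ξ) = S ξ
  selfAdjoint : ∀ ξ : Freq d, ξ ≠ 0 → (S ξ * symbol A ξ).IsHermitian

/-- The full symmetrizer `S` is positive in the direction `ν`, with constant `c`: for all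
`ξ̃ ≠ 0` and all `u ∈ ker L(ξ̃)`, `Re (S(ξ̃) L(ν) u, u) ≥ c |u|²`. -/
def IsPositiveInDirection {d N : ℕ} (A : Fin (d + 1) → CMat N) (ν : Freq d)
    (S : Freq d → CMat N) (c : ℝ) : Prop :=
  ∀ ξ : Freq d, ξ ≠ 0 → ∀ u : Fin N → ℂ, symbol A ξ *ᵥ u = 0 →
    c * normSqVec u ≤ (herm ((S ξ * symbol A ν) *ᵥ u) u).re

/-- `S` is a bounded family of full symmetrizers for `L(a, ·)`, `a ∈ 𝒜`, uniformly positive in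
the directions `ν a`. -/
def IsUniformFullSymmetrizer {m d N : ℕ} (𝒜 : Set (EuclideanSpace ℝ (Fin m)))
    (A : EuclideanSpace ℝ (Fin m) → Fin (d + 1) → CMat N)
    (ν : EuclideanSpace ℝ (Fin m) → Freq d)
    (S : EuclideanSpace ℝ (Fin m) → Freq d → CMat N) : Prop :=
  (∃ C : ℝ, ∀ a ∈ 𝒜, IsFullSymmetrizer (A a) (S a) C) ∧
    ∃ c : ℝ, 0 < c ∧ ∀ a ∈ 𝒜, IsPositiveInDirection (A a) (ν a) (S a) c

/-- `S` is a symmetrizer of `L(ξ̃) = ∑ ξ̃ⱼ Aⱼ` in the direction `ν`, a function of the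
frequencies `ξ` in the complement `E` of `ℝν`; it is bounded by `C`, and `S(ξ) L(ν) ≥ c`. -/
structure IsSymmetrizer {d N : ℕ} (E : Submodule ℝ (Freq d)) (A : Fin (d + 1) → CMat N)
    (ν : Freq d) (S : E → CMat N) (C c : ℝ) : Prop where
  bounded : ∀ ξ : E, ξ ≠ 0 → ∀ i j, ‖S ξ i j‖ ≤ C
  homog : ∀ ξ : E, ξ ≠ 0 → ∀ t : ℝ, 0 < t → S (t • ξ) = S ξ
  selfAdjoint : ∀ ξ : E, ξ ≠ 0 → (S ξ * symbol A (ξ : Freq d)).IsHermitian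
  selfAdjoint_dir : ∀ ξ : E, ξ ≠ 0 → (S ξ * symbol A ν).IsHermitian
  positive : ∀ ξ : E, ξ ≠ 0 → ∀ u : Fin N → ℂ,
    c * normSqVec u ≤ (herm ((S ξ * symbol A ν) *ᵥ u) u).re

/-- `S` is a uniform family of symmetrizers for `L(a, ·)` in the directions `ν a`, `a ∈ 𝒜`. -/
def IsUniformSymmetrizer {m d N : ℕ} (𝒜 : Set (EuclideanSpace ℝ (Fin m)))
    (E : Submodule ℝ (Freq d))
    (A : EuclideanSpace ℝ (Fin m) → Fin (d + 1) → CMat N)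
    (ν : EuclideanSpace ℝ (Fin m) → Freq d)
    (S : EuclideanSpace ℝ (Fin m) → E → CMat N) : Prop :=
  ∃ C c : ℝ, 0 < c ∧ ∀ a ∈ 𝒜, IsSymmetrizer E (A a) (ν a) (S a) C c

/-- `E` is a complement of `ℝ ν_a` for every `a ∈ 𝒜`, uniformly: the directions `ν_a` stay in
a compact set that does not meet `E`. -/
def UniformDecomposition {m d : ℕ} (𝒜 : Set (EuclideanSpace ℝ (Fin m)))
    (E : Submodule ℝ (Freq d)) (ν : EuclideanSpace ℝ (Fin m) → Freq d) : Prop :=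
  (∀ a ∈ 𝒜, IsCompl E (Submodule.span ℝ {ν a})) ∧
    ∃ K : Set (Freq d), IsCompact K ∧ Disjoint K (E : Set (Freq d)) ∧ ∀ a ∈ 𝒜, ν a ∈ K

/-! Direct part. Write a unit frequency as `η = ρ + τ ν` with `ρ ∈ E`. Then `S(ρ) L(η) = S(ρ) L(ρ) +
τ S(ρ) L(ν)` is self-adjoint, and `S(ρ) L(ν)` is positive on all vectors; only `ρ = 0` has to be
avoided. Near `ρ = 0` one uses `L(η)ᴴ` instead, since `L(η)ᴴ L(η)` is self-adjoint, and the two are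
glued by a cutoff in `‖ρ‖²`. Positivity is required only on `ker L(η)`. Boundedness and positivity
of `S` make `L(ν)` uniformly injective, so a nontrivial kernel forces `|τ| ≤ const * ‖ρ‖` and keeps
`ρ` away from `0`, where the cutoff is `1` (`le_norm_projAlong`).

Converse, algebra. Fix `ξ ∈ E` nonzero and put `K = L(ν)`, `X = L(ξ)`, `M = K⁻¹ X`, `T_λ = S(ξ - λ
ν)`. Hyperbolicity makes the spectrum of `M` real, and positivity of `T_λ K` on `ker (X - λ K)`
makes it semisimple. The spectral projectors satisfy `P_λᴴ T_λ K = P_λᴴ T_λ K P_λ`, which bounds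
`P_λ` and `K⁻¹` independently of the gaps between eigenvalues. The matrix `H = ∑ P_λᴴ Re(T_λ K) P_λ`
is then uniformly positive, `H M` is self-adjoint, and `H K⁻¹` is the symmetrizer
(`IsSymmetrizedPencil.isHermitian_and_positive`).

Converse, regularity. Eigenvalues may cross and the `P_λ` need not be regular, but `H` is the real
part of `Kᴴ ∑ T_λᴴ P_λ`, a sum linear in the projectors. After replacing `S` by its even part, the
entries of `T_λ` have the form `g(x, -arctan λ)` with `g` of period `π` in the angle, and
`regOn_spectral_sum` shows that `∑ g(x, -arctan λ) P_λ` is as regular as `M` and `g`. In the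
continuous and Lipschitz classes this rests on the identity `(λ - λ') P_λ P'_λ' = P_λ (M - M')
P'_λ'`. In the smooth class, `g` is expanded in a Fourier series and the sum becomes a rapidly
convergent series of powers of the Cayley transform `(1 - iM)(1 + iM)⁻¹`, which is power bounded.

The class `W^{1,∞}` is handled throughout as bounded functions that are locally Lipschitz with one
constant. -/

/-! ### Uniformly locally Lipschitz functions. -/

section LocallyLipschitz

open Set Filter Topology
open scoped NNReal

/-- `f` is locally Lipschitz near every point of `s`, with one constant for all points. -/
def UnifLocLipOn {X Y : Type*} [PseudoMetricSpace X] [PseudoMetricSpace Y] (f : X → Y)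
    (s : Set X) : Prop :=
  ∃ K : ℝ≥0, ∀ x ∈ s, ∃ U ∈ 𝓝 x, LipschitzOnWith K f U

variable {X Y Z : Type*} [PseudoMetricSpace X] [PseudoMetricSpace Y] [PseudoMetricSpace Z]

theorem UnifLocLipOn.continuousAt {f : X → Y} {s : Set X} (hf : UnifLocLipOn f s) {x : X}
    (hx : x ∈ s) : ContinuousAt f x := by
  obtain ⟨K, hK⟩ := hf
  obtain ⟨U, hU, hL⟩ := hK x hx
  exact hL.continuousOn.continuousAt hU

theorem UnifLocLipOn.mono {f : X → Y} {s t : Set X} (hf : UnifLocLipOn f s) (h : t ⊆ s) :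
    UnifLocLipOn f t :=
  let ⟨K, hK⟩ := hf
  ⟨K, fun x hx => hK x (h hx)⟩

theorem UnifLocLipOn.comp {g : Y → Z} {f : X → Y} {s : Set X} {t : Set Y}
    (hg : UnifLocLipOn g t) (hf : UnifLocLipOn f s) (h : MapsTo f s t) :
    UnifLocLipOn (fun x => g (f x)) s := by
  have hc := fun x (hx : x ∈ s) => hf.continuousAt hx
  obtain ⟨K, hK⟩ := hf
  obtain ⟨L, hL⟩ := hg
  refine ⟨L * K, fun x hx => ?_⟩
  obtain ⟨U, hU, hfU⟩ := hK x hx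
  obtain ⟨W, hW, hgW⟩ := hL (f x) (h hx)
  exact ⟨U ∩ f ⁻¹' W, inter_mem hU (hc x hx hW),
    hgW.comp (hfU.mono inter_subset_left) fun y hy => hy.2⟩

theorem UnifLocLipOn.prodMk {f : X → Y} {g : X → Z} {s : Set X} (hf : UnifLocLipOn f s)
    (hg : UnifLocLipOn g s) : UnifLocLipOn (fun x => (f x, g x)) s := by
  obtain ⟨K, hK⟩ := hf
  obtain ⟨L, hL⟩ := hg
  refine ⟨max K L, fun x hx => ?_⟩
  obtain ⟨U, hU, hfU⟩ := hK x hx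
  obtain ⟨W, hW, hgW⟩ := hL x hx
  exact ⟨U ∩ W, inter_mem hU hW,
    (hfU.mono inter_subset_left).prodMk (hgW.mono inter_subset_right)⟩

theorem UnifLocLipOn.congr_of_isOpen {f g : X → Y} {s : Set X} (hf : UnifLocLipOn f s)
    (hs : IsOpen s) (h : EqOn g f s) : UnifLocLipOn g s := by
  obtain ⟨K, hK⟩ := hf
  refine ⟨K, fun x hx => ?_⟩
  obtain ⟨U, hU, hfU⟩ := hK x hx
  refine ⟨U ∩ s, inter_mem hU (hs.mem_nhds hx), fun y hy z hz => ?_⟩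
  rw [h hy.2, h hz.2]
  exact hfU hy.1 hz.1

theorem UnifLocLipOn.union {f : X → Y} {s t : Set X} (hf : UnifLocLipOn f s)
    (hg : UnifLocLipOn f t) : UnifLocLipOn f (s ∪ t) := by
  obtain ⟨K, hK⟩ := hf
  obtain ⟨L, hL⟩ := hg
  refine ⟨max K L, ?_⟩
  rintro x (hx | hx)
  · obtain ⟨U, hU, h⟩ := hK x hx
    exact ⟨U, hU, h.weaken (le_max_left _ _)⟩
  · obtain ⟨U, hU, h⟩ := hL x hx
    exact ⟨U, hU, h.weaken (le_max_right _ _)⟩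

/-- A function which is `K`-Lipschitz near every point of a convex set is `K`-Lipschitz on it. -/
theorem lipschitzOnWith_of_convex_of_locally {V F : Type*} [NormedAddCommGroup V]
    [NormedSpace ℝ V] [PseudoMetricSpace F] {f : V → F} {s : Set V} {K : ℝ≥0}
    (hs : Convex ℝ s) (h : ∀ x ∈ s, ∃ U ∈ 𝓝 x, LipschitzOnWith K f U) :
    LipschitzOnWith K f s := by
  refine LipschitzOnWith.of_dist_le_mul fun x hx y hy => ?_
  set p : ℝ → V := fun t => x + t • (y - x) with hp
  have hps : ∀ t ∈ Icc (0 : ℝ) 1, p t ∈ s := fun t ht => by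
    have := hs.add_smul_sub_mem hx hy ht
    simpa [hp] using this
  have hpc : Continuous p := by fun_prop
  have hdist : ∀ t t' : ℝ, dist (p t) (p t') = |t - t'| * dist x y := fun t t' => by
    simp only [hp, dist_eq_norm]
    rw [add_sub_add_left_eq_sub, ← sub_smul, norm_smul, Real.norm_eq_abs, norm_sub_rev x y]
  have hfc : ContinuousOn (fun t => f (p t)) (Icc 0 1) := fun t ht => by
    obtain ⟨U, hU, hL⟩ := h (p t) (hps t ht)
    exact ((hL.continuousOn.continuousAt hU).comp (f := p) hpc.continuousAt).continuousWithinAt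
  -- Continuous induction on `[0, 1]`: this condition is closed in `t`, holds at `0`, and the local
  -- estimate at `p t` propagates it to the right with the same constant.
  set S : Set ℝ := {t | dist (f x) (f (p t)) ≤ K * dist x y * t} with hS
  have key : Icc (0 : ℝ) 1 ⊆ S := by
    apply IsClosed.Icc_subset_of_forall_mem_nhdsWithin
    · have : S ∩ Icc 0 1 = {t ∈ Icc (0 : ℝ) 1 | dist (f x) (f (p t)) ≤ K * dist x y * t} := by
        ext t; simp [hS, and_comm]
      rw [this]
      exact isClosed_Icc.isClosed_le
        (continuous_dist.comp_continuousOn (continuousOn_const.prodMk hfc)) (by fun_prop)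
    · simp [hS, hp]
    · rintro t ⟨htS, ht⟩
      obtain ⟨U, hU, hL⟩ := h (p t) (hps t ⟨ht.1, ht.2.le⟩)
      have h1 : ∀ᶠ t' in 𝓝[>] t, p t' ∈ U := nhdsWithin_le_nhds (hpc.continuousAt hU)
      filter_upwards [h1, self_mem_nhdsWithin] with t' ht' htt'
      have h2 := hL.dist_le_mul (p t) (mem_of_mem_nhds hU) (p t') ht'
      have h3 : |t - t'| = t' - t := by rw [abs_sub_comm, abs_of_pos (sub_pos.2 htt')]
      rw [hdist, h3] at h2
      have h4 : dist (f x) (f (p t)) ≤ K * dist x y * t := htS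
      have h5 := dist_triangle (f x) (f (p t)) (f (p t'))
      change dist (f x) (f (p t')) ≤ K * dist x y * t'
      linarith
  have := key (right_mem_Icc.2 zero_le_one)
  simpa [hS, hp] using this

/-- Compactness reduces the local constants to a single one. The neighbourhoods are taken in the
whole space, not relative to `Q`, as composition with maps into `Q` requires. -/
theorem ContDiffOn.unifLocLipOn_compact {F G : Type*} [NormedAddCommGroup F] [NormedSpace ℝ F]
    [NormedAddCommGroup G] [NormedSpace ℝ G] {g : F → G} {O Q : Set F}
    (hg : ContDiffOn ℝ ∞ g O) (hO : IsOpen O) (hQ : IsCompact Q) (hQO : Q ⊆ O) :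
    UnifLocLipOn g Q := by
  have h : ∀ y ∈ Q, ∃ K : ℝ≥0, ∃ U ∈ 𝓝 y, LipschitzOnWith K g U := fun y hy =>
    ((hg.contDiffAt (hO.mem_nhds (hQO hy))).of_le (by simp)).exists_lipschitzOnWith
  refine hQ.induction_on (p := fun s => UnifLocLipOn g s) ⟨0, by simp⟩
    (fun s t hst ht => ht.mono hst) (fun s t hs ht => hs.union ht) fun y hy => ?_
  obtain ⟨K, U, hU, hL⟩ := h y hy
  refine ⟨interior U, mem_nhdsWithin_of_mem_nhds (interior_mem_nhds.2 hU), K, fun z hz => ?_⟩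
  exact ⟨U, mem_interior_iff_mem_nhds.1 hz, hL⟩

end LocallyLipschitz

/-! ### Calculus common to the three regularity classes. -/

section RegOn

open Set Filter Topology

/-- The regularity classes on open sets, with `W^{1,∞}` replaced by uniformly locally Lipschitz. -/
def RegOn {V F : Type*} [NormedAddCommGroup V] [NormedSpace ℝ V]
    [NormedAddCommGroup F] [NormedSpace ℝ F]
    (r : Regularity) (f : V → F) (Ω : Set V) : Prop :=
  match r with
  | .continuous => ContinuousOn f Ω
  | .w1infty => UnifLocLipOn f Ω
  | .smooth => ContDiffOn ℝ ∞ f Ω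

variable {V F G H : Type*} [NormedAddCommGroup V] [NormedSpace ℝ V]
  [NormedAddCommGroup F] [NormedSpace ℝ F] [NormedAddCommGroup G] [NormedSpace ℝ G]
  [NormedAddCommGroup H] [NormedSpace ℝ H] {r : Regularity} {Ω : Set V}

theorem RegOn.continuousOn {f : V → F} (hf : RegOn r f Ω) : ContinuousOn f Ω := by
  cases r with
  | continuous => exact hf
  | w1infty => exact fun x hx => (UnifLocLipOn.continuousAt hf hx).continuousWithinAt
  | smooth => exact ContDiffOn.continuousOn hf

theorem RegOn.mono {f : V → F} {Ω' : Set V} (hf : RegOn r f Ω) (h : Ω' ⊆ Ω) :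
    RegOn r f Ω' := by
  cases r with
  | continuous => exact ContinuousOn.mono hf h
  | w1infty => exact UnifLocLipOn.mono hf h
  | smooth => exact ContDiffOn.mono hf h

theorem RegOn.comp {g : F → G} {f : V → F} {Ω' : Set F} (hg : RegOn r g Ω') (hf : RegOn r f Ω)
    (h : MapsTo f Ω Ω') : RegOn r (fun x => g (f x)) Ω := by
  cases r with
  | continuous => exact ContinuousOn.comp hg hf h
  | w1infty => exact UnifLocLipOn.comp hg hf h
  | smooth => exact ContDiffOn.comp hg hf h

theorem RegOn.prodMk {f : V → F} {g : V → G} (hf : RegOn r f Ω) (hg : RegOn r g Ω) :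
    RegOn r (fun x => (f x, g x)) Ω := by
  cases r with
  | continuous => exact ContinuousOn.prodMk hf hg
  | w1infty => exact UnifLocLipOn.prodMk hf hg
  | smooth => exact ContDiffOn.prodMk hf hg

theorem RegOn.congr_of_isOpen {f g : V → F} (hf : RegOn r f Ω) (hΩ : IsOpen Ω)
    (h : EqOn g f Ω) : RegOn r g Ω := by
  cases r with
  | continuous => exact ContinuousOn.congr hf h
  | w1infty => exact UnifLocLipOn.congr_of_isOpen hf hΩ h
  | smooth => exact ContDiffOn.congr hf h

theorem RegOn.union {f : V → F} {Ω' : Set V} (hf : RegOn r f Ω) (hf' : RegOn r f Ω')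
    (hΩ : IsOpen Ω) (hΩ' : IsOpen Ω') : RegOn r f (Ω ∪ Ω') := by
  cases r with
  | continuous => exact ContinuousOn.union_of_isOpen hf hf' hΩ hΩ'
  | w1infty => exact UnifLocLipOn.union hf hf'
  | smooth => exact ContDiffOn.union_of_isOpen hf hf' hΩ hΩ'

theorem ContinuousLinearMap.regOn (L : V →L[ℝ] F) (r : Regularity) (Ω : Set V) :
    RegOn r (fun x => L x) Ω := by
  cases r with
  | continuous => exact L.continuous.continuousOn
  | w1infty => exact ⟨‖L‖₊, fun x _ => ⟨univ, univ_mem, L.lipschitz.lipschitzOnWith⟩⟩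
  | smooth => exact L.contDiff.contDiffOn

theorem regOn_const (c : F) (r : Regularity) (Ω : Set V) : RegOn r (fun _ => c) Ω := by
  cases r with
  | continuous => exact continuousOn_const
  | w1infty => exact ⟨0, fun x _ => ⟨univ, univ_mem, (LipschitzWith.const c).lipschitzOnWith⟩⟩
  | smooth => exact contDiffOn_const

theorem regOn_fst (r : Regularity) (Ω : Set (V × F)) : RegOn r (fun x => x.1) Ω :=
  (ContinuousLinearMap.fst ℝ V F).regOn r Ω

theorem regOn_snd (r : Regularity) (Ω : Set (V × F)) : RegOn r (fun x => x.2) Ω :=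
  (ContinuousLinearMap.snd ℝ V F).regOn r Ω

theorem RegOn.clm {f : V → F} (L : F →L[ℝ] G) (hf : RegOn r f Ω) :
    RegOn r (fun x => L (f x)) Ω :=
  (L.regOn r univ).comp hf (mapsTo_univ _ _)

/-- Post-composition with a smooth function, for functions with values in a compact set. -/
theorem RegOn.contDiffOn_comp {g : F → G} {f : V → F} {O Q : Set F} (hf : RegOn r f Ω)
    (hg : ContDiffOn ℝ ∞ g O) (hO : IsOpen O) (hQ : IsCompact Q) (hQO : Q ⊆ O)
    (h : MapsTo f Ω Q) : RegOn r (fun x => g (f x)) Ω := by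
  cases r with
  | continuous => exact ContinuousOn.comp hg.continuousOn hf (h.mono_right hQO)
  | w1infty => exact UnifLocLipOn.comp (hg.unifLocLipOn_compact hO hQ hQO) hf h
  | smooth => exact ContDiffOn.comp hg hf (h.mono_right hQO)

theorem RegOn.add {f g : V → F} (hf : RegOn r f Ω) (hg : RegOn r g Ω) :
    RegOn r (fun x => f x + g x) Ω :=
  (hf.prodMk hg).clm (ContinuousLinearMap.fst ℝ F F + ContinuousLinearMap.snd ℝ F F)

theorem RegOn.sum {ι : Type*} (s : Finset ι) {f : ι → V → F} (hf : ∀ i ∈ s, RegOn r (f i) Ω) :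
    RegOn r (fun x => ∑ i ∈ s, f i x) Ω := by
  classical
  induction s using Finset.induction_on with
  | empty => simpa using regOn_const (0 : F) r Ω
  | insert i s hi ih =>
    simp only [Finset.sum_insert hi]
    exact (hf i (Finset.mem_insert_self _ _)).add
      (ih fun j hj => hf j (Finset.mem_insert_of_mem hj))

/-- The bounds matter in the Lipschitz class: a product of unbounded uniformly locally Lipschitz
functions has no uniform constant. Bounded factors take values in compact balls, where the bilinear
map has one. -/
theorem RegOn.bilin [FiniteDimensional ℝ F] [FiniteDimensional ℝ G] (B : F →L[ℝ] G →L[ℝ] H)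
    {f : V → F} {g : V → G} (hf : RegOn r f Ω) (hg : RegOn r g Ω) {Cf Cg : ℝ}
    (hfb : ∀ x ∈ Ω, ‖f x‖ ≤ Cf) (hgb : ∀ x ∈ Ω, ‖g x‖ ≤ Cg) :
    RegOn r (fun x => B (f x) (g x)) Ω := by
  have hF := FiniteDimensional.proper_real F
  have hG := FiniteDimensional.proper_real G
  refine (hf.prodMk hg).contDiffOn_comp (g := fun p : F × G => B p.1 p.2) (O := univ)
    (Q := Metric.closedBall 0 Cf ×ˢ Metric.closedBall 0 Cg)
    B.isBoundedBilinearMap.contDiff.contDiffOn isOpen_univ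
    ((isCompact_closedBall _ _).prod (isCompact_closedBall _ _)) (subset_univ _) fun x hx => ?_
  simpa using ⟨hfb x hx, hgb x hx⟩

end RegOn

/-! ### `W^{1,∞}` and uniformly locally Lipschitz functions. -/

section Weak

open Set Filter Topology Metric
open scoped NNReal Convolution

theorem fderiv_eq_zero_of_notMem_tsupport {V F : Type*} [NormedAddCommGroup V]
    [NormedSpace ℝ V] [NormedAddCommGroup F] [NormedSpace ℝ F]
    {φ : V → F} {x : V} (hx : x ∉ tsupport φ) : fderiv ℝ φ x = 0 := by
  by_contra h
  exact hx (support_fderiv_subset ℝ h)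

variable {V : Type*} [NormedAddCommGroup V] [NormedSpace ℝ V] [FiniteDimensional ℝ V]
  [MeasurableSpace V] [BorelSpace V]

section WeakToLip

variable {F : Type*} [NormedAddCommGroup F] [NormedSpace ℝ F]

/-- The derivative of a mollification falls on the kernel, so `t ↦ ρ (x - t)` is a test function for
the weak differential; the result is an average of `g` with a nonnegative weight of mass at most
one. Truncating `f` to the compact set `Q` makes it integrable on the whole space. -/
theorem HasWeakDifferentialOn.norm_fderiv_convolution_le {f : V → F} {g : V → V →L[ℝ] F}
    {Ω : Set V} (hΩ : IsOpen Ω) (h : HasWeakDifferentialOn f g Ω) {M : ℝ}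
    (hg : ∀ᵐ x ∂(Measure.addHaar : Measure V).restrict Ω, ‖g x‖ ≤ M) (hM : 0 ≤ M) {Q : Set V}
    (hQ : IsCompact Q) (hQΩ : Q ⊆ Ω) (hf : ContinuousOn f Q) (φ : ContDiffBump (0 : V)) {x : V}
    (hx : closedBall x φ.rOut ⊆ Q) :
    ∃ D : V →L[ℝ] F, ‖D‖ ≤ M ∧ HasFDerivAt
      (φ.normed Measure.addHaar ⋆[ContinuousLinearMap.lsmul ℝ ℝ, Measure.addHaar] Q.indicator f)
      D x := by
  set μ : Measure V := Measure.addHaar with hμ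
  set ρ : V → ℝ := φ.normed μ with hρ
  have hρs : ContDiff ℝ ∞ ρ := φ.contDiff_normed
  have hfi : LocallyIntegrable (Q.indicator f) μ :=
    ((integrable_indicator_iff hQ.measurableSet).2 (hf.integrableOn_compact hQ)).locallyIntegrable
  have hd := (φ.hasCompactSupport_normed (μ := μ)).hasFDerivAt_convolution_right
    (ContinuousLinearMap.lsmul ℝ ℝ : ℝ →L[ℝ] F →L[ℝ] F).flip hfi (hρs.of_le (by simp)) x
  rw [convolution_flip] at hd
  refine ⟨_, ?_, hd⟩
  refine ContinuousLinearMap.opNorm_le_bound _ hM fun v => ?_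
  rw [convolution_precompR_apply _ hfi ((φ.hasCompactSupport_normed (μ := μ)).fderiv ℝ)
    (hρs.continuous_fderiv (by simp))]
  set ψ : V → ℝ := fun t => ρ (x - t) with hψ
  have hψs : ContDiff ℝ ∞ ψ := hρs.comp (contDiff_const.sub contDiff_id)
  have hψsupp : tsupport ψ ⊆ closedBall x φ.rOut := by
    refine closure_minimal (fun t ht => ?_) isClosed_closedBall
    have h1 : x - t ∈ tsupport ρ := subset_tsupport _ ht
    rw [hρ, φ.tsupport_normed_eq] at h1
    rw [mem_closedBall, dist_comm, dist_eq_norm]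
    simpa using h1
  have hψc : HasCompactSupport ψ :=
    HasCompactSupport.intro (isCompact_closedBall x φ.rOut) fun t ht =>
      image_eq_zero_of_notMem_tsupport fun h' => ht (hψsupp h')
  have hψd : ∀ t, fderiv ℝ ψ t v = - fderiv ℝ ρ (x - t) v := fun t => by
    have h1 : HasFDerivAt ρ (fderiv ℝ ρ (x - t)) (x - t) :=
      (hρs.differentiable (by simp) _).hasFDerivAt
    have h2 : HasFDerivAt (fun t : V => x - t) (-ContinuousLinearMap.id ℝ V) t :=
      (hasFDerivAt_id t).const_sub x
    have h3 := (h1.comp t h2).fderiv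
    change fderiv ℝ (ρ ∘ fun t => x - t) t v = _
    rw [h3]; simp
  have hw := h ψ hψs hψc (hψsupp.trans (hx.trans hQΩ)) v
  have hL : (Q.indicator f ⋆[(ContinuousLinearMap.lsmul ℝ ℝ : ℝ →L[ℝ] F →L[ℝ] F).flip, μ]
      fun a => fderiv ℝ ρ a v) x = ∫ t in Ω, ψ t • g t v ∂μ := by
    rw [convolution_def, ← neg_neg (∫ t in Ω, ψ t • g t v ∂μ), ← hw, ← integral_neg,
      ← integral_indicator hΩ.measurableSet]
    congr 1
    ext t
    simp only [ContinuousLinearMap.flip_apply, ContinuousLinearMap.lsmul_apply]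
    by_cases ht : t ∈ tsupport ψ
    · have h1 : t ∈ Q := hx (hψsupp ht)
      rw [indicator_of_mem h1, indicator_of_mem (hQΩ h1), hψd]; simp
    · have h1 : fderiv ℝ ρ (x - t) v = 0 := by
        have := hψd t
        rw [fderiv_eq_zero_of_notMem_tsupport ht] at this
        simpa using this.symm
      rw [h1, zero_smul]
      by_cases h2 : t ∈ Ω
      · rw [indicator_of_mem h2, hψd, h1]; simp
      · rw [indicator_of_notMem h2]
  rw [hL]
  have hψi : Integrable ψ μ := hψs.continuous.integrable_of_hasCompactSupport hψc
  have hψ0 : ∀ t, 0 ≤ ψ t := fun t => φ.nonneg_normed _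
  have hψ1 : ∫ t, ψ t ∂μ = 1 := by
    rw [hψ, integral_sub_left_eq_self (fun t => ρ t) μ x]
    exact φ.integral_normed
  calc ‖∫ t in Ω, ψ t • g t v ∂μ‖ ≤ ∫ t in Ω, ψ t * (M * ‖v‖) ∂μ := by
        refine norm_integral_le_of_norm_le (hψi.restrict.mul_const _) ?_
        filter_upwards [hg] with t ht
        rw [norm_smul, Real.norm_of_nonneg (hψ0 t)]
        exact mul_le_mul_of_nonneg_left (((g t).le_opNorm v).trans (by gcongr)) (hψ0 t)
    _ = (∫ t in Ω, ψ t ∂μ) * (M * ‖v‖) := integral_mul_const _ _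
    _ ≤ 1 * (M * ‖v‖) := by
        gcongr
        rw [← hψ1]
        exact setIntegral_le_integral hψi (ae_of_all _ hψ0)
    _ = M * ‖v‖ := one_mul _

/-- On a small ball the mollifications are `M`-Lipschitz with `M` the `L^∞` norm of the weak
differential, and they approximate `f` at any two given points. The constant does not depend on the
ball. -/
theorem MemW1Infty.unifLocLipOn [CompleteSpace F] {f : V → F} {Ω : Set V} (hΩ : IsOpen Ω)
    (h : MemW1Infty f Ω) : UnifLocLipOn f Ω := by
  obtain ⟨hf, -, g, hg, hw⟩ := h
  set μ : Measure V := Measure.addHaar with hμ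
  set M : ℝ≥0 := (eLpNorm g ∞ (μ.restrict Ω)).toNNReal with hMdef
  have hgM : ∀ᵐ x ∂μ.restrict Ω, ‖g x‖ ≤ (M : ℝ) := by
    filter_upwards [ae_le_eLpNormEssSup (f := g) (μ := μ.restrict Ω)] with x hx
    rw [← eLpNorm_exponent_top] at hx
    have := ENNReal.toReal_mono hg.2.ne hx
    simpa [hMdef, ENNReal.coe_toNNReal_eq_toReal] using this
  refine ⟨M, fun x₀ hx₀ => ?_⟩
  obtain ⟨ε, hε, hball⟩ := nhds_basis_closedBall.mem_iff.1 (hΩ.mem_nhds hx₀)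
  have hV := FiniteDimensional.proper_real V
  set Q := closedBall x₀ ε with hQdef
  have hQ : IsCompact Q := isCompact_closedBall _ _
  have hfQ : ContinuousOn f Q := hf.mono hball
  refine ⟨ball x₀ (ε / 2), ball_mem_nhds _ (half_pos hε), LipschitzOnWith.of_dist_le_mul ?_⟩
  intro x hx y hy
  refine le_of_forall_pos_le_add fun η hη => ?_
  have happ : ∀ z ∈ ball x₀ (ε / 2), ∃ δ > 0, ∀ w ∈ ball z δ, dist (f w) (f z) ≤ η / 2 := by
    intro z hz
    have hzΩ : z ∈ Ω := hball (ball_subset_closedBall (ball_subset_ball (by linarith) hz))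
    have := (hf.continuousAt (hΩ.mem_nhds hzΩ))
    obtain ⟨δ, hδ, h⟩ := Metric.continuousAt_iff.1 this (η / 2) (half_pos hη)
    exact ⟨δ, hδ, fun w hw => (h hw).le⟩
  obtain ⟨δ₁, hδ₁, h₁⟩ := happ x hx
  obtain ⟨δ₂, hδ₂, h₂⟩ := happ y hy
  -- The bound `ε / 2` keeps the kernel's support inside `Q`; `δ₁` and `δ₂` keep the mollification
  -- within `η / 2` of `f` at `x` and at `y`.
  set δ := min (ε / 2) (min δ₁ δ₂) with hδ
  have hδ0 : 0 < δ := lt_min (half_pos hε) (lt_min hδ₁ hδ₂)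
  let φ : ContDiffBump (0 : V) := ⟨δ / 2, δ, half_pos hδ0, half_lt_self hδ0⟩
  set c := (φ.normed μ ⋆[ContinuousLinearMap.lsmul ℝ ℝ, μ] Q.indicator f) with hc
  have hsub : ∀ z ∈ ball x₀ (ε / 2), closedBall z φ.rOut ⊆ Q := fun z hz w hw => by
    have h1 : dist w z ≤ ε / 2 := (mem_closedBall.1 hw).trans (min_le_left _ _)
    have h2 : dist z x₀ < ε / 2 := hz
    rw [hQdef, mem_closedBall]
    linarith [dist_triangle w z x₀]
  have hclose : ∀ z ∈ ball x₀ (ε / 2), (∀ w ∈ ball z δ, dist (f w) (f z) ≤ η / 2) →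
      dist (c z) (f z) ≤ η / 2 := by
    intro z hz hδz
    have hzQ : z ∈ Q := hsub z hz (mem_closedBall_self φ.rOut_pos.le)
    have h1 := φ.dist_normed_convolution_le (μ := μ) (g := Q.indicator f) (x₀ := z) (ε := η / 2)
      ((integrable_indicator_iff hQ.measurableSet).2
        (hfQ.integrableOn_compact hQ)).aestronglyMeasurable ?_
    · rwa [indicator_of_mem hzQ] at h1
    · intro w hw
      rw [indicator_of_mem hzQ, indicator_of_mem (hsub z hz (ball_subset_closedBall hw))]
      exact hδz w hw
  have hx' := hclose x hx fun w hw => h₁ w (ball_subset_ball ((min_le_right _ _).trans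
    (min_le_left _ _)) hw)
  have hy' := hclose y hy fun w hw => h₂ w (ball_subset_ball ((min_le_right _ _).trans
    (min_le_right _ _)) hw)
  choose! D hDM hD using fun z (hz : z ∈ ball x₀ (ε / 2)) =>
    hw.norm_fderiv_convolution_le hΩ hgM M.2 hQ hball hfQ φ (hsub z hz)
  have hcl : dist (c x) (c y) ≤ M * dist x y := by
    rw [dist_eq_norm, dist_eq_norm]
    exact (convex_ball x₀ (ε / 2)).norm_image_sub_le_of_norm_hasFDerivWithin_le
      (fun z hz => (hD z hz).hasFDerivWithinAt) hDM hy hx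
  have t1 := dist_triangle4 (f x) (c x) (c y) (f y)
  rw [dist_comm (f x) (c x)] at t1
  linarith

end WeakToLip

section LipToWeak

/-- Integration by parts for line derivatives, which by Rademacher's theorem agree almost everywhere
with the differential. -/
theorem LipschitzWith.integral_fderiv_mul {u φ : V → ℝ} {C : ℝ≥0} (hu : LipschitzWith C u)
    (hφ : ContDiff ℝ ∞ φ) (hc : HasCompactSupport φ) (v : V) :
    ∫ x, fderiv ℝ φ x v * u x ∂Measure.addHaar
      = - ∫ x, φ x * fderiv ℝ u x v ∂(Measure.addHaar : Measure V) := by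
  obtain ⟨D, hD⟩ := ContDiff.lipschitzWith_of_hasCompactSupport hc hφ (by simp)
  have key := LipschitzWith.integral_lineDeriv_mul_eq (μ := (Measure.addHaar : Measure V))
    hu hD hc v
  have h1 : ∫ x, lineDeriv ℝ u x v * φ x ∂(Measure.addHaar : Measure V)
      = ∫ x, φ x * fderiv ℝ u x v ∂(Measure.addHaar : Measure V) := by
    refine integral_congr_ae ?_
    filter_upwards [hu.ae_differentiableAt (μ := (Measure.addHaar : Measure V))] with x hx
    rw [hx.lineDeriv_eq_fderiv, mul_comm]
  have h2 : ∀ x, lineDeriv ℝ φ x (-v) = - fderiv ℝ φ x v := fun x => by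
    rw [(hφ.differentiable (by simp) x).lineDeriv_eq_fderiv, map_neg]
  simp only [h2, neg_mul, integral_neg] at key
  rw [h1] at key
  rw [key, neg_neg]

theorem LipschitzWith.integral_fderiv_smul_complex {f : V → ℂ} {φ : V → ℝ} {C : ℝ≥0}
    (hf : LipschitzWith C f) (hφ : ContDiff ℝ ∞ φ) (hc : HasCompactSupport φ) (v : V) :
    ∫ x, fderiv ℝ φ x v • f x ∂Measure.addHaar
      = - ∫ x, φ x • fderiv ℝ f x v ∂(Measure.addHaar : Measure V) := by
  set μ : Measure V := Measure.addHaar with hμ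
  have hi1 : Integrable (fun x => fderiv ℝ φ x v • f x) μ := by
    refine Continuous.integrable_of_hasCompactSupport ?_ ?_
    · exact ((hφ.continuous_fderiv (by simp)).clm_apply continuous_const).smul hf.continuous
    · refine HasCompactSupport.intro hc fun x hx => ?_
      rw [fderiv_eq_zero_of_notMem_tsupport hx]; simp
  have hi2 : Integrable (fun x => φ x • fderiv ℝ f x v) μ := by
    have hφi : Integrable φ μ := hφ.continuous.integrable_of_hasCompactSupport hc
    refine (hφi.smul_const ((C : ℝ) * ‖v‖)).mono ?_ ?_
    · exact hφi.aestronglyMeasurable.smul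
        (measurable_fderiv_apply_const ℝ f v).aestronglyMeasurable
    · refine ae_of_all _ fun x => ?_
      simp only [norm_smul]
      gcongr
      refine ((fderiv ℝ f x).le_opNorm v).trans ?_
      rw [Real.norm_of_nonneg (by positivity)]
      gcongr
      exact norm_fderiv_le_of_lipschitz ℝ hf
  have key : ∀ P : ℂ →L[ℝ] ℝ, P (∫ x, fderiv ℝ φ x v • f x ∂μ)
      = P (- ∫ x, φ x • fderiv ℝ f x v ∂μ) := fun P => by
    rw [map_neg, ← P.integral_comp_comm hi1, ← P.integral_comp_comm hi2]
    have hP : LipschitzWith (‖P‖₊ * C) (fun x => P (f x)) := P.lipschitz.comp hf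
    have := hP.integral_fderiv_mul hφ hc v
    simp only [map_smul, smul_eq_mul]
    rw [this]
    congr 1
    refine integral_congr_ae ?_
    filter_upwards [hf.ae_differentiableAt (μ := μ)] with x hx
    have h1 : HasFDerivAt (fun x => P (f x)) (P.comp (fderiv ℝ f x)) x :=
      P.hasFDerivAt.comp x hx.hasFDerivAt
    rw [h1.fderiv]; rfl
  exact Complex.ext (key Complex.reCLM) (key Complex.imCLM)

theorem LipschitzOnWith.extend_complex {X : Type*} [PseudoMetricSpace X] {f : X → ℂ} {s : Set X}
    {C : ℝ≥0} (hf : LipschitzOnWith C f s) :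
    ∃ (D : ℝ≥0) (g : X → ℂ), LipschitzWith D g ∧ EqOn f g s := by
  obtain ⟨u, hu, hu'⟩ := (Complex.reCLM.lipschitz.comp_lipschitzOnWith hf).extend_real
  obtain ⟨w, hw, hw'⟩ := (Complex.imCLM.lipschitz.comp_lipschitzOnWith hf).extend_real
  refine ⟨_, fun x => Complex.equivRealProdCLM.symm (u x, w x),
    Complex.equivRealProdCLM.symm.lipschitz.comp (hu.prodMk hw), fun x hx => ?_⟩
  have h1 := hu' hx
  have h2 := hw' hx
  simp only [Function.comp, Complex.reCLM_apply, Complex.imCLM_apply] at h1 h2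
  apply Complex.ext <;> simp [h1, h2]

/-- The classical differential serves as weak differential. On a compact neighbourhood of the
support of a test function, `f` is Lipschitz and coincides with a globally Lipschitz function, for
which integration by parts is available. The uniform constant bounds the differential; `B` has to
bound `f` separately. -/
theorem UnifLocLipOn.memW1Infty {f : V → ℂ} {Ω : Set V} (hΩ : IsOpen Ω) (h : UnifLocLipOn f Ω)
    {B : ℝ} (hB : ∀ x ∈ Ω, ‖f x‖ ≤ B) : MemW1Infty f Ω := by
  have hcont : ContinuousOn f Ω := fun x hx => (h.continuousAt hx).continuousWithinAt
  set μ : Measure V := Measure.addHaar with hμ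
  obtain ⟨K, hK⟩ := h
  refine ⟨hcont, memLp_top_of_bound (hcont.aestronglyMeasurable hΩ.measurableSet) B
    ((ae_restrict_iff' hΩ.measurableSet).2 (ae_of_all _ hB)), fderiv ℝ f, ?_, ?_⟩
  · refine memLp_top_of_bound (measurable_fderiv ℝ f).aestronglyMeasurable K
      ((ae_restrict_iff' hΩ.measurableSet).2 (ae_of_all _ fun x hx => ?_))
    obtain ⟨U, hU, hL⟩ := hK x hx
    exact norm_fderiv_le_of_lipschitzOn ℝ hU hL
  · intro φ hφ hc hsupp v
    have hV := FiniteDimensional.proper_real V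
    obtain ⟨Q, hQ, hsQ, hQΩ⟩ := exists_compact_between hc hΩ hsupp
    have hloc : LocallyLipschitzOn Q f := fun x hx => by
      obtain ⟨U, hU, hL⟩ := hK x (hQΩ hx)
      exact ⟨K, U, mem_nhdsWithin_of_mem_nhds hU, hL⟩
    obtain ⟨C, hC⟩ := hloc.exists_lipschitzOnWith_of_compact hQ
    obtain ⟨D, g, hg, hfg⟩ := hC.extend_complex
    have key := hg.integral_fderiv_smul_complex hφ hc v
    rw [← integral_indicator hΩ.measurableSet, ← integral_indicator hΩ.measurableSet]
    have e₁ : Ω.indicator (fun x => fderiv ℝ φ x v • f x) = fun x => fderiv ℝ φ x v • g x := by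
      ext x
      by_cases hx : x ∈ tsupport φ
      · rw [indicator_of_mem (hsupp hx), hfg (interior_subset (hsQ hx))]
      · classical
        simp [indicator_apply, fderiv_eq_zero_of_notMem_tsupport hx]
    have e₂ : Ω.indicator (fun x => φ x • fderiv ℝ f x v) = fun x => φ x • fderiv ℝ g x v := by
      ext x
      by_cases hx : x ∈ tsupport φ
      · have : f =ᶠ[𝓝 x] g := hfg.eventuallyEq_of_mem (mem_interior_iff_mem_nhds.1 (hsQ hx))
        rw [indicator_of_mem (hsupp hx), this.fderiv_eq]
      · classical
        simp [indicator_apply, image_eq_zero_of_notMem_tsupport hx]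
    rw [e₁, e₂, key]

end LipToWeak

theorem Regularity.On.regOn {F : Type*} [NormedAddCommGroup F] [NormedSpace ℝ F]
    [CompleteSpace F] {r : Regularity} {f : V → F} {Ω : Set V} (hΩ : IsOpen Ω)
    (h : r.On f Ω) : RegOn r f Ω := by
  cases r with
  | continuous => exact h
  | w1infty => exact MemW1Infty.unifLocLipOn hΩ h
  | smooth => exact h

theorem RegOn.on {r : Regularity} {f : V → ℂ} {Ω : Set V} (hΩ : IsOpen Ω) (h : RegOn r f Ω)
    {B : ℝ} (hB : ∀ x ∈ Ω, ‖f x‖ ≤ B) : r.On f Ω := by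
  cases r with
  | continuous => exact h
  | w1infty => exact UnifLocLipOn.memW1Infty hΩ h hB
  | smooth => exact h

end Weak

/-! ### Bounds on derivatives of products, series and powers. -/

section DerivBounds

open Set Filter Topology

universe u

/-- All derivatives of `f` up to order `k` are bounded by `B` on `s`. -/
def DerivLE {V F : Type*} [NormedAddCommGroup V] [NormedSpace ℝ V] [NormedAddCommGroup F]
    [NormedSpace ℝ F] (s : Set V) (k : ℕ) (f : V → F) (B : ℝ) : Prop :=
  ∀ j ≤ k, ∀ x ∈ s, ‖iteratedFDeriv ℝ j f x‖ ≤ B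

section Basic

variable {V F G H : Type*} [NormedAddCommGroup V] [NormedSpace ℝ V]
  [NormedAddCommGroup F] [NormedSpace ℝ F] [NormedAddCommGroup G] [NormedSpace ℝ G]
  [NormedAddCommGroup H] [NormedSpace ℝ H] {s : Set V} {k : ℕ}

theorem DerivLE.mono {f : V → F} {a b : ℝ} (h : DerivLE s k f a) (hab : a ≤ b) :
    DerivLE s k f b :=
  fun j hj x hx => (h j hj x hx).trans hab

theorem DerivLE.congr {f g : V → F} {a : ℝ} (h : DerivLE s k f a) {t : Set V} (ht : IsOpen t)
    (hst : s ⊆ t) (hfg : EqOn g f t) : DerivLE s k g a := fun j hj x hx => by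
  have he : g =ᶠ[𝓝 x] f := hfg.eventuallyEq_of_mem (ht.mem_nhds (hst hx))
  rw [(he.iteratedFDeriv ℝ j).self_of_nhds]
  exact h j hj x hx

theorem derivLE_succ_iff {f : V → F} {a : ℝ} :
    DerivLE s (k + 1) f a ↔ (∀ x ∈ s, ‖f x‖ ≤ a) ∧ DerivLE s k (fderiv ℝ f) a := by
  constructor
  · refine fun h => ⟨fun x hx => by simpa using h 0 (by simp) x hx, fun j hj x hx => ?_⟩
    rw [norm_iteratedFDeriv_fderiv]
    exact h (j + 1) (by omega) x hx
  · rintro ⟨h0, h1⟩ j hj x hx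
    cases j with
    | zero => simpa using h0 x hx
    | succ j =>
      rw [← norm_iteratedFDeriv_fderiv]
      exact h1 j (by omega) x hx

/-- Leibniz formula, with the binomial coefficients summing to at most `2 ^ k`. The constant depends
on `B` and `k` alone, so it can be used along infinite families. -/
theorem exists_derivLE_bilin (B : F →L[ℝ] G →L[ℝ] H) (hs : IsOpen s) (k : ℕ) :
    ∃ c : ℝ, 0 ≤ c ∧ ∀ {f : V → F} {g : V → G} {a b : ℝ}, ContDiffOn ℝ ∞ f s →
      ContDiffOn ℝ ∞ g s → DerivLE s k f a → DerivLE s k g b → 0 ≤ a → 0 ≤ b →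
      DerivLE s k (fun x => B (f x) (g x)) (c * a * b) := by
  refine ⟨‖B‖ * 2 ^ k, by positivity, ?_⟩
  intro f g a b hfs hgs hf hg ha hb j hj x hx
  have h := B.norm_iteratedFDerivWithin_le_of_bilinear hfs hgs hs.uniqueDiffOn hx
    (n := j) (by exact_mod_cast le_top)
  rw [iteratedFDerivWithin_of_isOpen j hs hx] at h
  refine h.trans ?_
  have h2 : ∑ i ∈ Finset.range (j + 1), (j.choose i : ℝ) * ‖iteratedFDerivWithin ℝ i f s x‖ *
      ‖iteratedFDerivWithin ℝ (j - i) g s x‖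
      ≤ ∑ i ∈ Finset.range (j + 1), (j.choose i : ℝ) * (a * b) := by
    refine Finset.sum_le_sum fun i hi => ?_
    have hi' : i ≤ j := by simpa [Nat.lt_succ_iff] using hi
    rw [iteratedFDerivWithin_of_isOpen _ hs hx, iteratedFDerivWithin_of_isOpen _ hs hx, mul_assoc]
    gcongr
    · exact hf i (hi'.trans hj) x hx
    · exact hg (j - i) (by omega) x hx
  rw [← Finset.sum_mul] at h2
  have h3 : ∑ i ∈ Finset.range (j + 1), (j.choose i : ℝ) = 2 ^ j := by
    exact_mod_cast Nat.sum_range_choose j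
  rw [h3] at h2
  calc _ ≤ ‖B‖ * (2 ^ j * (a * b)) := by gcongr
    _ ≤ ‖B‖ * (2 ^ k * (a * b)) := by gcongr; norm_num
    _ = _ := by ring

theorem DerivLE.sum {ι : Type*} (t : Finset ι) {f : ι → V → F} {a : ι → ℝ} (hs : IsOpen s)
    (hfs : ∀ i ∈ t, ContDiffOn ℝ ∞ (f i) s) (h : ∀ i ∈ t, DerivLE s k (f i) (a i)) :
    DerivLE s k (fun x => ∑ i ∈ t, f i x) (∑ i ∈ t, a i) := by
  intro j hj x hx
  rw [iteratedFDeriv_fun_sum_apply fun i hi =>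
    ((hfs i hi).contDiffAt (hs.mem_nhds hx)).of_le (by exact_mod_cast le_top)]
  exact norm_sum_le_of_le _ fun i hi => h i hi j hj x hx

theorem ContDiffOn.exists_derivLE {f : V → F} {t : Set V} (hf : ContDiffOn ℝ ∞ f t)
    (ht : IsOpen t) {Q : Set V} (hQ : IsCompact Q) (hQt : Q ⊆ t) (k : ℕ) :
    ∃ B, 0 ≤ B ∧ DerivLE Q k f B := by
  have h : ∀ j : ℕ, ∃ B, ∀ x ∈ Q, ‖iteratedFDeriv ℝ j f x‖ ≤ B := fun j => by
    refine hQ.exists_bound_of_continuousOn ?_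
    have h1 := hf.continuousOn_iteratedFDerivWithin (m := j) (by exact_mod_cast le_top)
      ht.uniqueDiffOn
    exact (h1.congr fun x hx => (iteratedFDerivWithin_of_isOpen j ht hx).symm).mono hQt
  choose B hB using h
  refine ⟨∑ j ∈ Finset.range (k + 1), |B j|, Finset.sum_nonneg fun _ _ => abs_nonneg _,
    fun j hj x hx => ?_⟩
  refine (hB j x hx).trans ((le_abs_self _).trans ?_)
  exact Finset.single_le_sum (f := fun j => |B j|) (fun _ _ => abs_nonneg _)
    (Finset.mem_range.2 (by omega))

end Basic

/-- A series of smooth functions whose derivatives are bounded on the open set `s` by summable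
sequences is smooth on `s`. -/
theorem contDiffOn_tsum_of_derivLE {ι : Type*} {V : Type u} [NormedAddCommGroup V]
    [NormedSpace ℝ V] {s : Set V} (hs : IsOpen s) (hs' : IsPreconnected s) (k : ℕ) :
    ∀ {F : Type u} [NormedAddCommGroup F] [NormedSpace ℝ F] [CompleteSpace F]
      {f : ι → V → F} {a : ι → ℝ}, (∀ i, ContDiffOn ℝ ∞ (f i) s) → Summable a →
      (∀ i, DerivLE s k (f i) (a i)) → ContDiffOn ℝ k (fun x => ∑' i, f i x) s := by
  -- The target space varies in the induction, because the inductive hypothesis is applied to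
  -- differentials, with values in `V →L[ℝ] F`.
  induction k with
  | zero =>
    intro F _ _ _ f a hf ha h
    simp only [Nat.cast_zero, contDiffOn_zero]
    exact continuousOn_tsum (fun i => (hf i).continuousOn) ha fun i x hx => by
      simpa using h i 0 le_rfl x hx
  | succ k ih =>
    intro F _ _ _ f a hf ha h
    have h' := fun i => derivLE_succ_iff.1 (h i)
    have hd : ∀ x ∈ s, HasFDerivAt (fun x => ∑' i, f i x) (∑' i, fderiv ℝ (f i) x) x := by
      intro x hx
      refine hasFDerivAt_tsum_of_isPreconnected ha hs hs' (fun i y hy => ?_) (fun i y hy => ?_)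
        hx ?_ hx
      · exact (((hf i).contDiffAt (hs.mem_nhds hy)).differentiableAt (by simp)).hasFDerivAt
      · simpa using (h' i).2 0 (by simp) y hy
      · exact Summable.of_norm_bounded ha fun i => (h' i).1 x hx
    rw [Nat.cast_add, Nat.cast_one, contDiffOn_succ_iff_fderiv_of_isOpen hs]
    refine ⟨fun x hx => (hd x hx).differentiableAt.differentiableWithinAt, by simp, ?_⟩
    refine (ih (fun i => ?_) ha fun i => (h' i).2).congr fun x hx => (hd x hx).fderiv
    exact (hf i).fderiv_of_isOpen hs (by simp)

section Pow

variable {V R : Type*} [NormedAddCommGroup V] [NormedSpace ℝ V]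
  [NormedRing R] [NormedAlgebra ℝ R]

theorem contDiffOn_pow {s : Set V} {U : V → R} (hU : ContDiffOn ℝ ∞ U s) (n : ℕ) :
    ContDiffOn ℝ ∞ (fun x => U x ^ n) s := by
  induction n with
  | zero => simpa using contDiffOn_const
  | succ n ih =>
    simp only [pow_succ]
    exact ih.mul hU

/-- The derivatives of the powers of a power bounded smooth function grow polynomially. -/
theorem exists_derivLE_pow {s : Set V} (hs : IsOpen s) {U : V → R} (hU : ContDiffOn ℝ ∞ U s)
    {B₀ : ℝ} (hpow : ∀ n : ℕ, ∀ x ∈ s, ‖U x ^ n‖ ≤ B₀)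
    (hder : ∀ k, ∃ B, 0 ≤ B ∧ DerivLE s k U B) (k : ℕ) :
    ∃ (B : ℝ) (p : ℕ), 0 ≤ B ∧ ∀ n : ℕ, DerivLE s k (fun x => U x ^ n) (B * (n + 1 : ℝ) ^ p) := by
  induction k with
  | zero =>
    refine ⟨|B₀|, 0, abs_nonneg _, fun n j hj x hx => ?_⟩
    obtain rfl : j = 0 := by omega
    simpa using (hpow n x hx).trans (le_abs_self _)
  | succ k ih =>
    obtain ⟨B, p, hB, h⟩ := ih
    obtain ⟨D, hD, hUD⟩ := hder (k + 1)
    have hU' := (derivLE_succ_iff.1 hUD).2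
    have hU's : ContDiffOn ℝ ∞ (fderiv ℝ U) s := hU.fderiv_of_isOpen hs (by simp)
    -- Left and right multiplication of a differential by an element of `R`: the differential of `U
    -- ^ n` is a sum of terms `U ^ (n - 1 - i) * DU * U ^ i`.
    let L₁ : R →L[ℝ] (V →L[ℝ] R) →L[ℝ] (V →L[ℝ] R) :=
      (ContinuousLinearMap.compL ℝ V R R).comp (ContinuousLinearMap.mul ℝ R)
    let L₂ : R →L[ℝ] (V →L[ℝ] R) →L[ℝ] (V →L[ℝ] R) :=
      (ContinuousLinearMap.compL ℝ V R R).comp (ContinuousLinearMap.mul ℝ R).flip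
    obtain ⟨c₁, hc₁, hL₁⟩ := exists_derivLE_bilin L₁ hs k
    obtain ⟨c₂, hc₂, hL₂⟩ := exists_derivLE_bilin L₂ hs k
    set E : ℝ := c₁ * B * (c₂ * B * D) with hE
    have hE0 : 0 ≤ E := by positivity
    -- Each of the `n` terms contains two powers of `U`, whose derivatives up to order `k` grow like
    -- `(n + 1) ^ p`; the number of terms adds one to the exponent. The undifferentiated power is
    -- controlled by `B₀`.
    refine ⟨|B₀| + E, 2 * p + 1, by positivity, fun n => derivLE_succ_iff.2 ⟨fun x hx => ?_, ?_⟩⟩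
    · refine (hpow n x hx).trans ((le_abs_self _).trans ?_)
      have : (1 : ℝ) ≤ (n + 1 : ℝ) ^ (2 * p + 1) := one_le_pow₀ (by linarith [n.cast_nonneg (α := ℝ)])
      nlinarith [abs_nonneg B₀]
    · have hform : EqOn (fderiv ℝ fun x => U x ^ n) (fun x => ∑ i ∈ Finset.range n,
          L₁ (U x ^ (n.pred - i)) (L₂ (U x ^ i) (fderiv ℝ U x))) s := by
        intro x hx
        have h1 : HasFDerivAt U (fderiv ℝ U x) x :=
          ((hU.contDiffAt (hs.mem_nhds hx)).differentiableAt (by simp)).hasFDerivAt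
        have h2 := (h1.pow' n).fderiv
        change fderiv ℝ (U ^ n) x = _
        rw [h2]
        refine Finset.sum_congr rfl fun i _ => ?_
        ext v
        simp [L₁, L₂, mul_assoc]
      refine DerivLE.congr ?_ hs subset_rfl hform
      have hsmooth : ∀ i, ContDiffOn ℝ ∞ (fun x => L₂ (U x ^ i) (fderiv ℝ U x)) s := fun i =>
        L₂.isBoundedBilinearMap.contDiff.comp_contDiffOn ((contDiffOn_pow hU i).prodMk hU's)
      refine (DerivLE.sum (a := fun _ => E * (n + 1 : ℝ) ^ (2 * p)) (Finset.range n) hs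
        (fun i _ => ?_) fun i hi => ?_).mono ?_
      · exact L₁.isBoundedBilinearMap.contDiff.comp_contDiffOn
          ((contDiffOn_pow hU _).prodMk (hsmooth i))
      · have hin : i < n := Finset.mem_range.1 hi
        have hmono : ∀ m : ℕ, m ≤ n → DerivLE s k (fun x => U x ^ m) (B * (n + 1 : ℝ) ^ p) :=
          fun m hm => (h m).mono (by gcongr)
        have h2 := hL₂ (contDiffOn_pow hU i) hU's (hmono i hin.le) hU' (by positivity) hD
        have h3 := hL₁ (contDiffOn_pow hU _) (hsmooth i)
          (hmono (n.pred - i) (by simp; omega)) h2 (by positivity) (by positivity)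
        refine h3.mono (le_of_eq ?_)
        rw [hE]; ring
      · rw [Finset.sum_const, Finset.card_range, nsmul_eq_mul, pow_succ]
        have h1 : (0 : ℝ) ≤ (n + 1 : ℝ) ^ (2 * p) := by positivity
        have h2 : (0 : ℝ) ≤ n := n.cast_nonneg
        nlinarith [abs_nonneg B₀, mul_nonneg (abs_nonneg B₀) h1, mul_nonneg hE0 h1,
          mul_nonneg (mul_nonneg (abs_nonneg B₀) h1) h2]

end Pow

end DerivBounds

/-! ### Integrals depending on a parameter. -/

section Parametric

open Set Filter Topology

universe u

theorem contDiffOn_fderiv_comp_inl {V F : Type*} [NormedAddCommGroup V] [NormedSpace ℝ V]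
    [NormedAddCommGroup F] [NormedSpace ℝ F] {s : Set V} (hs : IsOpen s) {h : V × ℝ → F} (hh : ContDiffOn ℝ ∞ h (s ×ˢ univ)) :
    ContDiffOn ℝ ∞ (fun p => (fderiv ℝ h p).comp (ContinuousLinearMap.inl ℝ V ℝ))
      (s ×ˢ univ) :=
  ((ContinuousLinearMap.compL ℝ V (V × ℝ) F).flip
    (ContinuousLinearMap.inl ℝ V ℝ)).contDiff.comp_contDiffOn
    (hh.fderiv_of_isOpen (hs.prod isOpen_univ) (by simp))

variable {V : Type u} [NormedAddCommGroup V] [NormedSpace ℝ V] [FiniteDimensional ℝ V]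
  {s : Set V}

theorem hasFDerivAt_intervalIntegral_of_contDiffOn {F : Type*} [NormedAddCommGroup F]
    [NormedSpace ℝ F] [NormedSpace ℂ F] [IsScalarTower ℝ ℂ F] [CompleteSpace F]
    (hs : IsOpen s) {h : V × ℝ → F} (hh : ContDiffOn ℝ ∞ h (s ×ˢ univ)) {φ : ℝ → ℂ}
    (hφ : Continuous φ) (hφ1 : ∀ θ, ‖φ θ‖ ≤ 1) (a b : ℝ) {x : V} (hx : x ∈ s) :
    HasFDerivAt (fun x => ∫ θ in a..b, φ θ • h (x, θ))
      (∫ θ in a..b, φ θ • (fderiv ℝ h (x, θ)).comp (ContinuousLinearMap.inl ℝ V ℝ)) x := by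
  have hV := FiniteDimensional.proper_real V
  have hsu : IsOpen (s ×ˢ (univ : Set ℝ)) := hs.prod isOpen_univ
  obtain ⟨ε, hε, hball⟩ := Metric.nhds_basis_closedBall.mem_iff.1 (hs.mem_nhds hx)
  have hfc : ContinuousOn (fun p => (fderiv ℝ h p).comp (ContinuousLinearMap.inl ℝ V ℝ))
      (s ×ˢ univ) :=
    ((ContinuousLinearMap.compL ℝ V (V × ℝ) F).flip
      (ContinuousLinearMap.inl ℝ V ℝ)).continuous.comp_continuousOn
      (hh.continuousOn_fderiv_of_isOpen hsu (by simp))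
  have hcont : ∀ y ∈ s, Continuous fun θ : ℝ => h (y, θ) := fun y hy =>
    hh.continuousOn.comp_continuous (by fun_prop) fun θ => ⟨hy, mem_univ _⟩
  have hcont' : Continuous fun θ : ℝ =>
      (fderiv ℝ h (x, θ)).comp (ContinuousLinearMap.inl ℝ V ℝ) :=
    hfc.comp_continuous (f := fun θ : ℝ => (x, θ)) (by fun_prop) fun θ => ⟨hx, mem_univ _⟩
  have hQ : IsCompact (Metric.closedBall x ε ×ˢ uIcc a b) :=
    (isCompact_closedBall _ _).prod isCompact_uIcc
  obtain ⟨C, hC⟩ := hQ.exists_bound_of_continuousOn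
    (hfc.mono (prod_mono hball (subset_univ _)))
  refine intervalIntegral.hasFDerivAt_integral_of_dominated_of_fderiv_le (𝕜 := ℝ)
    (s := Metric.ball x ε) (bound := fun _ => C)
    (F' := fun y θ => φ θ • (fderiv ℝ h (y, θ)).comp (ContinuousLinearMap.inl ℝ V ℝ))
    (Metric.ball_mem_nhds _ hε) ?_ ?_ ?_ ?_ ?_ ?_
  · filter_upwards [hs.mem_nhds hx] with y hy
    exact (hφ.smul (hcont y hy)).aestronglyMeasurable
  · exact (hφ.smul (hcont x hx)).intervalIntegrable _ _
  · exact (hφ.smul hcont').aestronglyMeasurable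
  · refine ae_of_all _ fun θ hθ y hy => ?_
    rw [norm_smul]
    have h1 := hC (y, θ) ⟨Metric.ball_subset_closedBall hy, uIoc_subset_uIcc hθ⟩
    calc _ ≤ 1 * C := by gcongr; exact hφ1 θ
      _ = C := one_mul C
  · exact intervalIntegrable_const
  · refine ae_of_all _ fun θ _ y hy => HasFDerivAt.const_smul ?_ (φ θ)
    have hys : y ∈ s := hball (Metric.ball_subset_closedBall hy)
    have h1 : HasFDerivAt h (fderiv ℝ h (y, θ)) (y, θ) :=
      ((hh.contDiffAt (hsu.mem_nhds ⟨hys, mem_univ _⟩)).differentiableAt (by simp)).hasFDerivAt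
    exact h1.comp y (hasFDerivAt_prodMk_left y θ)

theorem contDiffOn_intervalIntegral_param (hs : IsOpen s) {φ : ℝ → ℂ}
    (hφ : Continuous φ) (hφ1 : ∀ θ, ‖φ θ‖ ≤ 1) (a b : ℝ) (k : ℕ) :
    ∀ {F : Type u} [NormedAddCommGroup F]
      [NormedSpace ℝ F] [NormedSpace ℂ F] [IsScalarTower ℝ ℂ F] [CompleteSpace F]
      {h : V × ℝ → F}, ContDiffOn ℝ ∞ h (s ×ˢ univ) →
      ContDiffOn ℝ k (fun x => ∫ θ in a..b, φ θ • h (x, θ)) s := by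
  induction k with
  | zero =>
    intro F _ _ _ _ _ h hh
    rw [Nat.cast_zero, contDiffOn_zero]
    exact fun x hx => (hasFDerivAt_intervalIntegral_of_contDiffOn hs hh hφ hφ1 a b
      hx).continuousAt.continuousWithinAt
  | succ k ih =>
    intro F _ _ _ _ _ h hh
    have hd := fun x hx =>
      hasFDerivAt_intervalIntegral_of_contDiffOn hs hh hφ hφ1 a b (x := x) hx
    rw [Nat.cast_add, Nat.cast_one, contDiffOn_succ_iff_fderiv_of_isOpen hs]
    exact ⟨fun x hx => (hd x hx).differentiableAt.differentiableWithinAt, by simp,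
      (ih (contDiffOn_fderiv_comp_inl hs hh)).congr fun x hx => (hd x hx).fderiv⟩

/-- One constant serves all weights of modulus at most one, hence all Fourier characters at once. -/
theorem exists_derivLE_intervalIntegral_param (hs : IsOpen s) {Q : Set V} (hQ : IsCompact Q)
    (hQs : Q ⊆ s) (a b : ℝ) (k : ℕ) :
    ∀ {F : Type u} [NormedAddCommGroup F]
      [NormedSpace ℝ F] [NormedSpace ℂ F] [IsScalarTower ℝ ℂ F] [CompleteSpace F]
      {h : V × ℝ → F}, ContDiffOn ℝ ∞ h (s ×ˢ univ) →
      ∃ C : ℝ, 0 ≤ C ∧ ∀ φ : ℝ → ℂ, Continuous φ → (∀ θ, ‖φ θ‖ ≤ 1) →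
        DerivLE Q k (fun x => ∫ θ in a..b, φ θ • h (x, θ)) C := by
  have base : ∀ {F : Type u} [NormedAddCommGroup F]
      [NormedSpace ℝ F] [NormedSpace ℂ F] [IsScalarTower ℝ ℂ F] [CompleteSpace F]
      {h : V × ℝ → F}, ContDiffOn ℝ ∞ h (s ×ˢ univ) →
      ∃ C : ℝ, 0 ≤ C ∧ ∀ φ : ℝ → ℂ, Continuous φ → (∀ θ, ‖φ θ‖ ≤ 1) →
        ∀ x ∈ Q, ‖∫ θ in a..b, φ θ • h (x, θ)‖ ≤ C := by
    intro F _ _ _ _ _ h hh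
    obtain ⟨C, hC⟩ := (hQ.prod (isCompact_uIcc (a := a) (b := b))).exists_bound_of_continuousOn
      (hh.continuousOn.mono (prod_mono hQs (subset_univ _)))
    refine ⟨|C| * |b - a|, by positivity, fun φ hφ hφ1 x hx => ?_⟩
    refine intervalIntegral.norm_integral_le_of_norm_le_const fun θ hθ => ?_
    rw [norm_smul]
    have h1 := hC (x, θ) ⟨hx, uIoc_subset_uIcc hθ⟩
    calc _ ≤ 1 * |C| := by gcongr; exacts [hφ1 θ, h1.trans (le_abs_self C)]
      _ = |C| := one_mul _
  induction k with
  | zero =>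
    intro F _ _ _ _ _ h hh
    obtain ⟨C, hC0, hC⟩ := base hh
    refine ⟨C, hC0, fun φ hφ hφ1 j hj x hx => ?_⟩
    obtain rfl : j = 0 := by omega
    simpa using hC φ hφ hφ1 x hx
  | succ k ih =>
    intro F _ _ _ _ _ h hh
    obtain ⟨C, hC0, hC⟩ := base hh
    obtain ⟨D, hD0, hD⟩ := ih (contDiffOn_fderiv_comp_inl hs hh)
    refine ⟨max C D, le_max_of_le_left hC0, fun φ hφ hφ1 => derivLE_succ_iff.2
      ⟨fun x hx => (hC φ hφ hφ1 x hx).trans (le_max_left _ _), ?_⟩⟩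
    exact ((hD φ hφ hφ1).mono (le_max_right _ _)).congr hs hQs fun x hx =>
      (hasFDerivAt_intervalIntegral_of_contDiffOn hs hh hφ hφ1 a b hx).fderiv

end Parametric

/-! ### Fourier series in an angle, with parameters. -/

section FourierCoefficients

open Set Filter Topology

theorem hasDerivAt_snd_of_contDiffOn {V : Type*} [NormedAddCommGroup V] [NormedSpace ℝ V] {s : Set V}
    (hs : IsOpen s) {g : V × ℝ → ℂ}
    (hg : ContDiffOn ℝ ∞ g (s ×ˢ univ)) {x : V} (hx : x ∈ s) (θ : ℝ) :
    HasDerivAt (fun θ => g (x, θ)) (fderiv ℝ g (x, θ) (0, 1)) θ := by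
  have h1 : HasFDerivAt g (fderiv ℝ g (x, θ)) (x, θ) :=
    ((hg.contDiffAt ((hs.prod isOpen_univ).mem_nhds ⟨hx, mem_univ _⟩)).differentiableAt
      (by simp)).hasFDerivAt
  exact h1.comp_hasDerivAt θ ((hasDerivAt_const θ x).prodMk (hasDerivAt_id θ))

variable {V : Type} [NormedAddCommGroup V] [NormedSpace ℝ V] [FiniteDimensional ℝ V]
  {s : Set V}

theorem DerivLE.const_smul {V F : Type*} [NormedAddCommGroup V] [NormedSpace ℝ V]
    [NormedAddCommGroup F] [NormedSpace ℝ F] [NormedSpace ℂ F] [IsScalarTower ℝ ℂ F]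
    {s t : Set V} {k : ℕ} {f : V → F} {a : ℝ} (hs : IsOpen s) (hts : t ⊆ s)
    (hf : ContDiffOn ℝ ∞ f s) (h : DerivLE t k f a) (c : ℂ) :
    DerivLE t k (fun x => c • f x) (‖c‖ * a) := fun j hj x hx => by
  have h1 : ContDiffAt ℝ j f x :=
    (hf.contDiffAt (hs.mem_nhds (hts hx))).of_le (by exact_mod_cast le_top)
  rw [iteratedFDeriv_const_smul_apply' h1, norm_smul]
  gcongr
  exact h j hj x hx

/-- The Fourier coefficients of `θ ↦ g (x, θ)` on `[0, π]`, as functions of the parameter `x`. -/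
noncomputable def paramFourierCoeff {V : Type*} (g : V × ℝ → ℂ) (n : ℤ) (x : V) : ℂ :=
  fourierCoeffOn Real.pi_pos (fun θ => g (x, θ)) n

theorem paramFourierCoeff_eq {V : Type*} (g : V × ℝ → ℂ) (n : ℤ) (x : V) :
    paramFourierCoeff g n x = ((1 / (Real.pi - 0) : ℝ) : ℂ) •
      ∫ θ in (0 : ℝ)..Real.pi, (fourier (-n) (θ : AddCircle (Real.pi - 0)) : ℂ) • g (x, θ) := by
  rw [paramFourierCoeff, fourierCoeffOn_eq_integral, Complex.coe_smul]

theorem continuous_fourier_coe (n : ℤ) :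
    Continuous fun θ : ℝ => (fourier n (θ : AddCircle (Real.pi - 0)) : ℂ) :=
  (fourier n).continuous.comp (AddCircle.continuous_mk' _)

theorem norm_fourier_coe_le (n : ℤ) (θ : ℝ) :
    ‖(fourier n (θ : AddCircle (Real.pi - 0)) : ℂ)‖ ≤ 1 := by
  rw [fourier_apply]
  exact (Circle.norm_coe _).le

theorem contDiffOn_paramFourierCoeff (hs : IsOpen s) {g : V × ℝ → ℂ}
    (hg : ContDiffOn ℝ ∞ g (s ×ˢ univ)) (n : ℤ) : ContDiffOn ℝ ∞ (paramFourierCoeff g n) s := by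
  rw [contDiffOn_infty]
  intro k
  have h := contDiffOn_intervalIntegral_param hs (continuous_fourier_coe (-n))
    (norm_fourier_coe_le (-n)) 0 Real.pi k hg
  exact (h.const_smul ((1 / (Real.pi - 0) : ℝ) : ℂ)).congr fun x _ => paramFourierCoeff_eq g n x

/-- The Fourier coefficients of a smooth periodic function decay rapidly, with all their
derivatives in the parameter. -/
theorem exists_derivLE_paramFourierCoeff (hs : IsOpen s) {Q : Set V} (hQ : IsCompact Q)
    (hQs : Q ⊆ s) (k l : ℕ) : ∀ {g : V × ℝ → ℂ}, ContDiffOn ℝ ∞ g (s ×ˢ univ) →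
      (∀ x ∈ s, ∀ θ, g (x, θ + Real.pi) = g (x, θ)) →
      ∃ C : ℝ, 0 ≤ C ∧ ∀ n : ℤ, DerivLE Q k (paramFourierCoeff g n) (C / (|(n : ℝ)| + 1) ^ l) := by
  induction l with
  | zero =>
    intro g hg hper
    obtain ⟨C, hC0, hC⟩ := exists_derivLE_intervalIntegral_param hs hQ hQs 0 Real.pi k hg
    refine ⟨‖((1 / (Real.pi - 0) : ℝ) : ℂ)‖ * C, by positivity, fun n => ?_⟩
    have h1 := hC _ (continuous_fourier_coe (-n)) (norm_fourier_coe_le (-n))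
    have h2 := h1.const_smul hs hQs (contDiffOn_infty.2 fun k =>
      contDiffOn_intervalIntegral_param hs (continuous_fourier_coe (-n))
        (norm_fourier_coe_le (-n)) 0 Real.pi k hg) ((1 / (Real.pi - 0) : ℝ) : ℂ)
    rw [pow_zero, div_one]
    exact h2.congr hs hQs fun x _ => paramFourierCoeff_eq g n x
  | succ l ih =>
    intro g hg hper
    set g' : V × ℝ → ℂ := fun p => fderiv ℝ g p (0, 1) with hg'
    have hg's : ContDiffOn ℝ ∞ g' (s ×ˢ univ) :=
      (hg.fderiv_of_isOpen (hs.prod isOpen_univ) (by simp)).clm_apply contDiffOn_const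
    have hper' : ∀ x ∈ s, ∀ θ, g' (x, θ + Real.pi) = g' (x, θ) := fun x hx θ => by
      have h1 := (hasDerivAt_snd_of_contDiffOn hs hg hx (θ + Real.pi)).comp_add_const θ Real.pi
      have h2 : (fun θ => g (x, θ + Real.pi)) = fun θ => g (x, θ) := funext (hper x hx)
      rw [h2] at h1
      exact h1.unique (hasDerivAt_snd_of_contDiffOn hs hg hx θ)
    obtain ⟨C₀, hC₀, h₀⟩ := exists_derivLE_intervalIntegral_param hs hQ hQs 0 Real.pi k hg
    obtain ⟨C, hC0, hC⟩ := ih hg's hper'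
    refine ⟨max (‖((1 / (Real.pi - 0) : ℝ) : ℂ)‖ * C₀) C, le_max_of_le_right hC0, fun n => ?_⟩
    by_cases hn : n = 0
    · subst hn
      have h1 := h₀ _ (continuous_fourier_coe (-0)) (norm_fourier_coe_le (-0))
      have h2 := h1.const_smul hs hQs (contDiffOn_infty.2 fun k =>
        contDiffOn_intervalIntegral_param hs (continuous_fourier_coe (-0))
          (norm_fourier_coe_le (-0)) 0 Real.pi k hg) ((1 / (Real.pi - 0) : ℝ) : ℂ)
      refine (h2.mono ?_).congr hs hQs fun x _ => paramFourierCoeff_eq g 0 x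
      simp
    -- Integration by parts in `θ`, without boundary term by periodicity, gains the factor `1 / (2 *
    -- |n|)`. Since `|n| ≥ 1`, it is at most `1 / (|n| + 1)`, and the decay improves by one order.
    · have hform : EqOn (paramFourierCoeff g n)
          (fun x => ((Real.pi : ℂ) / (2 * Real.pi * Complex.I * n)) • paramFourierCoeff g' n x)
          s := by
        intro x hx
        have h1 := fourierCoeffOn_of_hasDerivAt Real.pi_pos hn
          (fun θ _ => hasDerivAt_snd_of_contDiffOn hs hg hx θ)
          (Continuous.intervalIntegrable (hg's.continuousOn.comp_continuous
            (f := fun θ : ℝ => (x, θ)) (by fun_prop) fun θ => ⟨hx, mem_univ _⟩) _ _)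
        have h2 : g (x, Real.pi) = g (x, 0) := by simpa using hper x hx 0
        rw [paramFourierCoeff, h1, h2]
        simp only [paramFourierCoeff, hg', smul_eq_mul, sub_self, mul_zero, zero_sub,
          Complex.ofReal_zero, sub_zero]
        ring
      refine DerivLE.congr ?_ hs hQs hform
      refine ((hC n).const_smul hs hQs (contDiffOn_paramFourierCoeff hs hg's n) _).mono ?_
      have hn1 : (1 : ℝ) ≤ |(n : ℝ)| := by exact_mod_cast Int.one_le_abs hn
      have hnorm : ‖(Real.pi : ℂ) / (2 * Real.pi * Complex.I * n)‖ = 1 / (2 * |(n : ℝ)|) := by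
        simp only [norm_div, norm_mul, Complex.norm_real, Complex.norm_I, Complex.norm_intCast,
          Complex.norm_ofNat, Real.norm_of_nonneg Real.pi_pos.le]
        field_simp
      rw [hnorm]
      calc 1 / (2 * |(n : ℝ)|) * (C / (|(n : ℝ)| + 1) ^ l)
          ≤ 1 / (|(n : ℝ)| + 1) * (C / (|(n : ℝ)| + 1) ^ l) := by gcongr; linarith
        _ = C / (|(n : ℝ)| + 1) ^ (l + 1) := by rw [pow_succ]; field_simp
        _ ≤ _ := by gcongr; exact le_max_right _ _

theorem summable_int_div_abs_add_one_sq (C : ℝ) :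
    Summable fun n : ℤ => C / (|(n : ℝ)| + 1) ^ 2 := by
  have h : Summable fun n : ℕ => C / ((n : ℝ) + 1) ^ 2 := by
    have h1 := (summable_nat_add_iff 1).2 (Real.summable_one_div_nat_pow.2 one_lt_two)
    refine (h1.mul_left C).congr fun n => ?_
    push_cast
    ring
  refine Summable.of_nat_of_neg (h.congr fun n => ?_) (h.congr fun n => ?_) <;> simp

/-- With period `π`, the characters are the integer powers of `exp (2 i θ)`. Decay of order two
makes the coefficients summable. -/
theorem hasSum_paramFourierCoeff (hs : IsOpen s) {g : V × ℝ → ℂ}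
    (hg : ContDiffOn ℝ ∞ g (s ×ˢ univ))
    (hper : ∀ x ∈ s, ∀ θ, g (x, θ + Real.pi) = g (x, θ)) {x : V} (hx : x ∈ s) (θ : ℝ) :
    HasSum (fun n : ℤ => paramFourierCoeff g n x * Complex.exp (2 * θ * Complex.I) ^ n)
      (g (x, θ)) := by
  have hT : (0 : ℝ) < Real.pi - 0 := by simpa using Real.pi_pos
  have : Fact ((0 : ℝ) < Real.pi - 0) := ⟨hT⟩
  have hp : Function.Periodic (fun θ => g (x, θ)) (Real.pi - 0) := by
    rw [sub_zero]; exact hper x hx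
  have hcont : Continuous fun θ => g (x, θ) :=
    hg.continuousOn.comp_continuous (by fun_prop) fun θ => ⟨hx, mem_univ _⟩
  let G : C(AddCircle (Real.pi - 0), ℂ) := ⟨hp.lift, continuous_coinduced_dom.2 hcont⟩
  have hcoef : ∀ n, fourierCoeff G n = paramFourierCoeff g n x := fun n => by
    rw [fourierCoeff_eq_intervalIntegral G n 0, paramFourierCoeff_eq, Complex.coe_smul]
    congr 2
    simp
  obtain ⟨C, hC0, hC⟩ := exists_derivLE_paramFourierCoeff hs (isCompact_singleton (x := x))
    (singleton_subset_iff.2 hx) 0 2 hg hper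
  have hsum : Summable (fourierCoeff G) := by
    refine Summable.of_norm_bounded (summable_int_div_abs_add_one_sq C) fun n => ?_
    rw [hcoef]
    simpa using hC n 0 le_rfl x rfl
  have h := has_pointwise_sum_fourier_series_of_summable hsum (θ : AddCircle (Real.pi - 0))
  have hG : G (θ : AddCircle (Real.pi - 0)) = g (x, θ) := rfl
  rw [hG] at h
  convert h using 2 with n
  rw [hcoef, smul_eq_mul, fourier_coe_apply, ← Complex.exp_int_mul]
  congr 2
  have : (Real.pi : ℂ) ≠ 0 := by exact_mod_cast Real.pi_ne_zero
  push_cast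
  rw [sub_zero]
  field_simp

/-- Rapid decay of the coefficients beats the polynomial growth of the derivatives of powers. In the
application `U'` is the inverse of `U`; at most one of the exponents `n.toNat` and `(-n).toNat` is
nonzero, so the product stands for `U ^ n`. -/
theorem contDiffOn_tsum_fourier_pow {R : Type} [NormedRing R] [NormedAlgebra ℝ R]
    [CompleteSpace R] (J : ℂ →L[ℝ] R →L[ℝ] R) (hs : IsOpen s) {g : V × ℝ → ℂ}
    (hg : ContDiffOn ℝ ∞ g (s ×ˢ univ))
    (hper : ∀ x ∈ s, ∀ θ, g (x, θ + Real.pi) = g (x, θ)) {U U' : V → R}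
    (hU : ContDiffOn ℝ ∞ U s) (hU' : ContDiffOn ℝ ∞ U' s) {B : ℝ}
    (hpow : ∀ n : ℕ, ∀ x ∈ s, ‖U x ^ n‖ ≤ B) (hpow' : ∀ n : ℕ, ∀ x ∈ s, ‖U' x ^ n‖ ≤ B) :
    ContDiffOn ℝ ∞ (fun x => ∑' n : ℤ,
      J (paramFourierCoeff g n x) (U x ^ n.toNat * U' x ^ (-n).toNat)) s := by
  rw [contDiffOn_infty]
  refine fun k x₀ hx₀ => ContDiffAt.contDiffWithinAt ?_
  have hV := FiniteDimensional.proper_real V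
  obtain ⟨ε, hε, hball⟩ := Metric.nhds_basis_closedBall.mem_iff.1 (hs.mem_nhds hx₀)
  have hQ : IsCompact (Metric.closedBall x₀ ε) := isCompact_closedBall _ _
  set t := Metric.ball x₀ ε with ht
  have hto : IsOpen t := Metric.isOpen_ball
  have htQ : t ⊆ Metric.closedBall x₀ ε := Metric.ball_subset_closedBall
  have hts : t ⊆ s := htQ.trans hball
  have hpoly : ∀ {W : V → R}, ContDiffOn ℝ ∞ W s → (∀ n : ℕ, ∀ x ∈ s, ‖W x ^ n‖ ≤ B) →
      ∃ (D : ℝ) (p : ℕ), 0 ≤ D ∧ ∀ n : ℕ, DerivLE t k (fun x => W x ^ n) (D * (n + 1 : ℝ) ^ p) :=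
    fun {W} hW hWp => exists_derivLE_pow hto (hW.mono hts) (fun n x hx => hWp n x (hts hx))
      (fun j => by
        obtain ⟨D, hD, h⟩ := hW.exists_derivLE hs hQ hball j
        exact ⟨D, hD, fun i hi x hx => h i hi x (htQ hx)⟩) k
  obtain ⟨D₁, p₁, hD₁, h₁⟩ := hpoly hU hpow
  obtain ⟨D₂, p₂, hD₂, h₂⟩ := hpoly hU' hpow'
  -- Of the decay, `p₁ + p₂` orders absorb the growth of the two powers and the remaining two make
  -- the series summable.
  obtain ⟨C, hC, h₃⟩ := exists_derivLE_paramFourierCoeff hs hQ hball k (p₁ + p₂ + 2) hg hper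
  obtain ⟨c₁, hc₁, hb₁⟩ := exists_derivLE_bilin (ContinuousLinearMap.mul ℝ R) hto k
  obtain ⟨c₂, hc₂, hb₂⟩ := exists_derivLE_bilin J hto k
  have hUn := fun n => (contDiffOn_pow hU n).mono hts
  have hUn' := fun n => (contDiffOn_pow hU' n).mono hts
  have hprod : ∀ n m : ℕ, ContDiffOn ℝ ∞ (fun x => U x ^ n * U' x ^ m) t := fun n m =>
    (hUn n).mul (hUn' m)
  have hcoef := fun n => (contDiffOn_paramFourierCoeff hs hg n).mono hts
  refine (contDiffOn_tsum_of_derivLE hto (convex_ball x₀ ε).isPreconnected k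
    (a := fun n : ℤ => (c₂ * C * (c₁ * D₁ * D₂)) / (|(n : ℝ)| + 1) ^ 2) (fun n => ?_)
    (summable_int_div_abs_add_one_sq _) fun n => ?_).contDiffAt (hto.mem_nhds
      (Metric.mem_ball_self hε))
  · exact J.isBoundedBilinearMap.contDiff.comp_contDiffOn ((hcoef n).prodMk (hprod _ _))
  · have habs : ((n.toNat : ℕ) : ℝ) ≤ |(n : ℝ)| ∧ (((-n).toNat : ℕ) : ℝ) ≤ |(n : ℝ)| := by
      constructor
      · rw [← Int.cast_abs]
        exact_mod_cast (show (n.toNat : ℤ) ≤ |n| by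
          rw [Int.ofNat_toNat]; exact max_le (le_abs_self n) (abs_nonneg n))
      · rw [← Int.cast_abs]
        exact_mod_cast (show ((-n).toNat : ℤ) ≤ |n| by
          rw [Int.ofNat_toNat]; exact max_le (neg_le_abs n) (abs_nonneg n))
    have e₁ : DerivLE t k (fun x => U x ^ n.toNat) (D₁ * (|(n : ℝ)| + 1) ^ p₁) :=
      (h₁ _).mono (by gcongr; exact habs.1)
    have e₂ : DerivLE t k (fun x => U' x ^ (-n).toNat) (D₂ * (|(n : ℝ)| + 1) ^ p₂) :=
      (h₂ _).mono (by gcongr; exact habs.2)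
    have e₃ : DerivLE t k (paramFourierCoeff g n) (C / (|(n : ℝ)| + 1) ^ (p₁ + p₂ + 2)) :=
      fun i hi x hx => h₃ n i hi x (htQ hx)
    have e₄ := hb₁ (hUn _) (hUn' _) e₁ e₂ (by positivity) (by positivity)
    have e₅ := hb₂ (hcoef n) (hprod _ _) e₃ e₄ (by positivity) (by positivity)
    refine e₅.mono (le_of_eq ?_)
    rw [pow_add, pow_add]
    field_simp

end FourierCoefficients

/-! ### Regularity of sums over the spectrum. -/

section SpectralResolution

open Set Filter Topology

/-- `P λ`, `λ ∈ Λ`, are complementary projectors on eigenspaces of `M`, with real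
eigenvalues `λ`. -/
structure IsSpectralResolution {R : Type*} [Ring R] [Algebra ℂ R] (M : R) (Λ : Finset ℝ)
    (P : ℝ → R) : Prop where
  sum_eq_one : ∑ l ∈ Λ, P l = 1
  idem : ∀ l ∈ Λ, P l * P l = P l
  orthogonal : ∀ l ∈ Λ, ∀ l' ∈ Λ, l ≠ l' → P l * P l' = 0
  mul_left : ∀ l ∈ Λ, M * P l = (l : ℂ) • P l
  mul_right : ∀ l ∈ Λ, P l * M = (l : ℂ) • P l

namespace IsSpectralResolution

section Algebra

variable {R : Type*} [Ring R] [Algebra ℂ R] {M : R} {Λ : Finset ℝ} {P : ℝ → R}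

theorem sum_mul_sum (h : IsSpectralResolution M Λ P) (f g : ℝ → ℂ) :
    (∑ l ∈ Λ, f l • P l) * ∑ l ∈ Λ, g l • P l = ∑ l ∈ Λ, (f l * g l) • P l := by
  rw [Finset.sum_mul]
  refine Finset.sum_congr rfl fun l hl => ?_
  rw [Finset.mul_sum, Finset.sum_eq_single_of_mem l hl]
  · rw [smul_mul_smul_comm, h.idem l hl]
  · intro l' hl' hne
    rw [smul_mul_smul_comm, h.orthogonal l hl l' hl' hne.symm, smul_zero]

theorem sum_pow (h : IsSpectralResolution M Λ P) (f : ℝ → ℂ) (n : ℕ) :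
    (∑ l ∈ Λ, f l • P l) ^ n = ∑ l ∈ Λ, f l ^ n • P l := by
  induction n with
  | zero => simp [h.sum_eq_one]
  | succ n ih =>
    rw [pow_succ, ih, h.sum_mul_sum]
    simp only [pow_succ]

theorem eq_sum (h : IsSpectralResolution M Λ P) : M = ∑ l ∈ Λ, (l : ℂ) • P l := by
  rw [← mul_one M, ← h.sum_eq_one, Finset.mul_sum]
  exact Finset.sum_congr rfl h.mul_left

theorem one_add_smul (h : IsSpectralResolution M Λ P) (c : ℂ) :
    1 + c • M = ∑ l ∈ Λ, (1 + c * l) • P l := by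
  have := h.eq_sum
  conv_lhs => rw [this, ← h.sum_eq_one]
  simp only [add_smul, one_smul, Finset.sum_add_distrib, Finset.smul_sum, smul_smul]

theorem one_add_smul_mul_inv (h : IsSpectralResolution M Λ P) {c : ℂ}
    (hc : ∀ l : ℝ, 1 + c * l ≠ 0) :
    (1 + c • M) * ∑ l ∈ Λ, (1 + c * l)⁻¹ • P l = 1 ∧
      (∑ l ∈ Λ, (1 + c * l)⁻¹ • P l) * (1 + c • M) = 1 := by
  rw [h.one_add_smul c, h.sum_mul_sum (fun l => 1 + c * l) (fun l => (1 + c * l)⁻¹),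
    h.sum_mul_sum (fun l => (1 + c * l)⁻¹) (fun l => 1 + c * l)]
  simp [hc, h.sum_eq_one]

theorem isUnit_one_add_smul (h : IsSpectralResolution M Λ P) {c : ℂ}
    (hc : ∀ l : ℝ, 1 + c * l ≠ 0) : IsUnit (1 + c • M) :=
  ⟨⟨_, _, (h.one_add_smul_mul_inv hc).1, (h.one_add_smul_mul_inv hc).2⟩, rfl⟩

theorem inverse_one_add_smul (h : IsSpectralResolution M Λ P) {c : ℂ}
    (hc : ∀ l : ℝ, 1 + c * l ≠ 0) :
    Ring.inverse (1 + c • M) = ∑ l ∈ Λ, (1 + c * l)⁻¹ • P l := by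
  have h1 := h.one_add_smul_mul_inv hc
  exact Ring.inverse_unit (⟨_, _, h1.1, h1.2⟩ : Rˣ)

end Algebra

section Normed

variable {R : Type*} [NormedRing R] [NormedAlgebra ℂ R] {M M' : R} {Λ Λ' : Finset ℝ}
  {P P' : ℝ → R}

theorem norm_sum_smul_le {C B : ℝ} {f : ℝ → ℂ} (hP : ∀ l ∈ Λ, ‖P l‖ ≤ C)
    (hf : ∀ l ∈ Λ, ‖f l‖ ≤ B) : ‖∑ l ∈ Λ, f l • P l‖ ≤ Λ.card * (B * C) := by
  refine (norm_sum_le_of_le (f := fun l => f l • P l) (n := fun _ => B * C) Λ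
    fun l hl => ?_).trans (by simp)
  rw [norm_smul]
  have := (norm_nonneg _).trans (hf l hl)
  gcongr
  exacts [hf l hl, hP l hl]

/-- Inserting `∑ P' l' = 1` and `∑ P l = 1` turns the difference into a double sum of `(f l - f' l')
• (P l * P' l')`. Since `(l - l') P l P' l' = P l (M - M') P' l'`, a factor `|l - l'|` is paid for
by `‖M - M'‖`. No matching or separation of eigenvalues is needed, only bounded projectors. -/
theorem norm_sum_sub_sum_le (h : IsSpectralResolution M Λ P) (h' : IsSpectralResolution M' Λ' P')
    {C ε A : ℝ} (hC : 0 ≤ C) (hε : 0 ≤ ε) (hA : 0 ≤ A) {f f' : ℝ → ℂ}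
    (hP : ∀ l ∈ Λ, ‖P l‖ ≤ C) (hP' : ∀ l ∈ Λ', ‖P' l‖ ≤ C)
    (hf : ∀ l ∈ Λ, ∀ l' ∈ Λ', ‖f l - f' l'‖ ≤ ε + A * |l - l'|) :
    ‖∑ l ∈ Λ, f l • P l - ∑ l ∈ Λ', f' l • P' l‖
      ≤ Λ.card * (Λ'.card * (C ^ 2 * (ε + A * ‖M - M'‖))) := by
  have e : ∑ l ∈ Λ, f l • P l - ∑ l ∈ Λ', f' l • P' l
      = ∑ l ∈ Λ, ∑ l' ∈ Λ', (f l - f' l') • (P l * P' l') := by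
    simp only [sub_smul, Finset.sum_sub_distrib]
    congr 1
    · refine Finset.sum_congr rfl fun l _ => ?_
      rw [← Finset.smul_sum, ← Finset.mul_sum, h'.sum_eq_one, mul_one]
    · rw [Finset.sum_comm]
      refine Finset.sum_congr rfl fun l _ => ?_
      rw [← Finset.smul_sum, ← Finset.sum_mul, h.sum_eq_one, one_mul]
  rw [e]
  have hterm : ∀ l ∈ Λ, ∀ l' ∈ Λ', ‖(f l - f' l') • (P l * P' l')‖
      ≤ C ^ 2 * (ε + A * ‖M - M'‖) := by
    intro l hl l' hl'
    have h1 : ‖P l * P' l'‖ ≤ C ^ 2 := by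
      rw [sq]
      exact (norm_mul_le _ _).trans (mul_le_mul (hP l hl) (hP' l' hl') (norm_nonneg _) hC)
    have h2 : |l - l'| * ‖P l * P' l'‖ ≤ C ^ 2 * ‖M - M'‖ := by
      have h3 : P l * (M - M') * P' l' = ((l - l' : ℝ) : ℂ) • (P l * P' l') := by
        rw [mul_sub, sub_mul, h.mul_right l hl, mul_assoc (P l) M', h'.mul_left l' hl',
          smul_mul_assoc, mul_smul_comm, ← sub_smul]
        push_cast
        rfl
      have h4 : |l - l'| * ‖P l * P' l'‖ = ‖P l * (M - M') * P' l'‖ := by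
        rw [h3, norm_smul, Complex.norm_real, Real.norm_eq_abs]
      rw [h4]
      calc ‖P l * (M - M') * P' l'‖ ≤ ‖P l‖ * ‖M - M'‖ * ‖P' l'‖ := by
            refine (norm_mul_le _ _).trans ?_
            gcongr
            exact norm_mul_le _ _
        _ ≤ C * ‖M - M'‖ * C := by
            gcongr
            exacts [hP l hl, hP' l' hl']
        _ = C ^ 2 * ‖M - M'‖ := by ring
    rw [norm_smul]
    calc ‖f l - f' l'‖ * ‖P l * P' l'‖ ≤ (ε + A * |l - l'|) * ‖P l * P' l'‖ := by
          gcongr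
          exact hf l hl l' hl'
      _ = ε * ‖P l * P' l'‖ + A * (|l - l'| * ‖P l * P' l'‖) := by ring
      _ ≤ ε * C ^ 2 + A * (C ^ 2 * ‖M - M'‖) := by gcongr
      _ = _ := by ring
  refine (norm_sum_le_of_le (n := fun _ => Λ'.card * (C ^ 2 * (ε + A * ‖M - M'‖))) Λ
    fun l hl => ?_).trans (by simp)
  exact (norm_sum_le_of_le (n := fun _ => C ^ 2 * (ε + A * ‖M - M'‖)) Λ'
    fun l' hl' => hterm l hl l' hl').trans (by simp)

end Normed

end IsSpectralResolution

theorem one_add_I_mul_ofReal_ne_zero (l : ℝ) : 1 + Complex.I * l ≠ 0 := fun h => by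
  simpa using congrArg Complex.re h

theorem one_sub_I_mul_ofReal_ne_zero (l : ℝ) : 1 + -Complex.I * l ≠ 0 := fun h => by
  simpa using congrArg Complex.re h

/-- At the angle `-arctan l` the basic character is the Cayley transform of `l`; Fourier series in
the angle thus become series in powers of the Cayley transform of `M`. -/
theorem exp_two_mul_neg_arctan (l : ℝ) :
    Complex.exp (2 * ((-Real.arctan l : ℝ) : ℂ) * Complex.I)
      = (1 + -Complex.I * l) * (1 + Complex.I * l)⁻¹ := by
  set t := Real.arctan l with ht
  have hc : Real.cos t ≠ 0 := (Real.cos_arctan_pos l).ne'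
  have hl : (l : ℂ) = Complex.sin t / Complex.cos t := by
    rw [← Real.tan_arctan l, ← ht, Complex.ofReal_tan, Complex.tan_eq_sin_div_cos]
  have hc' : Complex.cos (t : ℂ) ≠ 0 := by
    rw [← Complex.ofReal_cos]; exact_mod_cast hc
  have hne := one_add_I_mul_ofReal_ne_zero l
  rw [← div_eq_mul_inv, eq_div_iff hne, hl]
  have h1 : 2 * ((-t : ℝ) : ℂ) * Complex.I = (-t : ℂ) * Complex.I + (-t : ℂ) * Complex.I := by
    push_cast; ring
  have hsc := Complex.sin_sq_add_cos_sq (t : ℂ)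
  rw [h1, Complex.exp_add, Complex.exp_mul_I, Complex.cos_neg, Complex.sin_neg]
  field_simp
  linear_combination (Complex.cos t - Complex.I * Complex.sin t) * hsc
    + (- Complex.sin t ^ 2 * (Complex.cos t - Complex.I * Complex.sin t)) * Complex.I_sq

theorem norm_exp_two_mul_neg_arctan (θ : ℝ) : ‖Complex.exp (2 * (θ : ℂ) * Complex.I)‖ = 1 := by
  rw [show 2 * (θ : ℂ) * Complex.I = ((2 * θ : ℝ) : ℂ) * Complex.I by push_cast; ring]
  exact Complex.norm_exp_ofReal_mul_I _

theorem Real.abs_arctan_sub_le (x y : ℝ) : |Real.arctan x - Real.arctan y| ≤ |x - y| := by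
  have h := lipschitzWith_of_nnnorm_deriv_le (C := 1) Real.differentiable_arctan fun x => by
    rw [Real.deriv_arctan, ← NNReal.coe_le_coe, coe_nnnorm, Real.norm_of_nonneg (by positivity)]
    exact (div_le_one (by positivity)).2 (by nlinarith [sq_nonneg x])
  simpa [Real.dist_eq] using h.dist_le_mul x y

section Regularity

variable {V : Type} [NormedAddCommGroup V] [NormedSpace ℝ V]
  {R : Type} [NormedRing R] [NormedAlgebra ℂ R] {Ω : Set V} {M : V → R} {Λ : V → Finset ℝ}
  {P : V → ℝ → R} {g : V × ℝ → ℂ} {C : ℝ} {n : ℕ}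

theorem continuousOn_spectral_sum [FiniteDimensional ℝ V] (hΩ : IsOpen Ω) (hM : ContinuousOn M Ω)
    (hP : ∀ x ∈ Ω, IsSpectralResolution (M x) (Λ x) (P x)) (hn : ∀ x ∈ Ω, (Λ x).card ≤ n)
    (hC : 0 ≤ C) (hPC : ∀ x ∈ Ω, ∀ l ∈ Λ x, ‖P x l‖ ≤ C) (hg : ContinuousOn g (Ω ×ˢ univ)) :
    ContinuousOn (fun x => ∑ l ∈ Λ x, g (x, -Real.arctan l) • P x l) Ω := by
  intro x₀ hx₀
  refine ContinuousAt.continuousWithinAt (Metric.continuousAt_iff'.2 fun η hη => ?_)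
  have hV := FiniteDimensional.proper_real V
  obtain ⟨ρ, hρ, hball⟩ := Metric.nhds_basis_closedBall.mem_iff.1 (hΩ.mem_nhds hx₀)
  -- The angle `-arctan l` brings the unbounded variable `l` into a compact interval, so `g` is
  -- bounded and uniformly continuous on the relevant set.
  set Q : Set (V × ℝ) := Metric.closedBall x₀ ρ ×ˢ Icc (-(Real.pi / 2)) (Real.pi / 2) with hQdef
  have hQ : IsCompact Q := (isCompact_closedBall _ _).prod isCompact_Icc
  have hgQ : ContinuousOn g Q := hg.mono (prod_mono hball (subset_univ _))
  obtain ⟨B, hB⟩ := hQ.exists_bound_of_continuousOn hgQ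
  have hB0 : 0 ≤ B := (norm_nonneg _).trans
    (hB (x₀, 0) ⟨Metric.mem_closedBall_self hρ.le, by constructor <;> linarith [Real.pi_pos]⟩)
  have harc : ∀ l : ℝ, -Real.arctan l ∈ Icc (-(Real.pi / 2)) (Real.pi / 2) := fun l =>
    ⟨by linarith [Real.arctan_lt_pi_div_two l], by linarith [Real.neg_pi_div_two_lt_arctan l]⟩
  set K : ℝ := n * (n * C ^ 2) + 1 with hK
  have hK0 : 0 < K := by positivity
  obtain ⟨δ, hδ, hδg⟩ := Metric.uniformContinuousOn_iff.1
    (hQ.uniformContinuousOn_of_continuous hgQ) (η / (2 * K)) (by positivity)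
  -- With this slope, `A * |l - l'|` dominates the trivial bound `2 * B` as soon as `|l - l'| ≥ δ`;
  -- for closer `l`, `l'` uniform continuity is used.
  set A : ℝ := 2 * B / δ with hA
  have hMc : ContinuousAt M x₀ := hM.continuousAt (hΩ.mem_nhds hx₀)
  have hM' := Metric.continuousAt_iff'.1 hMc (η / (2 * K * (A + 1))) (by positivity)
  filter_upwards [hM', Metric.ball_mem_nhds x₀ (lt_min hδ hρ)] with x hx hxδ
  have hxρ : x ∈ Metric.closedBall x₀ ρ :=
    Metric.ball_subset_closedBall (Metric.ball_subset_ball (min_le_right _ _) hxδ)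
  have hxΩ : x ∈ Ω := hball hxρ
  rw [dist_eq_norm] at hx ⊢
  have hf : ∀ l ∈ Λ x, ∀ l' ∈ Λ x₀, ‖g (x, -Real.arctan l) - g (x₀, -Real.arctan l')‖
      ≤ η / (2 * K) + A * |l - l'| := by
    intro l _ l' _
    have m1 : (x, -Real.arctan l) ∈ Q := ⟨hxρ, harc l⟩
    have m2 : (x₀, -Real.arctan l') ∈ Q := ⟨Metric.mem_closedBall_self hρ.le, harc l'⟩
    by_cases hll : |l - l'| < δ
    · have hd : dist (x, -Real.arctan l) (x₀, -Real.arctan l') < δ := by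
        rw [Prod.dist_eq]
        refine max_lt (lt_of_lt_of_le hxδ (min_le_left _ _)) ?_
        rw [dist_neg_neg, Real.dist_eq]
        exact (Real.abs_arctan_sub_le l l').trans_lt hll
      have h1 := hδg _ m1 _ m2 hd
      rw [dist_eq_norm] at h1
      have : 0 ≤ A * |l - l'| := by positivity
      linarith
    · have h1 := norm_sub_le_of_le (hB _ m1) (hB _ m2)
      have h2 : 2 * B ≤ A * |l - l'| := by
        rw [hA, div_mul_eq_mul_div, le_div_iff₀ hδ]
        exact mul_le_mul_of_nonneg_left (not_lt.1 hll) (by positivity)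
      have h3 : 0 < η / (2 * K) := by positivity
      linarith
  have key := (hP x hxΩ).norm_sum_sub_sum_le (hP x₀ hx₀) hC (by positivity) (by positivity)
    (hPC x hxΩ) (hPC x₀ hx₀) hf
  have hc1 : ((Λ x).card : ℝ) ≤ n := by exact_mod_cast hn x hxΩ
  have hc2 : ((Λ x₀).card : ℝ) ≤ n := by exact_mod_cast hn x₀ hx₀
  have hAM : A * ‖M x - M x₀‖ ≤ η / (2 * K) := by
    have h1 : A * ‖M x - M x₀‖ ≤ (A + 1) * (η / (2 * K * (A + 1))) := by
      gcongr
      linarith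
    refine h1.trans (le_of_eq ?_)
    have : 0 < A + 1 := by positivity
    field_simp
  calc _ ≤ ((Λ x).card : ℝ) * ((Λ x₀).card * (C ^ 2 * (η / (2 * K) + A * ‖M x - M x₀‖))) := key
    _ ≤ n * (n * (C ^ 2 * (η / (2 * K) + η / (2 * K)))) := by gcongr
    _ = (n * (n * C ^ 2)) * (η / K) := by field_simp; ring
    _ < K * (η / K) := by
        refine mul_lt_mul_of_pos_right ?_ (by positivity)
        rw [hK]; linarith
    _ = η := by field_simp

theorem unifLocLipOn_spectral_sum (hΩ : IsOpen Ω) (hM : UnifLocLipOn M Ω)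
    (hP : ∀ x ∈ Ω, IsSpectralResolution (M x) (Λ x) (P x)) (hn : ∀ x ∈ Ω, (Λ x).card ≤ n)
    (hC : 0 ≤ C) (hPC : ∀ x ∈ Ω, ∀ l ∈ Λ x, ‖P x l‖ ≤ C) (hg : UnifLocLipOn g (Ω ×ˢ univ)) :
    UnifLocLipOn (fun x => ∑ l ∈ Λ x, g (x, -Real.arctan l) • P x l) Ω := by
  obtain ⟨K, hK⟩ := hM
  obtain ⟨L, hL⟩ := hg
  refine ⟨Real.toNNReal (n * (n * (C ^ 2 * (L + L * K)))), fun x₀ hx₀ => ?_⟩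
  obtain ⟨ρ, hρ, hball⟩ := Metric.nhds_basis_ball.mem_iff.1 (hΩ.mem_nhds hx₀)
  obtain ⟨U, hU, hKU⟩ := hK x₀ hx₀
  refine ⟨Metric.ball x₀ ρ ∩ U, inter_mem (Metric.ball_mem_nhds _ hρ) hU,
    LipschitzOnWith.of_dist_le_mul fun x hx y hy => ?_⟩
  have hxΩ := hball hx.1
  have hyΩ := hball hy.1
  -- The eigenvalues `l` and `l'` may be far apart, so a local estimate is not enough; convexity of
  -- the ball times the line makes it global.
  have hLip : LipschitzOnWith L g (Metric.ball x₀ ρ ×ˢ univ) :=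
    lipschitzOnWith_of_convex_of_locally ((convex_ball x₀ ρ).prod convex_univ)
      fun p hp => hL p ⟨hball hp.1, hp.2⟩
  have hf : ∀ l ∈ Λ x, ∀ l' ∈ Λ y, ‖g (x, -Real.arctan l) - g (y, -Real.arctan l')‖
      ≤ L * dist x y + L * |l - l'| := by
    intro l _ l' _
    have h1 := hLip.dist_le_mul (x, -Real.arctan l) ⟨hx.1, mem_univ _⟩ (y, -Real.arctan l')
      ⟨hy.1, mem_univ _⟩
    rw [dist_eq_norm] at h1
    refine h1.trans ?_
    rw [← mul_add]
    gcongr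
    rw [Prod.dist_eq]
    refine max_le (by simp) ?_
    rw [dist_neg_neg, Real.dist_eq]
    exact (Real.abs_arctan_sub_le l l').trans (by simp)
  have key := (hP x hxΩ).norm_sum_sub_sum_le (hP y hyΩ) hC (by positivity) (by positivity)
    (hPC x hxΩ) (hPC y hyΩ) hf
  have hc1 : ((Λ x).card : ℝ) ≤ n := by exact_mod_cast hn x hxΩ
  have hc2 : ((Λ y).card : ℝ) ≤ n := by exact_mod_cast hn y hyΩ
  have hMxy : ‖M x - M y‖ ≤ K * dist x y := by
    rw [← dist_eq_norm]
    exact hKU.dist_le_mul x hx.2 y hy.2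
  rw [dist_eq_norm (∑ l ∈ Λ x, _), Real.coe_toNNReal _ (by positivity)]
  calc _ ≤ ((Λ x).card : ℝ) * ((Λ y).card * (C ^ 2 * (L * dist x y + L * ‖M x - M y‖))) := key
    _ ≤ n * (n * (C ^ 2 * (L * dist x y + L * (K * dist x y)))) := by gcongr
    _ = _ := by ring

/-- The Cayley transform `U` of `M` is smooth in `x` as a rational function of `M`, and its powers
`∑ z l ^ k • P l` with `|z l| = 1` are bounded by `n * C`. The sum equals the series of Fourier
coefficients of `g` times powers of `U`, where no individual projector appears. -/
theorem contDiffOn_spectral_sum [FiniteDimensional ℝ V] [CompleteSpace R] (hΩ : IsOpen Ω) (hM : ContDiffOn ℝ ∞ M Ω)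
    (hP : ∀ x ∈ Ω, IsSpectralResolution (M x) (Λ x) (P x)) (hn : ∀ x ∈ Ω, (Λ x).card ≤ n)
    (hC : 0 ≤ C) (hPC : ∀ x ∈ Ω, ∀ l ∈ Λ x, ‖P x l‖ ≤ C) (hg : ContDiffOn ℝ ∞ g (Ω ×ˢ univ))
    (hper : ∀ x ∈ Ω, ∀ θ, g (x, θ + Real.pi) = g (x, θ)) :
    ContDiffOn ℝ ∞ (fun x => ∑ l ∈ Λ x, g (x, -Real.arctan l) • P x l) Ω := by
  set z : ℝ → ℂ := fun l => Complex.exp (2 * ((-Real.arctan l : ℝ) : ℂ) * Complex.I) with hz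
  have hz0 : ∀ l, z l ≠ 0 := fun l => Complex.exp_ne_zero _
  have hz1 : ∀ l, ‖z l‖ = 1 := fun l => norm_exp_two_mul_neg_arctan _
  have hzl : ∀ l : ℝ, (1 + -Complex.I * l) * (1 + Complex.I * l)⁻¹ = z l := fun l =>
    (exp_two_mul_neg_arctan l).symm
  have hzl' : ∀ l : ℝ, (1 + Complex.I * l) * (1 + -Complex.I * l)⁻¹ = (z l)⁻¹ := fun l => by
    rw [← hzl, mul_inv, inv_inv, mul_comm]
  have hlin : ∀ c : ℂ, ContDiffOn ℝ ∞ (fun x => 1 + c • M x) Ω := fun c =>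
    contDiffOn_const.add (hM.const_smul c)
  have hinv : ∀ c : ℂ, (∀ l : ℝ, 1 + c * l ≠ 0) →
      ContDiffOn ℝ ∞ (fun x => Ring.inverse (1 + c • M x)) Ω := fun c hc x hx => by
    obtain ⟨u, hu⟩ := (hP x hx).isUnit_one_add_smul hc
    have h1 : ContDiffAt ℝ ∞ (Ring.inverse : R → R) (1 + c • M x) := by
      rw [← hu]; exact contDiffAt_ringInverse ℝ u
    exact h1.comp_contDiffWithinAt x (hlin c x hx)
  set U : V → R := fun x => (1 + -Complex.I • M x) * Ring.inverse (1 + Complex.I • M x) with hU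
  set U' : V → R := fun x => (1 + Complex.I • M x) * Ring.inverse (1 + -Complex.I • M x) with hU'
  have hUs : ContDiffOn ℝ ∞ U Ω := (hlin _).mul (hinv _ one_add_I_mul_ofReal_ne_zero)
  have hUs' : ContDiffOn ℝ ∞ U' Ω := (hlin _).mul (hinv _ one_sub_I_mul_ofReal_ne_zero)
  have hUe : ∀ x ∈ Ω, ∀ k : ℕ, U x ^ k = ∑ l ∈ Λ x, z l ^ k • P x l := fun x hx k => by
    rw [← (hP x hx).sum_pow z k]
    simp only [hU]
    rw [(hP x hx).inverse_one_add_smul one_add_I_mul_ofReal_ne_zero,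
      (hP x hx).one_add_smul, (hP x hx).sum_mul_sum (fun l => 1 + -Complex.I * l)
        (fun l => (1 + Complex.I * l)⁻¹)]
    simp only [hzl]
  have hUe' : ∀ x ∈ Ω, ∀ k : ℕ, U' x ^ k = ∑ l ∈ Λ x, (z l)⁻¹ ^ k • P x l := fun x hx k => by
    rw [← (hP x hx).sum_pow (fun l => (z l)⁻¹) k]
    simp only [hU']
    rw [(hP x hx).inverse_one_add_smul one_sub_I_mul_ofReal_ne_zero,
      (hP x hx).one_add_smul, (hP x hx).sum_mul_sum (fun l => 1 + Complex.I * l)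
        (fun l => (1 + -Complex.I * l)⁻¹)]
    simp only [hzl']
  have hbd : ∀ (w : ℝ → ℂ), (∀ l, ‖w l‖ = 1) → ∀ x ∈ Ω, ‖∑ l ∈ Λ x, w l • P x l‖ ≤ n * C :=
    fun w hw x hx => by
      have hcard : ((Λ x).card : ℝ) ≤ n := by exact_mod_cast hn x hx
      refine (IsSpectralResolution.norm_sum_smul_le (hPC x hx) (B := 1)
        fun l _ => (hw l).le).trans ?_
      rw [one_mul]
      gcongr
  have hsm := contDiffOn_tsum_fourier_pow (ContinuousLinearMap.lsmul ℝ ℂ : ℂ →L[ℝ] R →L[ℝ] R)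
    hΩ hg hper hUs hUs' (B := n * C)
    (fun k x hx => by
      rw [hUe x hx]; exact hbd (fun l => z l ^ k) (fun l => by simp [hz1]) x hx)
    (fun k x hx => by
      rw [hUe' x hx]; exact hbd (fun l => (z l)⁻¹ ^ k) (fun l => by simp [hz1]) x hx)
  refine hsm.congr fun x hx => ?_
  have hterm : ∀ k : ℤ, U x ^ k.toNat * U' x ^ (-k).toNat = ∑ l ∈ Λ x, z l ^ k • P x l := by
    intro k
    rw [hUe x hx, hUe' x hx, (hP x hx).sum_mul_sum (fun l => z l ^ k.toNat)
      (fun l => (z l)⁻¹ ^ (-k).toNat)]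
    refine Finset.sum_congr rfl fun l _ => ?_
    congr 1
    rcases le_total 0 k with hk | hk
    · lift k to ℕ using hk
      simp
    · obtain ⟨j, rfl⟩ : ∃ j : ℕ, k = -(j : ℤ) := ⟨(-k).toNat, by omega⟩
      simp
  have hsum : HasSum (fun k : ℤ => ∑ l ∈ Λ x, (paramFourierCoeff g k x * z l ^ k) • P x l)
      (∑ l ∈ Λ x, g (x, -Real.arctan l) • P x l) :=
    hasSum_sum fun l _ => (hasSum_paramFourierCoeff hΩ hg hper hx (-Real.arctan l)).smul_const _
  rw [← hsum.tsum_eq]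
  refine tsum_congr fun k => ?_
  rw [hterm k, ContinuousLinearMap.lsmul_apply, Finset.smul_sum]
  simp only [smul_smul]

theorem regOn_spectral_sum [FiniteDimensional ℝ V] [CompleteSpace R] {r : Regularity} (hΩ : IsOpen Ω)
    (hM : RegOn r M Ω)
    (hP : ∀ x ∈ Ω, IsSpectralResolution (M x) (Λ x) (P x)) (hn : ∀ x ∈ Ω, (Λ x).card ≤ n)
    (hC : 0 ≤ C) (hPC : ∀ x ∈ Ω, ∀ l ∈ Λ x, ‖P x l‖ ≤ C) (hg : RegOn r g (Ω ×ˢ univ))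
    (hper : ∀ x ∈ Ω, ∀ θ, g (x, θ + Real.pi) = g (x, θ)) :
    RegOn r (fun x => ∑ l ∈ Λ x, g (x, -Real.arctan l) • P x l) Ω := by
  cases r with
  | continuous => exact continuousOn_spectral_sum hΩ hM hP hn hC hPC hg
  | w1infty => exact unifLocLipOn_spectral_sum hΩ hM hP hn hC hPC hg
  | smooth => exact contDiffOn_spectral_sum hΩ hM hP hn hC hPC hg hper

end Regularity

end SpectralResolution

/-! ### Spectral projectors of matrices with real semisimple spectrum. -/

section Diagonalization

open Polynomial

theorem Polynomial.aeval_mul_of_mul_eq_smul {R : Type*} [Ring R] [Algebra ℂ R] {M Q : R} {l : ℂ}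
    (h : M * Q = l • Q) (p : ℂ[X]) : aeval M p * Q = p.eval l • Q := by
  obtain ⟨q, hq⟩ := X_sub_C_dvd_sub_C_eval (p := p) (a := l)
  have h1 : p = q * (X - C l) + C (p.eval l) := by rw [mul_comm, ← hq]; ring
  conv_lhs => rw [h1]
  have h2 : (M - algebraMap ℂ R l) * Q = 0 := by
    rw [sub_mul, h, Algebra.algebraMap_eq_smul_one, smul_mul_assoc, one_mul, sub_self]
  rw [map_add, map_mul, map_sub, aeval_X, aeval_C, aeval_C, add_mul, mul_assoc, h2, mul_zero,
    zero_add, Algebra.algebraMap_eq_smul_one, smul_mul_assoc, one_mul]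

/-- The Lagrange projectors of an element annihilated by a polynomial with simple real roots. -/
theorem isSpectralResolution_lagrange {R : Type*} [Ring R] [Algebra ℂ R] {M : R} {Λ : Finset ℝ}
    (h : aeval M (Lagrange.nodal Λ fun l : ℝ => (l : ℂ)) = 0) :
    IsSpectralResolution M Λ fun l => aeval M (Lagrange.basis Λ (fun l : ℝ => (l : ℂ)) l) := by
  set v : ℝ → ℂ := fun l => (l : ℂ) with hv
  have hinj : Set.InjOn v Λ := Complex.ofReal_injective.injOn
  have hL : ∀ l ∈ Λ, M * aeval M (Lagrange.basis Λ v l)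
      = (l : ℂ) • aeval M (Lagrange.basis Λ v l) := by
    intro l hl
    have h1 : (X - C (l : ℂ)) * Lagrange.basis Λ v l
        = C (Lagrange.nodalWeight Λ v l) * Lagrange.nodal Λ v := by
      rw [Lagrange.basis_eq_prod_sub_inv_mul_nodal_div hl, ← Lagrange.nodal_erase_eq_nodal_div hl,
        Lagrange.nodal_eq_mul_nodal_erase hl]
      ring
    have h2 := congrArg (aeval M) h1
    rw [map_mul, map_mul, h, mul_zero, map_sub, aeval_X, aeval_C, sub_mul, sub_eq_zero,
      Algebra.algebraMap_eq_smul_one, smul_mul_assoc, one_mul] at h2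
    exact h2
  refine ⟨?_, fun l hl => ?_, fun l hl l' hl' hne => ?_, hL, fun l hl => ?_⟩
  · rw [← map_sum]
    -- For empty `Λ` the nodal polynomial is `1`, so the hypothesis says `1 = 0` and the empty sum
    -- is `1`.
    rcases Λ.eq_empty_or_nonempty with rfl | hne
    · simpa using h.symm
    · rw [Lagrange.sum_basis hinj hne, map_one]
  · rw [aeval_mul_of_mul_eq_smul (hL l hl)]
    change eval (v l) _ • _ = _
    rw [Lagrange.eval_basis_self hinj hl, one_smul]
  · rw [aeval_mul_of_mul_eq_smul (hL l' hl')]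
    change eval (v l') _ • _ = _
    rw [Lagrange.eval_basis_of_ne hne hl', zero_smul]
  · rw [← hL l hl]
    have := (Polynomial.commute_X (Lagrange.basis Λ v l)).symm.map (aeval M)
    simpa using this.eq

/-- An endomorphism with real semisimple eigenvalues is annihilated by a polynomial with simple
real roots. -/
theorem Module.End.exists_aeval_nodal_eq_zero {W : Type*} [AddCommGroup W] [Module ℂ W]
    [FiniteDimensional ℂ W] (f : Module.End ℂ W)
    (hreal : ∀ μ : ℂ, f.HasEigenvalue μ → μ.im = 0)
    (hss : ∀ (l : ℝ) (w : W), (f - (l : ℂ) • 1) ((f - (l : ℂ) • 1) w) = 0 →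
      (f - (l : ℂ) • 1) w = 0) :
    ∃ Λ : Finset ℝ, Λ.card ≤ Module.finrank ℂ W ∧
      aeval f (Lagrange.nodal Λ fun l : ℝ => (l : ℂ)) = 0 := by
  classical
  refine ⟨f.charpoly.roots.toFinset.image Complex.re, ?_, ?_⟩
  · refine Finset.card_image_le.trans ((Multiset.toFinset_card_le _).trans ?_)
    exact (Polynomial.card_roots' _).trans (LinearMap.charpoly_natDegree f).le
  · refine LinearMap.ext fun w => ?_
    have hw : w ∈ ⨆ μ, f.maxGenEigenspace μ := by
      rw [Module.End.iSup_maxGenEigenspace_eq_top]; trivial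
    refine Submodule.iSup_induction _ (motive := fun w => aeval f (Lagrange.nodal
      (f.charpoly.roots.toFinset.image Complex.re) fun l : ℝ => (l : ℂ)) w
        = (0 : Module.End ℂ W) w) hw (fun μ v hv => ?_) (by simp) fun x y hx hy => ?_
    · by_cases hv0 : v = 0
      · simp [hv0]
      obtain ⟨k, hk⟩ := (Module.End.mem_maxGenEigenspace f μ v).1 hv
      have hμ : f.HasEigenvalue μ := by
        refine Module.End.hasEigenvalue_of_hasGenEigenvalue (k := k) fun hbot => hv0 ?_
        have : v ∈ f.genEigenspace μ k := by
          rw [Module.End.mem_genEigenspace_nat, LinearMap.mem_ker]; exact hk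
        rw [hbot] at this
        simpa using this
      have hμr : ((μ.re : ℝ) : ℂ) = μ := Complex.ext (by simp) (by simp [hreal μ hμ])
      -- A generalized eigenvector is an eigenvector: `hss` lowers the exponent `k` one by one down
      -- to `1`.
      have hone : (f - μ • 1) v = 0 := by
        have hss' : ∀ w, (f - μ • 1) ((f - μ • 1) w) = 0 → (f - μ • 1) w = 0 := fun w hw => by
          rw [← hμr] at hw ⊢; exact hss _ _ hw
        clear hv
        induction k with
        | zero => exact absurd (by simpa using hk) hv0
        | succ k ih =>
          cases k with
          | zero => simpa using hk
          | succ k =>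
            apply ih
            rw [pow_succ', pow_succ', Module.End.mul_apply, Module.End.mul_apply] at hk
            rw [pow_succ', Module.End.mul_apply]
            exact hss' _ hk
      have hmem : μ.re ∈ f.charpoly.roots.toFinset.image Complex.re := by
        refine Finset.mem_image_of_mem _ (Multiset.mem_toFinset.2 ?_)
        rw [Polynomial.mem_roots (LinearMap.charpoly_monic f).ne_zero]
        exact Module.End.hasEigenvalue_iff_isRoot_charpoly f μ |>.1 hμ
      rw [Lagrange.nodal_eq_mul_nodal_erase hmem, mul_comm, map_mul, Module.End.mul_apply]
      have : aeval f (X - C ((μ.re : ℝ) : ℂ)) v = 0 := by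
        rw [hμr, map_sub, aeval_X, aeval_C, Algebra.algebraMap_eq_smul_one]; exact hone
      rw [this]; simp
    · rw [map_add, hx, hy]; simp

theorem Matrix.exists_isSpectralResolution {N : ℕ} (M : CMat N)
    (hreal : ∀ (μ : ℂ) (w : Fin N → ℂ), w ≠ 0 → M *ᵥ w = μ • w → μ.im = 0)
    (hss : ∀ (l : ℝ) (w : Fin N → ℂ), (M - (l : ℂ) • 1) *ᵥ ((M - (l : ℂ) • 1) *ᵥ w) = 0 →
      (M - (l : ℂ) • 1) *ᵥ w = 0) :
    ∃ (Λ : Finset ℝ) (P : ℝ → CMat N), Λ.card ≤ N ∧ IsSpectralResolution M Λ P := by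
  have hsub : ∀ l : ℂ, Matrix.toLinAlgEquiv' M - l • 1 = Matrix.toLinAlgEquiv' (M - l • 1) := by
    intro l; rw [map_sub, map_smul, map_one]
  obtain ⟨Λ, hcard, h⟩ := Module.End.exists_aeval_nodal_eq_zero (Matrix.toLinAlgEquiv' M)
    (fun μ hμ => by
      obtain ⟨w, hw⟩ := hμ.exists_hasEigenvector
      exact hreal μ w hw.2 (by simpa using hw.apply_eq_smul))
    (fun l w hw => by
      rw [hsub] at hw ⊢
      exact hss l w hw)
  rw [Polynomial.aeval_algHom_apply] at h
  refine ⟨Λ, _, by simpa using hcard, isSpectralResolution_lagrange ?_⟩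
  exact (Matrix.toLinAlgEquiv' (R := ℂ) (n := Fin N)).injective (by rw [map_zero]; exact h)

end Diagonalization

/-! ### Hermitian product and Euclidean norm on `ℂᴺ`. -/

section Herm

variable {N : ℕ}

/-- The Euclidean norm on `ℂᴺ`. -/
noncomputable def vecNorm (u : Fin N → ℂ) : ℝ := ‖(WithLp.toLp 2 u : EuclideanSpace ℂ (Fin N))‖

theorem vecNorm_nonneg (u : Fin N → ℂ) : 0 ≤ vecNorm u := norm_nonneg _

theorem vecNorm_sq (u : Fin N → ℂ) : vecNorm u ^ 2 = normSqVec u := by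
  rw [vecNorm, EuclideanSpace.norm_sq_eq, normSqVec]

theorem vecNorm_eq_zero {u : Fin N → ℂ} : vecNorm u = 0 ↔ u = 0 := by
  rw [vecNorm, norm_eq_zero, WithLp.toLp_eq_zero]

theorem vecNorm_smul (z : ℂ) (u : Fin N → ℂ) : vecNorm (z • u) = ‖z‖ * vecNorm u := by
  rw [vecNorm, WithLp.toLp_smul, norm_smul]; rfl

theorem vecNorm_sum_le {ι : Type*} (s : Finset ι) (f : ι → Fin N → ℂ) :
    vecNorm (∑ i ∈ s, f i) ≤ ∑ i ∈ s, vecNorm (f i) := by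
  rw [vecNorm, WithLp.toLp_sum]; exact norm_sum_le _ _

theorem norm_apply_le_vecNorm (u : Fin N → ℂ) (i : Fin N) : ‖u i‖ ≤ vecNorm u :=
  PiLp.norm_apply_le (WithLp.toLp 2 u : EuclideanSpace ℂ (Fin N)) i

theorem vecNorm_le_of_forall_le {u : Fin N → ℂ} {b : ℝ} (hb : 0 ≤ b) (h : ∀ i, ‖u i‖ ≤ b) :
    vecNorm u ≤ N * b := by
  refine abs_le_of_sq_le_sq' ?_ (by positivity) |>.2
  rw [vecNorm_sq, normSqVec]
  calc ∑ i, ‖u i‖ ^ 2 ≤ ∑ _i : Fin N, b ^ 2 := by gcongr with i; exact h i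
    _ = N * b ^ 2 := by simp
    _ ≤ N ^ 2 * b ^ 2 := by
        gcongr
        exact_mod_cast Nat.le_self_pow two_ne_zero N
    _ = _ := by ring

theorem vecNorm_mulVec_le {A : CMat N} {C : ℝ} (hC : 0 ≤ C) (h : ∀ i j, ‖A i j‖ ≤ C)
    (u : Fin N → ℂ) : vecNorm (A *ᵥ u) ≤ N ^ 2 * C * vecNorm u := by
  have h0 := vecNorm_nonneg u
  have h1 : ∀ i, ‖(A *ᵥ u) i‖ ≤ N * (C * vecNorm u) := fun i => by
    have e : (A *ᵥ u) i = ∑ j, A i j * u j := rfl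
    rw [e]
    calc ‖∑ j, A i j * u j‖ ≤ ∑ _j : Fin N, C * vecNorm u := norm_sum_le_of_le _ fun j _ => by
          rw [norm_mul]
          gcongr
          exacts [h i j, norm_apply_le_vecNorm u j]
      _ = N * (C * vecNorm u) := by simp
  refine (vecNorm_le_of_forall_le (by positivity) h1).trans (le_of_eq (by ring))

theorem herm_eq_dotProduct (f u : Fin N → ℂ) : herm f u = star u ⬝ᵥ f := by
  simp only [herm, dotProduct, Pi.star_apply, mul_comm]

theorem norm_herm_le (f u : Fin N → ℂ) : ‖herm f u‖ ≤ vecNorm f * vecNorm u := by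
  have h := norm_inner_le_norm (𝕜 := ℂ) (WithLp.toLp 2 u : EuclideanSpace ℂ (Fin N))
    (WithLp.toLp 2 f)
  rw [EuclideanSpace.inner_eq_star_dotProduct] at h
  rw [herm_eq_dotProduct, dotProduct_comm, mul_comm]
  exact h

theorem herm_mulVec_right (A : CMat N) (f u : Fin N → ℂ) :
    herm f (A *ᵥ u) = herm (Aᴴ *ᵥ f) u := by
  rw [herm_eq_dotProduct, herm_eq_dotProduct, Matrix.star_mulVec, Matrix.dotProduct_mulVec]

theorem herm_zero_right (f : Fin N → ℂ) : herm f 0 = 0 := by simp [herm]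

theorem herm_add_left (f g u : Fin N → ℂ) : herm (f + g) u = herm f u + herm g u := by
  simp [herm, add_mul, Finset.sum_add_distrib]

theorem herm_smul_left (z : ℂ) (f u : Fin N → ℂ) : herm (z • f) u = z * herm f u := by
  simp [herm, Finset.mul_sum, mul_assoc]

theorem herm_sum_left {ι : Type*} (s : Finset ι) (f : ι → Fin N → ℂ) (u : Fin N → ℂ) :
    herm (∑ i ∈ s, f i) u = ∑ i ∈ s, herm (f i) u := by
  simp only [herm_eq_dotProduct, dotProduct_sum]

theorem star_herm (f u : Fin N → ℂ) : star (herm f u) = herm u f := by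
  simp [herm, mul_comm]

end Herm

/-! ### Linearity of the symbol and hyperbolicity. -/

section Symbol

variable {d N : ℕ}

theorem symbol_add (A : Fin (d + 1) → CMat N) (ξ η : Freq d) :
    symbol A (ξ + η) = symbol A ξ + symbol A η := by
  simp [symbol, add_smul, Finset.sum_add_distrib]

theorem symbol_smul (A : Fin (d + 1) → CMat N) (t : ℝ) (ξ : Freq d) :
    symbol A (t • ξ) = (t : ℂ) • symbol A ξ := by
  simp only [symbol, Finset.smul_sum, smul_smul, PiLp.smul_apply, smul_eq_mul,
    Complex.ofReal_mul]

theorem symbol_sub_smul (A : Fin (d + 1) → CMat N) (ξ ν : Freq d) (l : ℝ) :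
    symbol A (ξ - l • ν) = symbol A ξ - (l : ℂ) • symbol A ν := by
  rw [sub_eq_add_neg, ← neg_smul, symbol_add, symbol_smul]
  push_cast
  rw [neg_smul, sub_eq_add_neg]

theorem IsHyperbolicInDirection.det_symbol_ne_zero {A : Fin (d + 1) → CMat N} {ν : Freq d}
    (h : IsHyperbolicInDirection A 0 ν) : (symbol A ν).det ≠ 0 := by
  have h1 := h.1
  have e : charDet A 0 (fun j => ((ν j : ℝ) : ℂ)) = (Complex.I • symbol A ν).det := by
    simp only [charDet, symbol, Finset.smul_sum, smul_smul, add_zero]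
  rw [e, Matrix.det_smul] at h1
  exact (mul_ne_zero_iff.1 h1).2

/-- Without lower order term the determinant is homogeneous, so the threshold disappears: scaling
`(ξ, τ)` by `t` raises `|t * τ|` above it. -/
theorem IsHyperbolicInDirection.det_symbol_add_ne_zero {A : Fin (d + 1) → CMat N} {ν : Freq d}
    (h : IsHyperbolicInDirection A 0 ν) (ξ : Freq d) {τ : ℝ} (hτ : τ ≠ 0) :
    (symbol A ξ + (Complex.I * τ) • symbol A ν).det ≠ 0 := by
  obtain ⟨-, γ, hγ⟩ := h
  set t : ℝ := (|γ| + 1) / |τ| with ht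
  have hτ' : 0 < |τ| := abs_pos.2 hτ
  have ht0 : 0 < t := by positivity
  have h1 : γ < |t * τ| := by
    rw [abs_mul, abs_of_pos ht0, ht, div_mul_cancel₀ _ hτ'.ne']
    linarith [le_abs_self γ]
  have h2 := hγ (t • ξ) (t * τ) h1
  have e : charDet A 0 (fun j => Complex.I * ((t * τ * ν j : ℝ) : ℂ) + (((t • ξ) j : ℝ) : ℂ))
      = ((Complex.I * t) • (symbol A ξ + (Complex.I * τ) • symbol A ν)).det := by
    rw [charDet]
    congr 1
    simp only [symbol, add_zero, Finset.smul_sum, smul_smul, ← Finset.sum_add_distrib,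
      ← add_smul]
    refine Finset.sum_congr rfl fun j _ => ?_
    congr 1
    simp
    ring
  rw [e, Matrix.det_smul] at h2
  exact (mul_ne_zero_iff.1 h2).2

end Symbol

/-! ### Algebra of a symmetrized pencil `X - λ K`. -/

section Pencil

variable {N : ℕ}

/-- The data of a full symmetrizer along the line `ξ - λ ν`: `K = L(ν)`, `X = L(ξ)`,
`T λ = S(ξ - λ ν)`. -/
structure IsSymmetrizedPencil (K X : CMat N) (T : ℝ → CMat N) (C c : ℝ) : Prop where
  det_ne_zero : K.det ≠ 0
  real : ∀ z : ℂ, z.im ≠ 0 → (X - z • K).det ≠ 0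
  bounded : ∀ l i j, ‖T l i j‖ ≤ C
  selfAdjoint : ∀ l : ℝ, (T l * (X - (l : ℂ) • K)).IsHermitian
  positive : ∀ (l : ℝ) (u : Fin N → ℂ), (X - (l : ℂ) • K) *ᵥ u = 0 →
    c * normSqVec u ≤ (herm ((T l * K) *ᵥ u) u).re

namespace IsSymmetrizedPencil

variable {K X : CMat N} {T : ℝ → CMat N} {C c : ℝ}

theorem mul_inv_mul (h : IsSymmetrizedPencil K X T C c) : K * (K⁻¹ * X) = X := by
  rw [← mul_assoc, Matrix.mul_nonsing_inv _ h.det_ne_zero.isUnit, one_mul]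

theorem mul_sub (h : IsSymmetrizedPencil K X T C c) (z : ℂ) :
    K * (K⁻¹ * X - z • 1) = X - z • K := by
  rw [Matrix.mul_sub, h.mul_inv_mul, mul_smul_comm, mul_one]

/-- The condition `real` excludes non-real eigenvalues. For semisimplicity, let `u = (K⁻¹ X - l) w`
be annihilated by `K⁻¹ X - l`. Then `T l K u = T l (X - l K) w`, and self-adjointness gives `(T l K
u, u) = (w, T l (X - l K) u) = 0`; positivity on the kernel forces `u = 0`. -/
theorem exists_isSpectralResolution (h : IsSymmetrizedPencil K X T C c) (hc : 0 < c) :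
    ∃ (Λ : Finset ℝ) (P : ℝ → CMat N), Λ.card ≤ N ∧ IsSpectralResolution (K⁻¹ * X) Λ P := by
  refine Matrix.exists_isSpectralResolution _ (fun μ w hw he => ?_) fun l w hw => ?_
  · by_contra him
    refine h.real μ him ?_
    refine Matrix.exists_mulVec_eq_zero_iff.1 ⟨w, hw, ?_⟩
    rw [← h.mul_sub, ← Matrix.mulVec_mulVec, Matrix.sub_mulVec, he, Matrix.smul_mulVec,
      Matrix.one_mulVec, sub_self, Matrix.mulVec_zero]
  · set u := (K⁻¹ * X - (l : ℂ) • 1) *ᵥ w with hu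
    have h1 : (X - (l : ℂ) • K) *ᵥ u = 0 := by
      rw [← h.mul_sub, ← Matrix.mulVec_mulVec, hw, Matrix.mulVec_zero]
    have h2 := h.positive l u h1
    have h3 : (T l * K) *ᵥ u = (T l * (X - (l : ℂ) • K)) *ᵥ w := by
      rw [hu, Matrix.mulVec_mulVec, mul_assoc, h.mul_sub]
    have h4 : herm ((T l * K) *ᵥ u) u = 0 := by
      rw [h3, ← (h.selfAdjoint l).eq, ← herm_mulVec_right, ← Matrix.mulVec_mulVec, h1,
        Matrix.mulVec_zero, herm_zero_right]
    rw [h4, Complex.zero_re, ← vecNorm_sq] at h2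
    have h5 : vecNorm u ^ 2 ≤ 0 := by
      by_contra hcon
      have := mul_pos hc (not_le.1 hcon)
      linarith
    exact vecNorm_eq_zero.1 (pow_eq_zero_iff two_ne_zero |>.1 (le_antisymm h5 (sq_nonneg _)))

variable {Λ : Finset ℝ} {P : ℝ → CMat N}

theorem sub_mul_proj (h : IsSymmetrizedPencil K X T C c)
    (hP : IsSpectralResolution (K⁻¹ * X) Λ P) (l : ℝ) {l' : ℝ} (hl' : l' ∈ Λ) :
    (X - (l : ℂ) • K) * P l' = ((l' - l : ℝ) : ℂ) • (K * P l') := by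
  rw [← h.mul_sub, mul_assoc, sub_mul, hP.mul_left l' hl', smul_mul_assoc, one_mul, ← sub_smul,
    mul_smul_comm]
  push_cast
  rfl

/-- The self-adjoint matrix `T l (X - l K)` kills the range of `P l`, and on the range of `P l'` it
acts as `(l' - l) T l K`. Hence `(P l)ᴴ (T l K) P l' = 0` for `l' ≠ l`. -/
theorem proj_conjTranspose_mul (h : IsSymmetrizedPencil K X T C c)
    (hP : IsSpectralResolution (K⁻¹ * X) Λ P) {l : ℝ} (hl : l ∈ Λ) :
    (P l)ᴴ * (T l * K) = (P l)ᴴ * (T l * K) * P l := by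
  have hz : ∀ l' ∈ Λ, l' ≠ l → (P l)ᴴ * (T l * K) * P l' = 0 := by
    intro l' hl' hne
    have h1 : ((l' - l : ℝ) : ℂ) • ((P l)ᴴ * (T l * K) * P l') = 0 := by
      calc _ = (P l)ᴴ * (T l * (X - (l : ℂ) • K)) * P l' := by
            rw [mul_assoc, mul_assoc (T l), mul_assoc _ (T l * _), mul_assoc (T l),
              h.sub_mul_proj hP l hl', mul_smul_comm, mul_smul_comm]
        _ = (T l * ((X - (l : ℂ) • K) * P l))ᴴ * P l' := by
            rw [← mul_assoc (T l), Matrix.conjTranspose_mul, (h.selfAdjoint l).eq]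
        _ = 0 := by
            rw [h.sub_mul_proj hP l hl, sub_self]
            simp
    refine (smul_eq_zero.1 h1).resolve_left ?_
    exact_mod_cast sub_ne_zero.2 hne
  conv_lhs => rw [← mul_one ((P l)ᴴ * (T l * K)), ← hP.sum_eq_one, Finset.mul_sum]
  exact Finset.sum_eq_single_of_mem l hl fun l' hl' hne => hz l' hl' hne

theorem positive_proj (h : IsSymmetrizedPencil K X T C c)
    (hP : IsSpectralResolution (K⁻¹ * X) Λ P) {l : ℝ} (hl : l ∈ Λ) (u : Fin N → ℂ) :
    c * vecNorm (P l *ᵥ u) ^ 2 ≤ (herm ((T l * K) *ᵥ (P l *ᵥ u)) (P l *ᵥ u)).re := by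
  rw [vecNorm_sq]
  refine h.positive l _ ?_
  rw [Matrix.mulVec_mulVec, h.sub_mul_proj hP l hl, sub_self]
  simp

/-- By the previous relation `(T l K P l u, P l u) = (T l K u, P l u)`, so positivity and
Cauchy–Schwarz give `c |P l u|² ≤ N² C |K u| |P l u|`. The gaps between eigenvalues do not enter,
which makes the bound uniform through crossings. -/
theorem vecNorm_proj_le (h : IsSymmetrizedPencil K X T C c) (hc : 0 < c) (hC : 0 ≤ C)
    (hP : IsSpectralResolution (K⁻¹ * X) Λ P) {l : ℝ} (hl : l ∈ Λ) (u : Fin N → ℂ) :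
    vecNorm (P l *ᵥ u) ≤ N ^ 2 * C / c * vecNorm (K *ᵥ u) := by
  have h1 := h.positive_proj hP hl u
  have h2 : herm ((T l * K) *ᵥ (P l *ᵥ u)) (P l *ᵥ u) = herm (T l *ᵥ (K *ᵥ u)) (P l *ᵥ u) := by
    rw [herm_mulVec_right, herm_mulVec_right, Matrix.mulVec_mulVec, Matrix.mulVec_mulVec,
      Matrix.mulVec_mulVec, Matrix.mulVec_mulVec, ← h.proj_conjTranspose_mul hP hl, mul_assoc]
  rw [h2] at h1
  have h3 : (herm (T l *ᵥ (K *ᵥ u)) (P l *ᵥ u)).re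
      ≤ N ^ 2 * C * vecNorm (K *ᵥ u) * vecNorm (P l *ᵥ u) :=
    ((Complex.re_le_norm _).trans (norm_herm_le _ _)).trans
      (mul_le_mul_of_nonneg_right (vecNorm_mulVec_le hC (h.bounded l) _) (vecNorm_nonneg _))
  have h0 := vecNorm_nonneg (P l *ᵥ u)
  have hK := vecNorm_nonneg (K *ᵥ u)
  rcases h0.eq_or_lt with h4 | h4
  · rw [← h4]; positivity
  · rw [div_mul_eq_mul_div, le_div_iff₀ hc]
    refine le_of_mul_le_mul_right ?_ h4
    calc vecNorm (P l *ᵥ u) * c * vecNorm (P l *ᵥ u) = c * vecNorm (P l *ᵥ u) ^ 2 := by ring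
      _ ≤ _ := h1.trans h3

theorem eq_sum_proj (hP : IsSpectralResolution (K⁻¹ * X) Λ P) (u : Fin N → ℂ) :
    u = ∑ l ∈ Λ, P l *ᵥ u := by
  rw [← Matrix.sum_mulVec, hP.sum_eq_one, Matrix.one_mulVec]

/-- Taken at `K⁻¹ *ᵥ u`, this yields a uniform bound on `K⁻¹`, although hyperbolicity only says that
`K.det ≠ 0`. -/
theorem vecNorm_le (h : IsSymmetrizedPencil K X T C c) (hc : 0 < c) (hC : 0 ≤ C)
    (hΛ : Λ.card ≤ N) (hP : IsSpectralResolution (K⁻¹ * X) Λ P) (u : Fin N → ℂ) :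
    vecNorm u ≤ N * (N ^ 2 * C / c * vecNorm (K *ᵥ u)) := by
  have hK := vecNorm_nonneg (K *ᵥ u)
  have hΛ' : (Λ.card : ℝ) ≤ N := by exact_mod_cast hΛ
  calc vecNorm u = vecNorm (∑ l ∈ Λ, P l *ᵥ u) := by rw [← eq_sum_proj hP u]
    _ ≤ ∑ l ∈ Λ, vecNorm (P l *ᵥ u) := vecNorm_sum_le _ _
    _ ≤ ∑ _l ∈ Λ, N ^ 2 * C / c * vecNorm (K *ᵥ u) :=
        Finset.sum_le_sum fun l hl => h.vecNorm_proj_le hc hC hP hl u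
    _ = Λ.card * (N ^ 2 * C / c * vecNorm (K *ᵥ u)) := by simp
    _ ≤ _ := by gcongr

/-- The symmetrizer `∑ Re (P_λᴴ T_λ K P_λ)` of `K⁻¹ X`. -/
theorem isHermitian_and_positive (h : IsSymmetrizedPencil K X T C c) (hc : 0 < c)
    (hΛ : Λ.card ≤ N) (hP : IsSpectralResolution (K⁻¹ * X) Λ P) {Y H : CMat N}
    (hY : Y = ∑ l ∈ Λ, (T l)ᴴ * P l) (hH : H = (1 / 2 : ℂ) • (Kᴴ * Y + Yᴴ * K)) :
    H.IsHermitian ∧ (H * (K⁻¹ * X)).IsHermitian ∧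
      ∀ u, c / (N + 1) * normSqVec u ≤ (herm (H *ᵥ u) u).re := by
  set G : ℝ → CMat N := fun l => (1 / 2 : ℂ) • ((T l * K)ᴴ + T l * K) with hG
  have hGh : ∀ l, (G l)ᴴ = G l := fun l => by
    simp only [hG, Matrix.conjTranspose_smul, Matrix.conjTranspose_add,
      Matrix.conjTranspose_conjTranspose, add_comm]
    simp
  -- The given form of `H` is linear in the projectors, as its regularity requires;
  -- `proj_conjTranspose_mul` converts it into this quadratic form, where symmetry and positivity
  -- are visible.
  have hHs : H = ∑ l ∈ Λ, (P l)ᴴ * G l * P l := by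
    rw [hH, hY, Matrix.conjTranspose_sum, Finset.mul_sum, Finset.sum_mul,
      ← Finset.sum_add_distrib, Finset.smul_sum]
    refine Finset.sum_congr rfl fun l hl => ?_
    have h1 := h.proj_conjTranspose_mul hP hl
    have h2 := congrArg Matrix.conjTranspose h1
    simp only [Matrix.conjTranspose_mul, Matrix.conjTranspose_conjTranspose] at h2
    simp only [hG, Matrix.conjTranspose_mul, Matrix.conjTranspose_conjTranspose, mul_smul_comm,
      smul_mul_assoc, Matrix.mul_add, Matrix.add_mul, mul_assoc] at h1 h2 ⊢
    rw [← h1, ← h2]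
  refine ⟨?_, ?_, fun u => ?_⟩
  · rw [Matrix.IsHermitian, hHs, Matrix.conjTranspose_sum]
    refine Finset.sum_congr rfl fun l _ => ?_
    rw [Matrix.conjTranspose_mul, Matrix.conjTranspose_mul, hGh,
      Matrix.conjTranspose_conjTranspose, mul_assoc]
  · have e : H * (K⁻¹ * X) = ∑ l ∈ Λ, (l : ℂ) • ((P l)ᴴ * G l * P l) := by
      rw [hHs, Finset.sum_mul]
      refine Finset.sum_congr rfl fun l hl => ?_
      rw [mul_assoc, hP.mul_right l hl, mul_smul_comm]
    rw [Matrix.IsHermitian, e, Matrix.conjTranspose_sum]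
    refine Finset.sum_congr rfl fun l _ => ?_
    rw [Matrix.conjTranspose_smul, Matrix.conjTranspose_mul, Matrix.conjTranspose_mul, hGh,
      Matrix.conjTranspose_conjTranspose, mul_assoc]
    simp
  · have hterm : ∀ l ∈ Λ, c * vecNorm (P l *ᵥ u) ^ 2
        ≤ (herm (((P l)ᴴ * G l * P l) *ᵥ u) u).re := by
      intro l hl
      refine (h.positive_proj hP hl u).trans (le_of_eq ?_)
      set w := P l *ᵥ u with hw
      have e1 : herm (((P l)ᴴ * G l * P l) *ᵥ u) u = herm (G l *ᵥ w) w := by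
        rw [hw, herm_mulVec_right, Matrix.mulVec_mulVec, Matrix.mulVec_mulVec, mul_assoc]
      have e2 : herm (G l *ᵥ w) w
          = (1 / 2 : ℂ) * (star (herm ((T l * K) *ᵥ w) w) + herm ((T l * K) *ᵥ w) w) := by
        rw [hG]
        simp only
        rw [Matrix.smul_mulVec, herm_smul_left, Matrix.add_mulVec, herm_add_left,
          ← herm_mulVec_right, star_herm]
      rw [e1, e2]
      simp
      ring
    have e : (herm (H *ᵥ u) u).re = ∑ l ∈ Λ, (herm (((P l)ᴴ * G l * P l) *ᵥ u) u).re := by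
      rw [hHs, Matrix.sum_mulVec, herm_sum_left, Complex.re_sum]
    rw [e]
    refine le_trans ?_ (Finset.sum_le_sum hterm)
    -- Cauchy–Schwarz over at most `N` eigenvalues costs a factor `N`; `N + 1` is also nonzero when
    -- `N = 0`.
    rw [← Finset.mul_sum, div_mul_eq_mul_div, div_le_iff₀ (by positivity), mul_assoc]
    refine mul_le_mul_of_nonneg_left ?_ hc.le
    have hS : 0 ≤ ∑ l ∈ Λ, vecNorm (P l *ᵥ u) ^ 2 := Finset.sum_nonneg fun _ _ => sq_nonneg _
    have hΛ' : (Λ.card : ℝ) ≤ N + 1 := by exact_mod_cast hΛ.trans (Nat.le_succ N)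
    calc normSqVec u = vecNorm u ^ 2 := (vecNorm_sq u).symm
      _ ≤ (∑ l ∈ Λ, vecNorm (P l *ᵥ u)) ^ 2 := by
          have : vecNorm u ≤ ∑ l ∈ Λ, vecNorm (P l *ᵥ u) := by
            conv_lhs => rw [eq_sum_proj hP u]
            exact vecNorm_sum_le _ _
          exact pow_le_pow_left₀ (vecNorm_nonneg u) this 2
      _ ≤ Λ.card * ∑ l ∈ Λ, vecNorm (P l *ᵥ u) ^ 2 := sq_sum_le_card_mul_sum_sq
      _ ≤ (N + 1) * ∑ l ∈ Λ, vecNorm (P l *ᵥ u) ^ 2 := by gcongr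
      _ = _ := mul_comm _ _

end IsSymmetrizedPencil

theorem isSymmetrizedPencil_of_isFullSymmetrizer {d : ℕ} {A : Fin (d + 1) → CMat N}
    {ν ξ : Freq d} {S : Freq d → CMat N} {C c : ℝ} (hH : IsHyperbolicInDirection A 0 ν)
    (hS : IsFullSymmetrizer A S C) (hp : IsPositiveInDirection A ν S c)
    (hne : ∀ l : ℝ, ξ - l • ν ≠ 0) :
    IsSymmetrizedPencil (symbol A ν) (symbol A ξ) (fun l => S (ξ - l • ν)) C c where
  det_ne_zero := hH.det_symbol_ne_zero
  real z hz := by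
    have h1 := hH.det_symbol_add_ne_zero (ξ - z.re • ν) (neg_ne_zero.2 hz)
    rw [symbol_sub_smul] at h1
    convert h1 using 2
    rw [sub_add, ← sub_smul]
    congr 2
    apply Complex.ext <;> simp
  bounded l := hS.bounded _ (hne l)
  selfAdjoint l := by
    rw [← symbol_sub_smul]; exact hS.selfAdjoint _ (hne l)
  positive l u hu := by
    rw [← symbol_sub_smul] at hu
    exact hp _ (hne l) u hu

end Pencil

/-! ### Regularity of matrix-valued functions. -/

section MatrixRegularity

open Set Filter Topology

attribute [local instance] Matrix.linftyOpNormedRing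

/-- The algebra norm on matrices which is associated to the sup norm on `ℂᴺ`. -/
noncomputable abbrev cMatNormedAlgebra (N : ℕ) : NormedAlgebra ℂ (CMat N) :=
  Matrix.linftyOpNormedAlgebra

attribute [local instance] cMatNormedAlgebra

variable {N : ℕ}

theorem CMat.norm_entry_le (A : CMat N) (i j : Fin N) : ‖A i j‖ ≤ ‖A‖ := by
  rw [← coe_nnnorm, ← coe_nnnorm, NNReal.coe_le_coe, Matrix.linfty_opNNNorm_def]
  refine le_trans ?_ (Finset.le_sup (f := fun i => ∑ j, ‖A i j‖₊) (Finset.mem_univ i))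
  exact Finset.single_le_sum (f := fun j => ‖A i j‖₊) (fun _ _ => zero_le) (Finset.mem_univ j)

theorem CMat.norm_le_of_entry_le {A : CMat N} {C : ℝ} (hC : 0 ≤ C) (h : ∀ i j, ‖A i j‖ ≤ C) :
    ‖A‖ ≤ N * C := by
  lift C to NNReal using hC
  rw [← coe_nnnorm, Matrix.linfty_opNNNorm_def]
  have : (Finset.univ.sup fun i => ∑ j, ‖A i j‖₊) ≤ N * C := by
    refine Finset.sup_le fun i _ => ?_
    calc ∑ j, ‖A i j‖₊ ≤ ∑ _j : Fin N, C := Finset.sum_le_sum fun j _ => by exact_mod_cast h i j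
      _ = N * C := by simp
  exact_mod_cast this

theorem CMat.entry_le_of_vecNorm_le {A : CMat N} {B : ℝ}
    (h : ∀ u, vecNorm (A *ᵥ u) ≤ B * vecNorm u) (i j : Fin N) : ‖A i j‖ ≤ B := by
  have h1 := h (Pi.single j 1)
  rw [Matrix.mulVec_single_one] at h1
  have h2 : vecNorm (Pi.single j (1 : ℂ) : Fin N → ℂ) = 1 := by
    rw [← pow_left_inj₀ (vecNorm_nonneg _) zero_le_one two_ne_zero, vecNorm_sq, normSqVec,
      Finset.sum_eq_single j (fun k _ hk => by simp [hk]) (by simp)]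
    simp
  rw [h2, mul_one] at h1
  exact (norm_apply_le_vecNorm (A.col j) i).trans h1

variable {V : Type*} [NormedAddCommGroup V] [NormedSpace ℝ V] {r : Regularity} {Ω : Set V}

theorem regOn_cMat_iff {F : V → CMat N} :
    RegOn r F Ω ↔ ∀ i j, RegOn r (fun x => F x i j) Ω := by
  constructor
  · intro h i j
    exact h.clm ((LinearMap.toContinuousLinearMap
      (Matrix.entryLinearMap ℂ ℂ i j : CMat N →ₗ[ℂ] ℂ)).restrictScalars ℝ)
  · intro h
    have h1 : RegOn r (fun x => ∑ i, ∑ j, Matrix.single i j (F x i j)) Ω :=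
      RegOn.sum _ fun i _ => RegOn.sum _ fun j _ =>
        (h i j).clm ((LinearMap.toContinuousLinearMap
          (Matrix.singleLinearMap ℂ i j : ℂ →ₗ[ℂ] CMat N)).restrictScalars ℝ)
    have e : F = fun x => ∑ i, ∑ j, Matrix.single i j (F x i j) :=
      funext fun x => Matrix.matrix_eq_sum_single (F x)
    rw [e]
    exact h1

theorem RegOn.cMat_mul {F G : V → CMat N} (hF : RegOn r F Ω) (hG : RegOn r G Ω) {a b : ℝ}
    (ha : ∀ x ∈ Ω, ‖F x‖ ≤ a) (hb : ∀ x ∈ Ω, ‖G x‖ ≤ b) : RegOn r (fun x => F x * G x) Ω :=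
  RegOn.bilin (ContinuousLinearMap.mul ℝ (CMat N)) hF hG ha hb

theorem RegOn.cMat_conjTranspose {F : V → CMat N} (hF : RegOn r F Ω) :
    RegOn r (fun x => (F x)ᴴ) Ω :=
  regOn_cMat_iff.2 fun i j =>
    (regOn_cMat_iff.1 hF j i).clm (Complex.conjCLE : ℂ →L[ℝ] ℂ)

theorem RegOn.cMat_const_smul {F : V → CMat N} (hF : RegOn r F Ω) (c : ℂ) :
    RegOn r (fun x => c • F x) Ω :=
  hF.clm ((c • ContinuousLinearMap.id ℂ (CMat N)).restrictScalars ℝ)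

/-- Inversion is smooth on the open set of units. The bounds on `F` and on its inverse confine the
pair to a compact part of `{(X, Y) | X * Y = 1}`, whose first projection is a compact set of units
containing the values of `F`. -/
theorem RegOn.cMat_inv {F : V → CMat N} (hF : RegOn r F Ω) {a b : ℝ}
    (ha : ∀ x ∈ Ω, ‖F x‖ ≤ a) (hb : ∀ x ∈ Ω, ‖(F x)⁻¹‖ ≤ b) (hdet : ∀ x ∈ Ω, (F x).det ≠ 0) :
    RegOn r (fun x => (F x)⁻¹) Ω := by
  have hcomp : CompleteSpace (CMat N) := FiniteDimensional.complete ℂ _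
  have hprop : ProperSpace (CMat N) := FiniteDimensional.proper ℂ _
  set Q : Set (CMat N × CMat N) :=
    (Metric.closedBall 0 a ×ˢ Metric.closedBall 0 b) ∩ {p | p.1 * p.2 = 1} with hQ
  have hQc : IsCompact Q :=
    ((isCompact_closedBall _ _).prod (isCompact_closedBall _ _)).inter_right
      (isClosed_eq (by fun_prop) continuous_const)
  have h := hF.contDiffOn_comp (g := (Ring.inverse : CMat N → CMat N)) (O := {X | IsUnit X})
    (Q := Prod.fst '' Q) (fun X hX => ?_) Units.isOpen (hQc.image continuous_fst) ?_ ?_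
  · simpa only [Matrix.nonsing_inv_eq_ringInverse] using h
  · obtain ⟨u, rfl⟩ := hX
    exact (contDiffAt_ringInverse ℝ u).contDiffWithinAt
  · rintro X ⟨p, hp, rfl⟩
    exact Matrix.isUnit_iff_isUnit_det _ |>.2 (Matrix.isUnit_det_of_right_inverse hp.2)
  · intro x hx
    refine ⟨(F x, (F x)⁻¹), ⟨⟨?_, ?_⟩, ?_⟩, rfl⟩
    · simpa using ha x hx
    · simpa using hb x hx
    · exact Matrix.mul_nonsing_inv _ (hdet x hx).isUnit

theorem norm_symbol_entry_le {d : ℕ} {A : Fin (d + 1) → CMat N} {ξ : Freq d} {M B : ℝ}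
    (hA : ∀ k i j, ‖A k i j‖ ≤ M) (hξ : ‖ξ‖ ≤ B) (i j : Fin N) :
    ‖symbol A ξ i j‖ ≤ (d + 1) * (B * M) := by
  have h1 : symbol A ξ i j = ∑ k, ((ξ k : ℝ) : ℂ) * A k i j := by
    simp [symbol, Matrix.sum_apply]
  rw [h1]
  calc ‖∑ k, ((ξ k : ℝ) : ℂ) * A k i j‖ ≤ ∑ _k : Fin (d + 1), B * M :=
        norm_sum_le_of_le _ fun k _ => by
          rw [norm_mul, Complex.norm_real]
          have h2 : ‖ξ k‖ ≤ B := (PiLp.norm_apply_le ξ k).trans hξ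
          exact mul_le_mul h2 (hA k i j) (norm_nonneg _) ((norm_nonneg _).trans h2)
    _ = (d + 1) * (B * M) := by simp

theorem RegOn.symbol {d : ℕ} {A : V → Fin (d + 1) → CMat N} {ξ : V → Freq d} {M B : ℝ}
    (hA : ∀ k i j, RegOn r (fun x => A x k i j) Ω) (hξ : RegOn r ξ Ω)
    (hAM : ∀ x ∈ Ω, ∀ k i j, ‖A x k i j‖ ≤ M) (hξB : ∀ x ∈ Ω, ‖ξ x‖ ≤ B) :
    RegOn r (fun x => symbol (A x) (ξ x)) Ω := by
  refine regOn_cMat_iff.2 fun i j => ?_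
  have e : (fun x => _root_.symbol (A x) (ξ x) i j)
      = fun x => ∑ k, ((ξ x k : ℝ) : ℂ) * A x k i j := by
    funext x
    simp [_root_.symbol, Matrix.sum_apply]
  rw [e]
  refine RegOn.sum _ fun k _ => RegOn.bilin (ContinuousLinearMap.mul ℝ ℂ)
    (hξ.clm (Complex.ofRealCLM.comp (EuclideanSpace.proj k : Freq d →L[ℝ] ℝ))) (hA k i j)
    (Cf := B) (fun x hx => ?_) (fun x hx => hAM x hx k i j)
  simpa using (PiLp.norm_apply_le (ξ x) k).trans (hξB x hx)

end MatrixRegularity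

/-! ### Normalization to the unit sphere. -/

section Normalize

open Set

theorem isOpen_shell (W : Type*) [NormedAddCommGroup W] : IsOpen (shell W) :=
  (isOpen_lt continuous_const continuous_norm).inter (isOpen_lt continuous_norm continuous_const)

theorem ne_zero_of_mem_shell {W : Type*} [NormedAddCommGroup W] {ξ : W} (h : ξ ∈ shell W) :
    ξ ≠ 0 := by
  rintro rfl
  have := h.1
  norm_num at this

theorem norm_inv_norm_smul {W : Type*} [NormedAddCommGroup W] [NormedSpace ℝ W] {ξ : W}
    (h : ξ ≠ 0) : ‖‖ξ‖⁻¹ • ξ‖ = 1 := by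
  rw [norm_smul, norm_inv, norm_norm, inv_mul_cancel₀ (norm_ne_zero_iff.2 h)]

theorem inv_norm_smul_mem_shell {W : Type*} [NormedAddCommGroup W] [NormedSpace ℝ W] {ξ : W}
    (h : ξ ≠ 0) : ‖ξ‖⁻¹ • ξ ∈ shell W := by
  refine ⟨?_, ?_⟩ <;> rw [norm_inv_norm_smul h] <;> norm_num

theorem inv_norm_smul_smul {W : Type*} [NormedAddCommGroup W] [NormedSpace ℝ W] (ξ : W) {t : ℝ}
    (ht : 0 < t) : ‖t • ξ‖⁻¹ • t • ξ = ‖ξ‖⁻¹ • ξ := by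
  rw [norm_smul, Real.norm_of_nonneg ht.le, smul_smul, mul_inv, mul_right_comm,
    inv_mul_cancel₀ ht.ne', one_mul]

theorem norm_smul_inv_norm_smul {W : Type*} [NormedAddCommGroup W] [NormedSpace ℝ W] {ξ : W}
    (h : ξ ≠ 0) : ‖ξ‖ • ‖ξ‖⁻¹ • ξ = ξ := by
  rw [smul_smul, mul_inv_cancel₀ (norm_ne_zero_iff.2 h), one_smul]

variable {V W : Type*} [NormedAddCommGroup V] [NormedSpace ℝ V] [NormedAddCommGroup W]
  [InnerProductSpace ℝ W] {r : Regularity} {Ω : Set V}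

theorem contDiffOn_inv_norm_smul : ContDiffOn ℝ ∞ (fun ξ : W => ‖ξ‖⁻¹ • ξ) {ξ | ξ ≠ 0} :=
  fun _ hξ => (((contDiffAt_norm ℝ hξ).inv (norm_ne_zero_iff.2 hξ)).smul
    contDiffAt_id).contDiffWithinAt

theorem RegOn.normalize {f : V → W} (hf : RegOn r f Ω) {Q : Set W} (hQ : IsCompact Q)
    (hQ0 : (0 : W) ∉ Q) (h : MapsTo f Ω Q) : RegOn r (fun x => ‖f x‖⁻¹ • f x) Ω :=
  hf.contDiffOn_comp (g := fun ξ : W => ‖ξ‖⁻¹ • ξ) contDiffOn_inv_norm_smul isOpen_ne hQ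
    (fun _ hξ h0 => hQ0 (h0 ▸ hξ)) h

theorem isCompact_closed_shell [FiniteDimensional ℝ W] (δ B : ℝ) :
    IsCompact {ξ : W | δ ≤ ‖ξ‖ ∧ ‖ξ‖ ≤ B} := by
  have hW := FiniteDimensional.proper_real W
  refine (isCompact_closedBall (0 : W) B).of_isClosed_subset ?_ fun ξ hξ => by simpa using hξ.2
  exact (isClosed_le continuous_const continuous_norm).inter
    (isClosed_le continuous_norm continuous_const)

theorem RegOn.normalize_of_le [FiniteDimensional ℝ W] {f : V → W} (hf : RegOn r f Ω) {δ B : ℝ}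
    (hδ : 0 < δ) (h : ∀ x ∈ Ω, δ ≤ ‖f x‖) (h' : ∀ x ∈ Ω, ‖f x‖ ≤ B) :
    RegOn r (fun x => ‖f x‖⁻¹ • f x) Ω :=
  hf.normalize (isCompact_closed_shell δ B)
    (fun h0 => by have := h0.1; rw [norm_zero] at this; linarith) fun x hx => ⟨h x hx, h' x hx⟩

theorem regOn_normalize_snd [FiniteDimensional ℝ W] (s : Set V) :
    RegOn r (fun x : V × W => (x.1, ‖x.2‖⁻¹ • x.2)) (s ×ˢ shell W) :=
  (regOn_fst r _).prodMk ((regOn_snd r _).normalize_of_le one_half_pos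
    (fun _ hx => hx.2.1.le) fun _ hx => hx.2.2.le)

theorem RegOn.comp_normalize_snd [FiniteDimensional ℝ W] {F : Type*} [NormedAddCommGroup F]
    [NormedSpace ℝ F] {s : Set V} {f : V × W → F} (hf : RegOn r f (s ×ˢ shell W)) :
    RegOn r (fun x : V × W => f (x.1, ‖x.2‖⁻¹ • x.2)) (s ×ˢ shell W) :=
  hf.comp (regOn_normalize_snd s) fun _ hx =>
    ⟨hx.1, inv_norm_smul_mem_shell (ne_zero_of_mem_shell hx.2)⟩

theorem regOn_cos (r : Regularity) (s : Set ℝ) : RegOn r Real.cos s := by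
  cases r with
  | continuous => exact Real.continuous_cos.continuousOn
  | w1infty => exact ⟨1, fun x _ => ⟨univ, Filter.univ_mem, Real.lipschitzWith_cos.lipschitzOnWith⟩⟩
  | smooth => exact Real.contDiff_cos.contDiffOn

theorem regOn_sin (r : Regularity) (s : Set ℝ) : RegOn r Real.sin s := by
  cases r with
  | continuous => exact Real.continuous_sin.continuousOn
  | w1infty => exact ⟨1, fun x _ => ⟨univ, Filter.univ_mem, Real.lipschitzWith_sin.lipschitzOnWith⟩⟩
  | smooth => exact Real.contDiff_sin.contDiffOn

end Normalize

/-! ### From full symmetrizers to symmetrizers on `E`. -/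

section Converse

open Set

attribute [local instance] Matrix.linftyOpNormedRing cMatNormedAlgebra

variable {m d N : ℕ} {r : Regularity}

/-- The symbol is odd, so `S (-ξ)` symmetrizes at `ξ` as well. Homogeneity concerns positive factors
only; evenness is what gives period `π` in the angle on the circle through `ξ` and `ν`. -/
theorem IsFullSymmetrizer.even {A : Fin (d + 1) → CMat N} {S : Freq d → CMat N} {C : ℝ}
    (h : IsFullSymmetrizer A S C) :
    IsFullSymmetrizer A (fun ξ => (1 / 2 : ℂ) • (S ξ + S (-ξ))) C where
  bounded ξ hξ i j := by
    have h1 := h.bounded ξ hξ i j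
    have h2 := h.bounded (-ξ) (neg_ne_zero.2 hξ) i j
    have h3 := norm_add_le (S ξ i j) (S (-ξ) i j)
    simp only [Matrix.smul_apply, Matrix.add_apply, smul_eq_mul, norm_mul]
    norm_num
    linarith
  homog ξ hξ t ht := by
    simp only [h.homog ξ hξ t ht, ← smul_neg, h.homog (-ξ) (neg_ne_zero.2 hξ) t ht]
  selfAdjoint ξ hξ := by
    have h1 := (h.selfAdjoint ξ hξ).eq
    have h2 := (h.selfAdjoint (-ξ) (neg_ne_zero.2 hξ)).eq
    have e : symbol A (-ξ) = -symbol A ξ := by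
      simpa using symbol_smul A (-1) ξ
    rw [e, mul_neg, Matrix.conjTranspose_neg, neg_inj] at h2
    simp only [Matrix.IsHermitian, smul_mul_assoc, add_mul, Matrix.conjTranspose_smul,
      Matrix.conjTranspose_add, h1, h2]
    simp

theorem IsPositiveInDirection.even {A : Fin (d + 1) → CMat N} {ν : Freq d}
    {S : Freq d → CMat N} {c : ℝ} (h : IsPositiveInDirection A ν S c) :
    IsPositiveInDirection A ν (fun ξ => (1 / 2 : ℂ) • (S ξ + S (-ξ))) c := by
  intro ξ hξ u hu
  have e : symbol A (-ξ) = -symbol A ξ := by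
    simpa using symbol_smul A (-1) ξ
  have h1 := h ξ hξ u hu
  have h2 := h (-ξ) (neg_ne_zero.2 hξ) u (by rw [e, Matrix.neg_mulVec, hu, neg_zero])
  simp only [smul_mul_assoc, add_mul, Matrix.smul_mulVec, Matrix.add_mulVec, herm_smul_left,
    herm_add_left]
  simp
  linarith

theorem RegOn.comp_homog {W : Type*} [NormedAddCommGroup W] [InnerProductSpace ℝ W]
    {S : EuclideanSpace ℝ (Fin m) → W → CMat N} {𝒜 : Set (EuclideanSpace ℝ (Fin m))} {i j : Fin N}
    (hS : RegOn r (fun x : EuclideanSpace ℝ (Fin m) × W => S x.1 x.2 i j) (𝒜 ×ˢ shell W))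
    (hom : ∀ a ∈ 𝒜, ∀ ξ : W, ξ ≠ 0 → ∀ t : ℝ, 0 < t → S a (t • ξ) = S a ξ)
    {V : Type*} [NormedAddCommGroup V] [NormedSpace ℝ V] {Ω : Set V} (hΩ : IsOpen Ω)
    {α : V → EuclideanSpace ℝ (Fin m)} {f : V → W} (hα : RegOn r α Ω) (hf : RegOn r f Ω)
    (hα𝒜 : MapsTo α Ω 𝒜) {Q : Set W} (hQ : IsCompact Q) (hQ0 : (0 : W) ∉ Q)
    (hfQ : MapsTo f Ω Q) : RegOn r (fun x => S (α x) (f x) i j) Ω := by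
  have h0 : ∀ x ∈ Ω, f x ≠ 0 := fun x hx h => hQ0 (h ▸ hfQ hx)
  refine (hS.comp (hα.prodMk (hf.normalize hQ hQ0 hfQ)) fun x hx =>
    ⟨hα𝒜 hx, inv_norm_smul_mem_shell (h0 x hx)⟩).congr_of_isOpen hΩ fun x hx => ?_
  simp only
  rw [hom _ (hα𝒜 hx) _ (h0 x hx) _ (inv_pos.2 (norm_pos_iff.2 (h0 x hx)))]

theorem smul_add_smul_ne_zero {E : Submodule ℝ (Freq d)} {ξ : E} (hξ : ξ ≠ 0) {ν : Freq d}
    (hν : ν ∉ E) {c s : ℝ} (hcs : c ^ 2 + s ^ 2 ≠ 0) : c • (ξ : Freq d) + s • ν ≠ 0 := by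
  intro h
  have hs : s = 0 := by
    by_contra hs
    refine hν ((E.smul_mem_iff hs).1 ?_)
    rw [eq_neg_of_add_eq_zero_right h]
    exact E.neg_mem (E.smul_mem _ ξ.2)
  subst hs
  rw [zero_smul, add_zero, smul_eq_zero] at h
  rcases h with h | h
  · simp [h] at hcs
  · exact hξ (by exact_mod_cast h)

/-- The points `cos θ ξ + sin θ ν` stay in a compact set that avoids `0` because `K` does not meet
`E`; this makes the Lipschitz constant uniform in the parameters and the angle. -/
theorem regOn_arc {𝒜 : Set (EuclideanSpace ℝ (Fin m))} (h𝒜 : IsOpen 𝒜)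
    {E : Submodule ℝ (Freq d)} {ν : EuclideanSpace ℝ (Fin m) → Freq d} (hν : RegOn r ν 𝒜)
    {K : Set (Freq d)} (hK : IsCompact K) (hKE : ∀ v ∈ K, v ∉ E) (hνK : ∀ a ∈ 𝒜, ν a ∈ K)
    {S : EuclideanSpace ℝ (Fin m) → Freq d → CMat N} {i j : Fin N}
    (hS : RegOn r (fun x : EuclideanSpace ℝ (Fin m) × Freq d => S x.1 x.2 i j) (𝒜 ×ˢ shell _))
    (hom : ∀ a ∈ 𝒜, ∀ ξ : Freq d, ξ ≠ 0 → ∀ t : ℝ, 0 < t → S a (t • ξ) = S a ξ) :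
    RegOn r (fun y : (EuclideanSpace ℝ (Fin m) × E) × ℝ =>
      S y.1.1 (Real.cos y.2 • (y.1.2 : Freq d) + Real.sin y.2 • ν y.1.1) i j)
      ((𝒜 ×ˢ shell E) ×ˢ univ) := by
  set Ω : Set ((EuclideanSpace ℝ (Fin m) × E) × ℝ) := (𝒜 ×ˢ shell E) ×ˢ univ with hΩ
  have hΩo : IsOpen Ω := (h𝒜.prod (isOpen_shell E)).prod isOpen_univ
  have ha : RegOn r (fun y : (EuclideanSpace ℝ (Fin m) × E) × ℝ => y.1.1) Ω :=
    (regOn_fst r Ω).clm (ContinuousLinearMap.fst ℝ _ _)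
  have hξ : RegOn r (fun y : (EuclideanSpace ℝ (Fin m) × E) × ℝ => (y.1.2 : Freq d)) Ω :=
    ((regOn_fst r Ω).clm (ContinuousLinearMap.snd ℝ (EuclideanSpace ℝ (Fin m)) E)).clm E.subtypeL
  have hνa : RegOn r (fun y : (EuclideanSpace ℝ (Fin m) × E) × ℝ => ν y.1.1) Ω :=
    hν.comp ha fun y hy => hy.1.1
  have hc : RegOn r (fun y : (EuclideanSpace ℝ (Fin m) × E) × ℝ => Real.cos y.2) Ω :=
    (regOn_cos r univ).comp (regOn_snd r Ω) (mapsTo_univ _ _)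
  have hs : RegOn r (fun y : (EuclideanSpace ℝ (Fin m) × E) × ℝ => Real.sin y.2) Ω :=
    (regOn_sin r univ).comp (regOn_snd r Ω) (mapsTo_univ _ _)
  obtain ⟨R, hR⟩ := hK.isBounded.exists_norm_le
  have hf := (RegOn.bilin (ContinuousLinearMap.lsmul ℝ ℝ) hc hξ (Cf := 1) (Cg := 2)
      (fun y _ => Real.abs_cos_le_one _) fun y hy => hy.1.2.2.le).add
    (RegOn.bilin (ContinuousLinearMap.lsmul ℝ ℝ) hs hνa (Cf := 1) (Cg := R)
      (fun y _ => Real.abs_sin_le_one _) fun y hy => hR _ (hνK _ hy.1.1))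
  set circle : Set (ℝ × ℝ) := {p | p.1 ^ 2 + p.2 ^ 2 = 1} with hcircle
  have hcc : IsCompact circle := by
    refine (isCompact_closedBall (0 : ℝ × ℝ) 1).of_isClosed_subset
      (isClosed_eq (by fun_prop) continuous_const) fun p hp => ?_
    have hp' : p.1 ^ 2 + p.2 ^ 2 = 1 := hp
    rw [mem_closedBall_zero_iff, Prod.norm_def, max_le_iff, Real.norm_eq_abs, Real.norm_eq_abs]
    exact ⟨abs_le_one_iff_mul_self_le_one.2 (by nlinarith [sq_nonneg p.2]),
      abs_le_one_iff_mul_self_le_one.2 (by nlinarith [sq_nonneg p.1])⟩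
  have hQ : IsCompact ((fun p : (ℝ × ℝ) × E × Freq d =>
      p.1.1 • (p.2.1 : Freq d) + p.1.2 • p.2.2) ''
        (circle ×ˢ {ξ : E | 1 / 2 ≤ ‖ξ‖ ∧ ‖ξ‖ ≤ 2} ×ˢ K)) :=
    (hcc.prod ((isCompact_closed_shell (1 / 2) 2).prod hK)).image (by fun_prop)
  refine RegOn.comp_homog hS hom hΩo ha hf (fun y hy => hy.1.1) hQ ?_ ?_
  · rintro ⟨⟨⟨c, s⟩, ξ, v⟩, ⟨h1, h2, h3⟩, h0⟩
    refine smul_add_smul_ne_zero (ξ := ξ) ?_ (hKE v h3) (c := c) (s := s) ?_ h0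
    · rintro rfl
      have h4 := h2.1
      rw [norm_zero] at h4
      norm_num at h4
    · rw [show c ^ 2 + s ^ 2 = 1 from h1]
      exact one_ne_zero
  · intro y hy
    exact ⟨((Real.cos y.2, Real.sin y.2), y.1.2, ν y.1.1),
      ⟨Real.cos_sq_add_sin_sq _, ⟨hy.1.2.1.le, hy.1.2.2.le⟩, hνK _ hy.1.1⟩, rfl⟩

theorem IsSymmetrizedPencil.norm_proj_le {K X : CMat N} {T : ℝ → CMat N} {C c M : ℝ}
    (h : IsSymmetrizedPencil K X T C c) (hc : 0 < c) (hC : 0 ≤ C) (hM : 0 ≤ M)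
    (hK : ∀ i j, ‖K i j‖ ≤ M) {Λ : Finset ℝ} {P : ℝ → CMat N}
    (hP : IsSpectralResolution (K⁻¹ * X) Λ P) {l : ℝ} (hl : l ∈ Λ) :
    ‖P l‖ ≤ N * (N ^ 2 * C / c * (N ^ 2 * M)) := by
  refine CMat.norm_le_of_entry_le (by positivity) (CMat.entry_le_of_vecNorm_le fun u => ?_)
  rw [mul_assoc]
  exact (h.vecNorm_proj_le hc hC hP hl u).trans
    (mul_le_mul_of_nonneg_left (vecNorm_mulVec_le hM hK u) (by positivity))

theorem IsSymmetrizedPencil.norm_inv_le {K X : CMat N} {T : ℝ → CMat N} {C c : ℝ}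
    (h : IsSymmetrizedPencil K X T C c) (hc : 0 < c) (hC : 0 ≤ C) {Λ : Finset ℝ}
    {P : ℝ → CMat N} (hΛ : Λ.card ≤ N) (hP : IsSpectralResolution (K⁻¹ * X) Λ P) :
    ‖K⁻¹‖ ≤ N * (N * (N ^ 2 * C / c)) := by
  refine CMat.norm_le_of_entry_le (by positivity) (CMat.entry_le_of_vecNorm_le fun u => ?_)
  have h1 := h.vecNorm_le hc hC hΛ hP (K⁻¹ *ᵥ u)
  rwa [Matrix.mulVec_mulVec, Matrix.mul_nonsing_inv _ h.det_ne_zero.isUnit, Matrix.one_mulVec,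
    ← mul_assoc] at h1

theorem CMat.norm_conjTranspose_le {A : CMat N} {b : ℝ} (hA : ‖A‖ ≤ b) : ‖Aᴴ‖ ≤ N * b :=
  CMat.norm_le_of_entry_le ((norm_nonneg A).trans hA) fun i j => by
    rw [Matrix.conjTranspose_apply, norm_star]
    exact (CMat.norm_entry_le A j i).trans hA

/-- Values on the line `ξ + ℝ ν` of an even homogeneous function. -/
theorem cos_smul_add_sin_smul_arctan {W Y : Type*} [NormedAddCommGroup W] [NormedSpace ℝ W]
    {f : W → Y} (hom : ∀ ξ : W, ξ ≠ 0 → ∀ t : ℝ, 0 < t → f (t • ξ) = f ξ) {ξ ν : W} {l : ℝ}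
    (hne : ξ - l • ν ≠ 0) :
    f (Real.cos (-Real.arctan l) • ξ + Real.sin (-Real.arctan l) • ν) = f (ξ - l • ν) := by
  rw [← hom (ξ - l • ν) hne _ (Real.cos_arctan_pos l)]
  congr 1
  have h1 : Real.sin (Real.arctan l) = Real.cos (Real.arctan l) * l := by
    have h2 := Real.tan_mul_cos (Real.cos_arctan_pos l).ne'
    rw [Real.tan_arctan] at h2
    rw [← h2, mul_comm]
  rw [Real.cos_neg, Real.sin_neg, h1, smul_sub, smul_smul, neg_smul, sub_eq_add_neg]

theorem exists_isUniformSymmetrizer_of_even {𝒜 : Set (EuclideanSpace ℝ (Fin m))}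
    (h𝒜 : IsOpen 𝒜) {A : EuclideanSpace ℝ (Fin m) → Fin (d + 1) → CMat N} {M : ℝ} (hM : 0 ≤ M)
    (hAM : ∀ a ∈ 𝒜, ∀ k i j, ‖A a k i j‖ ≤ M)
    (hA : ∀ k i j, RegOn r (fun a => A a k i j) 𝒜)
    {E : Submodule ℝ (Freq d)} {ν : EuclideanSpace ℝ (Fin m) → Freq d} (hν : RegOn r ν 𝒜)
    {K : Set (Freq d)} (hK : IsCompact K) (hKE : ∀ v ∈ K, v ∉ E) (hνK : ∀ a ∈ 𝒜, ν a ∈ K)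
    (hH : ∀ a ∈ 𝒜, IsHyperbolicInDirection (A a) 0 (ν a))
    {S : EuclideanSpace ℝ (Fin m) → Freq d → CMat N} {C c : ℝ} (hC : 0 ≤ C) (hc : 0 < c)
    (hS : ∀ a ∈ 𝒜, IsFullSymmetrizer (A a) (S a) C)
    (hp : ∀ a ∈ 𝒜, IsPositiveInDirection (A a) (ν a) (S a) c)
    (heven : ∀ a ξ, S a (-ξ) = S a ξ)
    (hreg : ∀ i j, RegOn r (fun x : EuclideanSpace ℝ (Fin m) × Freq d => S x.1 x.2 i j)
      (𝒜 ×ˢ shell _)) :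
    ∃ S₀ : EuclideanSpace ℝ (Fin m) → E → CMat N,
      IsUniformSymmetrizer 𝒜 E A ν S₀ ∧ HomogRegularOn r 𝒜 S₀ := by
  have hcomp : CompleteSpace (CMat N) := FiniteDimensional.complete ℂ _
  obtain ⟨R, hR⟩ := hK.isBounded.exists_norm_le
  set Ω : Set (EuclideanSpace ℝ (Fin m) × E) := 𝒜 ×ˢ shell E with hΩ
  have hΩo : IsOpen Ω := h𝒜.prod (isOpen_shell E)
  have hne : ∀ x ∈ Ω, ∀ l : ℝ, (x.2 : Freq d) - l • ν x.1 ≠ 0 := fun x hx l => by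
    have := smul_add_smul_ne_zero (ne_zero_of_mem_shell hx.2) (hKE _ (hνK _ hx.1)) (c := 1)
      (s := -l) (by positivity)
    rwa [one_smul, neg_smul, ← sub_eq_add_neg] at this
  set L : EuclideanSpace ℝ (Fin m) × E → CMat N := fun x => symbol (A x.1) (ν x.1) with hL
  set X : EuclideanSpace ℝ (Fin m) × E → CMat N := fun x => symbol (A x.1) (x.2 : Freq d) with hX
  set T : EuclideanSpace ℝ (Fin m) × E → ℝ → CMat N :=
    fun x l => S x.1 ((x.2 : Freq d) - l • ν x.1) with hT
  have hpen : ∀ x ∈ Ω, IsSymmetrizedPencil (L x) (X x) (T x) C c := fun x hx =>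
    isSymmetrizedPencil_of_isFullSymmetrizer (hH _ hx.1) (hS _ hx.1) (hp _ hx.1) (hne x hx)
  have hres := fun x hx => (hpen x hx).exists_isSpectralResolution hc
  choose! Λ P hΛ hP using hres
  -- regularity and bounds of `L`, `X`, `L⁻¹`
  have hAr : ∀ k i j, RegOn r (fun x : EuclideanSpace ℝ (Fin m) × E => A x.1 k i j) Ω :=
    fun k i j => (hA k i j).comp (regOn_fst r Ω) fun x hx => hx.1
  have hR0 : 0 ≤ |R| := abs_nonneg R
  have hνR : ∀ x ∈ Ω, ‖ν x.1‖ ≤ |R| := fun x hx => (hR _ (hνK _ hx.1)).trans (le_abs_self R)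
  have hLr : RegOn r L Ω := RegOn.symbol hAr (hν.comp (regOn_fst r Ω) fun x hx => hx.1)
    (fun x hx => hAM _ hx.1) hνR
  have hXr : RegOn r X Ω := RegOn.symbol hAr ((regOn_snd r Ω).clm E.subtypeL)
    (fun x hx => hAM _ hx.1) fun x hx => (hx.2.2.le : ‖x.2‖ ≤ 2)
  have hLe : ∀ x ∈ Ω, ∀ i j, ‖L x i j‖ ≤ (d + 1) * (|R| * M) := fun x hx =>
    norm_symbol_entry_le (hAM _ hx.1) (hνR x hx)
  have hLb : ∀ x ∈ Ω, ‖L x‖ ≤ N * ((d + 1) * (|R| * M)) := fun x hx =>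
    CMat.norm_le_of_entry_le (by positivity) (hLe x hx)
  have hXb : ∀ x ∈ Ω, ‖X x‖ ≤ N * ((d + 1) * (2 * M)) := fun x hx =>
    CMat.norm_le_of_entry_le (by positivity)
      (norm_symbol_entry_le (hAM _ hx.1) (hx.2.2.le : ‖x.2‖ ≤ 2))
  have hLi := fun x hx => (hpen x hx).norm_inv_le hc hC (hΛ x hx) (hP x hx)
  have hLir : RegOn r (fun x => (L x)⁻¹) Ω :=
    hLr.cMat_inv hLb hLi fun x hx => (hpen x hx).det_ne_zero
  have hPb := fun x hx l (hl : l ∈ Λ x) =>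
    (hpen x hx).norm_proj_le hc hC (by positivity) (hLe x hx) (hP x hx) hl
  set p : ℝ := N * (N ^ 2 * C / c * (N ^ 2 * ((d + 1) * (|R| * M)))) with hpdef
  have hp0 : 0 ≤ p := by positivity
  -- the sums over the spectrum
  have hG : ∀ k i, RegOn r (fun x => ∑ l ∈ Λ x, star (T x l k i) • P x l) Ω := by
    intro k i
    have h1 := regOn_spectral_sum (C := p) (n := N)
      (g := fun y : (EuclideanSpace ℝ (Fin m) × E) × ℝ =>
        star (S y.1.1 (Real.cos y.2 • (y.1.2 : Freq d) + Real.sin y.2 • ν y.1.1) k i)) hΩo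
      (hLir.cMat_mul hXr hLi hXb) hP hΛ hp0 hPb
      ((regOn_arc h𝒜 hν hK hKE hνK (hreg k i) fun a ha => (hS a ha).homog).clm
        (Complex.conjCLE : ℂ →L[ℝ] ℂ)) fun x hx θ => by
          -- Adding `π` to the angle negates the frequency.
          simp only [Real.cos_add_pi, Real.sin_add_pi, neg_smul, ← neg_add, heven]
    refine h1.congr_of_isOpen hΩo fun x hx => ?_
    refine Finset.sum_congr rfl fun l _ => ?_
    simp only [hT]
    rw [cos_smul_add_sin_smul_arctan (hS _ hx.1).homog (hne x hx l)]
  set Y : EuclideanSpace ℝ (Fin m) × E → CMat N := fun x => ∑ l ∈ Λ x, (T x l)ᴴ * P x l with hY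
  have hYr : RegOn r Y Ω := by
    refine regOn_cMat_iff.2 fun i j => ?_
    -- Expanding the products with `(T x l)ᴴ` entry by entry leaves sums of projectors with scalar
    -- coefficients, to which `hG` applies.
    have e : (fun x => Y x i j)
        = fun x => ∑ k, (∑ l ∈ Λ x, star (T x l k i) • P x l) k j := by
      funext x
      simp only [hY, Matrix.sum_apply, Matrix.mul_apply, Matrix.conjTranspose_apply,
        Matrix.smul_apply, smul_eq_mul]
      exact Finset.sum_comm
    rw [e]
    exact RegOn.sum _ fun k _ => regOn_cMat_iff.1 (hG k i) k j
  have hYb : ∀ x ∈ Ω, ‖Y x‖ ≤ N * ((N * (N * C)) * p) := fun x hx => by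
    have hΛ' : ((Λ x).card : ℝ) ≤ N := by exact_mod_cast hΛ x hx
    calc ‖Y x‖ ≤ ∑ _l ∈ Λ x, (N * (N * C)) * p := norm_sum_le_of_le _ fun l hl =>
          (norm_mul_le _ _).trans (mul_le_mul (CMat.norm_conjTranspose_le
            (CMat.norm_le_of_entry_le hC ((hpen x hx).bounded l))) (hPb x hx l hl)
            (norm_nonneg _) (by positivity))
      _ = (Λ x).card * ((N * (N * C)) * p) := by simp
      _ ≤ _ := by gcongr
  have hLc := fun x hx => CMat.norm_conjTranspose_le (hLb x hx)
  have hYc := fun x hx => CMat.norm_conjTranspose_le (hYb x hx)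
  set H : EuclideanSpace ℝ (Fin m) × E → CMat N :=
    fun x => (1 / 2 : ℂ) • ((L x)ᴴ * Y x + (Y x)ᴴ * L x) with hHdef
  have hHr : RegOn r H Ω := ((hLr.cMat_conjTranspose.cMat_mul hYr hLc hYb).add
    (hYr.cMat_conjTranspose.cMat_mul hLr hYc hLb)).cMat_const_smul _
  obtain ⟨h, hHb⟩ : ∃ h, ∀ x ∈ Ω, ‖H x‖ ≤ h := ⟨_, fun x hx => (norm_smul_le _ _).trans
    (mul_le_mul_of_nonneg_left ((norm_add_le _ _).trans (add_le_add
      ((norm_mul_le _ _).trans (mul_le_mul (hLc x hx) (hYb x hx) (norm_nonneg _)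
        ((norm_nonneg _).trans (hLc x hx))))
      ((norm_mul_le _ _).trans (mul_le_mul (hYc x hx) (hLb x hx) (norm_nonneg _)
        ((norm_nonneg _).trans (hYc x hx)))))) (norm_nonneg _))⟩
  have hSr : RegOn r (fun x => H x * (L x)⁻¹) Ω := hHr.cMat_mul hLir hHb hLi
  obtain ⟨B, hSb⟩ : ∃ B, ∀ x ∈ Ω, ‖H x * (L x)⁻¹‖ ≤ B := ⟨_, fun x hx => (norm_mul_le _ _).trans
    (mul_le_mul (hHb x hx) (hLi x hx) (norm_nonneg _) ((norm_nonneg _).trans (hHb x hx)))⟩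
  have key := fun x hx =>
    (hpen x hx).isHermitian_and_positive hc (hΛ x hx) (hP x hx) (Y := Y x) (H := H x) rfl rfl
  have hmem : ∀ a ∈ 𝒜, ∀ ξ : E, ξ ≠ 0 → (a, ‖ξ‖⁻¹ • ξ) ∈ Ω := fun a ha ξ hξ =>
    ⟨ha, inv_norm_smul_mem_shell hξ⟩
  have hdir : ∀ a ∈ 𝒜, ∀ ξ : E, ξ ≠ 0 →
      H (a, ‖ξ‖⁻¹ • ξ) * (L (a, ‖ξ‖⁻¹ • ξ))⁻¹ * symbol (A a) (ν a) = H (a, ‖ξ‖⁻¹ • ξ) :=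
    fun a ha ξ hξ => by
      rw [mul_assoc]
      exact (congrArg _ (Matrix.nonsing_inv_mul _
        (hpen _ (hmem a ha ξ hξ)).det_ne_zero.isUnit)).trans (mul_one _)
  -- The symmetrizer is `H L⁻¹` at normalized frequencies: times `L(ν)` it is `H`, and times `L(ξ)`
  -- it is a positive multiple of `H (L⁻¹ X)`.
  refine ⟨fun a ξ => H (a, ‖ξ‖⁻¹ • ξ) * (L (a, ‖ξ‖⁻¹ • ξ))⁻¹,
    ⟨B, c / (N + 1), by positivity, fun a ha => ⟨fun ξ hξ i j => ?_, fun ξ hξ t ht => ?_,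
      fun ξ hξ => ?_, fun ξ hξ => ?_, fun ξ hξ u => ?_⟩⟩, fun i j => ?_⟩
  · exact (CMat.norm_entry_le _ i j).trans (hSb _ (hmem a ha ξ hξ))
  · simp only [inv_norm_smul_smul ξ ht]
  · have h1 := (key _ (hmem a ha ξ hξ)).2.1
    rw [← mul_assoc] at h1
    have e : symbol (A a) (ξ : Freq d) = ((‖ξ‖ : ℝ) : ℂ) • X (a, ‖ξ‖⁻¹ • ξ) := by
      simp only [hX]
      rw [← symbol_smul, ← E.coe_smul, norm_smul_inv_norm_smul hξ]
    rw [e, mul_smul_comm, Matrix.IsHermitian, Matrix.conjTranspose_smul, h1.eq]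
    simp
  · rw [hdir a ha ξ hξ]
    exact (key _ (hmem a ha ξ hξ)).1
  · rw [hdir a ha ξ hξ]
    exact (key _ (hmem a ha ξ hξ)).2.2 u
  · exact RegOn.on (B := B) hΩo (regOn_cMat_iff.1 hSr.comp_normalize_snd i j) fun x hx =>
      (CMat.norm_entry_le _ i j).trans (hSb _ (hmem _ hx.1 _ (ne_zero_of_mem_shell hx.2)))

theorem IsUniformFullSymmetrizer.exists_isUniformSymmetrizer
    {𝒜 : Set (EuclideanSpace ℝ (Fin m))}
    (h𝒜 : IsOpen 𝒜) {A : EuclideanSpace ℝ (Fin m) → Fin (d + 1) → CMat N} {M : ℝ} (hM : 0 ≤ M)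
    (hAM : ∀ a ∈ 𝒜, ∀ k i j, ‖A a k i j‖ ≤ M)
    (hA : ∀ k i j, RegOn r (fun a => A a k i j) 𝒜)
    {E : Submodule ℝ (Freq d)} {ν : EuclideanSpace ℝ (Fin m) → Freq d} (hν : RegOn r ν 𝒜)
    {K : Set (Freq d)} (hK : IsCompact K) (hKE : ∀ v ∈ K, v ∉ E) (hνK : ∀ a ∈ 𝒜, ν a ∈ K)
    (hH : ∀ a ∈ 𝒜, IsHyperbolicInDirection (A a) 0 (ν a))
    {S : EuclideanSpace ℝ (Fin m) → Freq d → CMat N} (hS : IsUniformFullSymmetrizer 𝒜 A ν S)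
    (hreg : ∀ i j, RegOn r (fun x : EuclideanSpace ℝ (Fin m) × Freq d => S x.1 x.2 i j)
      (𝒜 ×ˢ shell _)) :
    ∃ S₀ : EuclideanSpace ℝ (Fin m) → E → CMat N,
      IsUniformSymmetrizer 𝒜 E A ν S₀ ∧ HomogRegularOn r 𝒜 S₀ := by
  obtain ⟨⟨C, hC⟩, c, hc, hp⟩ := hS
  refine exists_isUniformSymmetrizer_of_even h𝒜 hM hAM hA hν hK hKE hνK hH (abs_nonneg C) hc
    (S := fun a ξ => (1 / 2 : ℂ) • (S a ξ + S a (-ξ))) (fun a ha => ?_)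
    (fun a ha => (hp a ha).even) (fun a ξ => by simp only [neg_neg, add_comm]) ?_
  · have h1 := (hC a ha).even
    exact ⟨fun ξ hξ i j => (h1.bounded ξ hξ i j).trans (le_abs_self C), h1.homog, h1.selfAdjoint⟩
  · have h1 := regOn_cMat_iff.2 hreg
    have h2 : RegOn r (fun x : EuclideanSpace ℝ (Fin m) × Freq d => S x.1 (-x.2))
        (𝒜 ×ˢ shell _) :=
      h1.comp ((regOn_fst r _).prodMk ((regOn_snd r _).clm (-ContinuousLinearMap.id ℝ _)))
        fun x hx => ⟨hx.1, by simpa [shell] using hx.2⟩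
    exact regOn_cMat_iff.1 ((h1.add h2).cMat_const_smul _)

end Converse

/-! ### From symmetrizers on `E` to full symmetrizers. -/

section Direct

open Set
open scoped RealInnerProductSpace

variable {m d N : ℕ} {r : Regularity}

/-- The projection of `η` onto `E` along `v ∉ E`. -/
noncomputable def projAlong {W : Type*} [NormedAddCommGroup W] [InnerProductSpace ℝ W]
    [FiniteDimensional ℝ W] (E : Submodule ℝ W) (p : W × W) : E :=
  E.orthogonalProjectionOnto
    (p.1 - (⟪p.1, Eᗮ.starProjection p.2⟫ / ‖Eᗮ.starProjection p.2‖ ^ 2) • p.2)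

section ProjAlong

variable {W : Type*} [NormedAddCommGroup W] [InnerProductSpace ℝ W] [FiniteDimensional ℝ W]
  {E : Submodule ℝ W}

theorem starProjection_orthogonal_ne_zero {v : W} (hv : v ∉ E) : Eᗮ.starProjection v ≠ 0 := by
  rwa [Ne, Submodule.starProjection_apply_eq_zero_iff, Submodule.orthogonal_orthogonal]

/-- Pairing `η` with the component of `v` orthogonal to `E` kills the part in `E` and reads off `τ`.
-/
theorem exists_eq_projAlong_add_smul {v : W} (hv : v ∉ E) (h : IsCompl E (Submodule.span ℝ {v}))
    (η : W) : ∃ τ : ℝ, η = (projAlong E (η, v) : W) + τ • v := by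
  obtain ⟨e, he, w, hw, hew⟩ := Submodule.mem_sup.1 (h.sup_eq_top ▸ Submodule.mem_top (x := η))
  obtain ⟨t, rfl⟩ := Submodule.mem_span_singleton.1 hw
  refine ⟨t, ?_⟩
  have h0 := starProjection_orthogonal_ne_zero hv
  have h1 : ⟪η, Eᗮ.starProjection v⟫ = t * ‖Eᗮ.starProjection v‖ ^ 2 := by
    have h2 : ⟪e, Eᗮ.starProjection v⟫ = 0 :=
      (Submodule.mem_orthogonal E _).1 (Submodule.starProjection_apply_mem _ _) e he
    have h3 : ⟪v, Eᗮ.starProjection v⟫ = ‖Eᗮ.starProjection v‖ ^ 2 := by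
      rw [← real_inner_self_eq_norm_sq, Submodule.inner_starProjection_left_eq_right,
        Submodule.starProjection_eq_self_iff.2 (Submodule.starProjection_apply_mem _ _)]
    rw [← hew, inner_add_left, h2, zero_add, real_inner_smul_left, h3]
  have h4 : ⟪η, Eᗮ.starProjection v⟫ / ‖Eᗮ.starProjection v‖ ^ 2 = t := by
    rw [h1, mul_div_cancel_right₀ _ (pow_ne_zero 2 (norm_ne_zero_iff.2 h0))]
  have h5 : (projAlong E (η, v) : W) = e := by
    rw [projAlong]
    simp only [h4]
    rw [← hew, add_sub_cancel_right]
    exact Submodule.starProjection_eq_self_iff.2 he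
  rw [h5, hew]

theorem contDiffOn_projAlong :
    ContDiffOn ℝ ∞ (projAlong E) {p : W × W | Eᗮ.starProjection p.2 ≠ 0} := by
  intro p hp
  have hq : ContDiff ℝ ∞ fun p : W × W => Eᗮ.starProjection p.2 :=
    Eᗮ.starProjection.contDiff.comp contDiff_snd
  have h1 : ContDiffAt ℝ ∞ (fun p : W × W =>
      ⟪p.1, Eᗮ.starProjection p.2⟫ / ‖Eᗮ.starProjection p.2‖ ^ 2) p :=
    (contDiff_fst.inner ℝ hq).contDiffAt.div (hq.norm_sq ℝ).contDiffAt
      (pow_ne_zero 2 (norm_ne_zero_iff.2 hp))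
  exact (E.orthogonalProjectionOnto.contDiff.contDiffAt.comp p
    (contDiffAt_fst.sub (h1.smul contDiffAt_snd))).contDiffWithinAt

end ProjAlong

/-- The full symmetrizer at unit frequencies: it is `S(a, ρ)` if the projection `ρ` of `η` is not
small, and `L(a, η)ᴴ` if it is. -/
noncomputable def gluedSymmetrizer (E : Submodule ℝ (Freq d)) (δ : ℝ)
    (A : EuclideanSpace ℝ (Fin m) → Fin (d + 1) → CMat N) (ν : EuclideanSpace ℝ (Fin m) → Freq d)
    (S : EuclideanSpace ℝ (Fin m) → E → CMat N) (x : EuclideanSpace ℝ (Fin m) × Freq d) : CMat N :=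
  (Real.smoothTransition (‖projAlong E (x.2, ν x.1)‖ ^ 2 / δ - 1) : ℂ) •
      S x.1 (projAlong E (x.2, ν x.1)) +
    (1 - Real.smoothTransition (‖projAlong E (x.2, ν x.1)‖ ^ 2 / δ - 1) : ℂ) •
      (symbol (A x.1) x.2)ᴴ

/-- Two overlapping open sets suffice: where `‖ρ‖² > δ / 2` the projection stays away from the
singularity of `S` at `0`, and where `‖ρ‖² < δ` the cutoff vanishes and only `L(a, η)ᴴ` remains. -/
theorem regOn_gluedSymmetrizer {𝒜 : Set (EuclideanSpace ℝ (Fin m))}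
    (h𝒜 : IsOpen 𝒜) {A : EuclideanSpace ℝ (Fin m) → Fin (d + 1) → CMat N} {M : ℝ}
    (hAM : ∀ a ∈ 𝒜, ∀ k i j, ‖A a k i j‖ ≤ M)
    (hA : ∀ k i j, RegOn r (fun a => A a k i j) 𝒜)
    {E : Submodule ℝ (Freq d)} {ν : EuclideanSpace ℝ (Fin m) → Freq d} (hν : RegOn r ν 𝒜)
    {K : Set (Freq d)} (hK : IsCompact K) (hKE : ∀ v ∈ K, v ∉ E) (hνK : ∀ a ∈ 𝒜, ν a ∈ K)
    {S : EuclideanSpace ℝ (Fin m) → E → CMat N} {C : ℝ}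
    (hom : ∀ a ∈ 𝒜, ∀ ξ : E, ξ ≠ 0 → ∀ t : ℝ, 0 < t → S a (t • ξ) = S a ξ)
    (hSC : ∀ a ∈ 𝒜, ∀ ξ : E, ξ ≠ 0 → ∀ i j, ‖S a ξ i j‖ ≤ C)
    (hreg : ∀ i j, RegOn r (fun x : EuclideanSpace ℝ (Fin m) × E => S x.1 x.2 i j) (𝒜 ×ˢ shell _))
    {δ : ℝ} (hδ : 0 < δ) (i j : Fin N) :
    RegOn r (fun x => gluedSymmetrizer E δ A ν S x i j) (𝒜 ×ˢ shell (Freq d)) := by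
  set Ω : Set (EuclideanSpace ℝ (Fin m) × Freq d) := 𝒜 ×ˢ shell (Freq d) with hΩ
  have hΩo : IsOpen Ω := h𝒜.prod (isOpen_shell _)
  have hEp := FiniteDimensional.proper_real E
  set ρ : EuclideanSpace ℝ (Fin m) × Freq d → E := fun x => projAlong E (x.2, ν x.1) with hρ
  have hO : IsOpen {p : Freq d × Freq d | Eᗮ.starProjection p.2 ≠ 0} :=
    isOpen_ne_fun (by fun_prop) continuous_const
  have hQ := (isCompact_closed_shell (W := Freq d) (1 / 2) 2).prod hK
  have hQO : {η : Freq d | 1 / 2 ≤ ‖η‖ ∧ ‖η‖ ≤ 2} ×ˢ K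
      ⊆ {p : Freq d × Freq d | Eᗮ.starProjection p.2 ≠ 0} :=
    fun p hp => starProjection_orthogonal_ne_zero (hKE _ hp.2)
  have hmaps : MapsTo (fun x : EuclideanSpace ℝ (Fin m) × Freq d => (x.2, ν x.1)) Ω
      ({η : Freq d | 1 / 2 ≤ ‖η‖ ∧ ‖η‖ ≤ 2} ×ˢ K) :=
    fun x hx => ⟨⟨hx.2.1.le, hx.2.2.le⟩, hνK _ hx.1⟩
  have hνr : RegOn r (fun x : EuclideanSpace ℝ (Fin m) × Freq d => ν x.1) Ω :=
    hν.comp (regOn_fst r Ω) fun x hx => hx.1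
  have hρr : RegOn r ρ Ω :=
    ((regOn_snd r Ω).prodMk hνr).contDiffOn_comp contDiffOn_projAlong hO hQ hQO hmaps
  obtain ⟨B, hB⟩ := (hQ.image_of_continuousOn
    (contDiffOn_projAlong.continuousOn.mono hQO)).isBounded.exists_norm_le
  have hρB : ∀ x ∈ Ω, ‖ρ x‖ ≤ B := fun x hx => hB _ ⟨_, hmaps hx, rfl⟩
  have hs : ContinuousOn (fun x => ‖ρ x‖ ^ 2) Ω := hρr.continuousOn.norm.pow 2
  have hLr : RegOn r (fun x : EuclideanSpace ℝ (Fin m) × Freq d =>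
      (symbol (A x.1) x.2)ᴴ i j) Ω :=
    regOn_cMat_iff.1 (RegOn.cMat_conjTranspose (RegOn.symbol
      (fun k i j => (hA k i j).comp (regOn_fst r Ω) fun x hx => hx.1) (regOn_snd r Ω)
      (fun x hx => hAM _ hx.1) fun x hx => hx.2.2.le)) i j
  have hLb : ∀ x ∈ Ω, ‖(symbol (A x.1) x.2)ᴴ i j‖ ≤ (d + 1) * (2 * M) := fun x hx => by
    rw [Matrix.conjTranspose_apply, norm_star]
    exact norm_symbol_entry_le (hAM _ hx.1) hx.2.2.le j i
  set Ω₁ : Set (EuclideanSpace ℝ (Fin m) × Freq d) :=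
    Ω ∩ (fun x => ‖ρ x‖ ^ 2) ⁻¹' Ioi (δ / 2) with hΩ₁
  set Ω₂ : Set (EuclideanSpace ℝ (Fin m) × Freq d) :=
    Ω ∩ (fun x => ‖ρ x‖ ^ 2) ⁻¹' Iio δ with hΩ₂
  have hΩ₁o : IsOpen Ω₁ := hs.isOpen_inter_preimage hΩo isOpen_Ioi
  have hΩ₂o : IsOpen Ω₂ := hs.isOpen_inter_preimage hΩo isOpen_Iio
  have hsub : Ω₁ ⊆ Ω := inter_subset_left
  have hunion : Ω ⊆ Ω₁ ∪ Ω₂ := fun x hx => by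
    rcases lt_or_ge (δ / 2) (‖ρ x‖ ^ 2) with h | h
    · exact Or.inl ⟨hx, h⟩
    · exact Or.inr ⟨hx, show ‖ρ x‖ ^ 2 < δ by linarith⟩
  refine (RegOn.union (Ω := Ω₁) (Ω' := Ω₂) ?_ ?_ hΩ₁o hΩ₂o).mono hunion
  · have hsqrt : ∀ x ∈ Ω₁, √(δ / 2) ≤ ‖ρ x‖ := fun x hx =>
      (Real.sqrt_le_left (norm_nonneg _)).2 (le_of_lt hx.2)
    have hpos : 0 < √(δ / 2) := Real.sqrt_pos.2 (half_pos hδ)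
    have hSr : RegOn r (fun x : EuclideanSpace ℝ (Fin m) × Freq d => S x.1 (ρ x) i j) Ω₁ :=
      RegOn.comp_homog (hreg i j) hom hΩ₁o (regOn_fst r Ω₁) (hρr.mono hsub) (fun x hx => hx.1.1)
        (isCompact_closed_shell (√(δ / 2)) B)
        (fun h => by have := h.1; rw [norm_zero] at this; linarith)
        fun x hx => ⟨hsqrt x hx, hρB x hx.1⟩
    have hSb : ∀ x ∈ Ω₁, ‖S x.1 (ρ x) i j‖ ≤ C := fun x hx =>
      hSC _ hx.1.1 _ (norm_pos_iff.1 (hpos.trans_le (hsqrt x hx))) i j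
    have hg : ContDiff ℝ ∞ fun ξ : E => (Real.smoothTransition (‖ξ‖ ^ 2 / δ - 1) : ℂ) :=
      Complex.ofRealCLM.contDiff.comp (Real.smoothTransition.contDiff.comp
        (((contDiff_norm_sq ℝ).div_const δ).sub contDiff_const))
    have hχ : RegOn r (fun x => (Real.smoothTransition (‖ρ x‖ ^ 2 / δ - 1) : ℂ)) Ω₁ :=
      (hρr.mono hsub).contDiffOn_comp hg.contDiffOn isOpen_univ (isCompact_closedBall 0 B)
        (subset_univ _) fun x hx => by simpa using hρB x hx.1
    have hχ' : RegOn r (fun x => (1 - Real.smoothTransition (‖ρ x‖ ^ 2 / δ - 1) : ℂ)) Ω₁ :=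
      (hρr.mono hsub).contDiffOn_comp (contDiff_const.sub hg).contDiffOn isOpen_univ
        (isCompact_closedBall 0 B) (subset_univ _) fun x hx => by simpa using hρB x hx.1
    have hb : ∀ s : ℝ, ‖(Real.smoothTransition s : ℂ)‖ ≤ 1 := fun s => by
      rw [Complex.norm_real, Real.norm_of_nonneg (Real.smoothTransition.nonneg s)]
      exact Real.smoothTransition.le_one s
    have hb' : ∀ s : ℝ, ‖(1 - Real.smoothTransition s : ℂ)‖ ≤ 1 := fun s => by
      rw [← Complex.ofReal_one, ← Complex.ofReal_sub, Complex.norm_real,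
        Real.norm_of_nonneg (sub_nonneg.2 (Real.smoothTransition.le_one s))]
      linarith [Real.smoothTransition.nonneg s]
    exact (RegOn.bilin (ContinuousLinearMap.mul ℝ ℂ) hχ hSr (fun x _ => hb _) hSb).add
      (RegOn.bilin (ContinuousLinearMap.mul ℝ ℂ) hχ' (hLr.mono hsub) (fun x _ => hb' _)
        fun x hx => hLb x hx.1)
  · refine (hLr.mono inter_subset_left).congr_of_isOpen hΩ₂o fun x hx => ?_
    have h1 : ‖ρ x‖ ^ 2 / δ - 1 ≤ 0 := by
      rw [sub_nonpos, div_le_one hδ]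
      exact le_of_lt hx.2
    have h2 : Real.smoothTransition (‖projAlong E (x.2, ν x.1)‖ ^ 2 / δ - 1) = 0 :=
      Real.smoothTransition.zero_of_nonpos h1
    rw [gluedSymmetrizer, h2]
    simp

theorem norm_gluedSymmetrizer_le {A : EuclideanSpace ℝ (Fin m) → Fin (d + 1) → CMat N} {M : ℝ}
    {E : Submodule ℝ (Freq d)} {ν : EuclideanSpace ℝ (Fin m) → Freq d}
    {S : EuclideanSpace ℝ (Fin m) → E → CMat N} {C c δ : ℝ} (hC : 0 ≤ C)
    {a : EuclideanSpace ℝ (Fin m)} (hAM : ∀ k i j, ‖A a k i j‖ ≤ M)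
    (hS : IsSymmetrizer E (A a) (ν a) (S a) C c) {η : Freq d} (hη : ‖η‖ = 1) (i j : Fin N) :
    ‖gluedSymmetrizer E δ A ν S (a, η) i j‖ ≤ C + (d + 1) * (1 * M) := by
  set s : ℝ := ‖projAlong E (η, ν a)‖ ^ 2 / δ - 1 with hs
  have h0 := Real.smoothTransition.nonneg s
  have h1 := Real.smoothTransition.le_one s
  have e : gluedSymmetrizer E δ A ν S (a, η) i j
      = (Real.smoothTransition s : ℂ) * S a (projAlong E (η, ν a)) i j
        + (1 - Real.smoothTransition s : ℂ) * (symbol (A a) η)ᴴ i j := rfl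
  rw [e]
  refine (norm_add_le _ _).trans (add_le_add ?_ ?_)
  · rw [norm_mul, Complex.norm_real, Real.norm_of_nonneg h0]
    by_cases hρ : projAlong E (η, ν a) = 0
    · have : Real.smoothTransition s = 0 :=
        Real.smoothTransition.zero_of_nonpos (by simp [hs, hρ])
      rw [this, zero_mul]
      exact hC
    · exact (mul_le_of_le_one_left (norm_nonneg _) h1).trans (hS.bounded _ hρ i j)
  · rw [norm_mul, ← Complex.ofReal_one, ← Complex.ofReal_sub, Complex.norm_real,
      Real.norm_of_nonneg (sub_nonneg.2 h1), Matrix.conjTranspose_apply, norm_star]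
    exact (mul_le_of_le_one_left (norm_nonneg _) (by linarith)).trans
      (norm_symbol_entry_le hAM hη.le j i)

/-- With `η = ρ + τ ν`, the product `S(ρ) L(η)` is `S(ρ) L(ρ) + τ S(ρ) L(ν)`, a real combination of
self-adjoint matrices, and the other term is a real multiple of `L(η)ᴴ L(η)`. At `ρ = 0` the cutoff
removes the first term. -/
theorem isHermitian_gluedSymmetrizer_mul
    {A : EuclideanSpace ℝ (Fin m) → Fin (d + 1) → CMat N}
    {E : Submodule ℝ (Freq d)} {ν : EuclideanSpace ℝ (Fin m) → Freq d}
    {S : EuclideanSpace ℝ (Fin m) → E → CMat N} {C c δ : ℝ} {a : EuclideanSpace ℝ (Fin m)}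
    (hS : IsSymmetrizer E (A a) (ν a) (S a) C c) (hν : ν a ∉ E)
    (hE : IsCompl E (Submodule.span ℝ {ν a})) (η : Freq d) :
    (gluedSymmetrizer E δ A ν S (a, η) * symbol (A a) η).IsHermitian := by
  obtain ⟨τ, hτ⟩ := exists_eq_projAlong_add_smul hν hE η
  set s : ℝ := ‖projAlong E (η, ν a)‖ ^ 2 / δ - 1 with hs
  have h1 : ((1 - Real.smoothTransition s : ℂ) •
      ((symbol (A a) η)ᴴ * symbol (A a) η)).IsHermitian := by
    rw [Matrix.IsHermitian, Matrix.conjTranspose_smul, Matrix.conjTranspose_mul,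
      Matrix.conjTranspose_conjTranspose]
    simp
  have h2 : ((Real.smoothTransition s : ℂ) •
      (S a (projAlong E (η, ν a)) * symbol (A a) η)).IsHermitian := by
    by_cases hρ : projAlong E (η, ν a) = 0
    · have : Real.smoothTransition s = 0 :=
        Real.smoothTransition.zero_of_nonpos (by simp [hs, hρ])
      simp [this, Matrix.IsHermitian]
    · have h3 : (S a (projAlong E (η, ν a)) * symbol (A a) η)ᴴ
          = S a (projAlong E (η, ν a)) * symbol (A a) η := by
        have h4 := congrArg (symbol (A a)) hτ
        rw [symbol_add, symbol_smul] at h4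
        rw [h4, mul_add, mul_smul_comm, Matrix.conjTranspose_add,
          Matrix.conjTranspose_smul, (hS.selfAdjoint _ hρ).eq, (hS.selfAdjoint_dir _ hρ).eq]
        simp
      rw [Matrix.IsHermitian, Matrix.conjTranspose_smul, h3]
      simp
  have h3 := h2.add h1
  rwa [← smul_mul_assoc, ← smul_mul_assoc, ← add_mul] at h3

/-- The projection of a characteristic unit frequency is not small. -/
theorem le_norm_projAlong {A : Fin (d + 1) → CMat N} {M : ℝ} (hM : 0 ≤ M)
    (hAM : ∀ k i j, ‖A k i j‖ ≤ M) {E : Submodule ℝ (Freq d)} (hE0 : E ≠ ⊥) {ν : Freq d} {R : ℝ}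
    (hR : ‖ν‖ ≤ R) {S : E → CMat N} {C c : ℝ} (hC : 0 ≤ C) (hc : 0 < c)
    (hS : IsSymmetrizer E A ν S C c) (hν : ν ∉ E) (hE : IsCompl E (Submodule.span ℝ {ν}))
    {η : Freq d} (hη : ‖η‖ = 1) {u : Fin N → ℂ} (hu0 : u ≠ 0) (hu : symbol A η *ᵥ u = 0) :
    1 ≤ (1 + N ^ 2 * C * (N ^ 2 * ((d + 1) * M)) / c * R) * ‖projAlong E (η, ν)‖ := by
  obtain ⟨τ, hτ⟩ := exists_eq_projAlong_add_smul hν hE η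
  set ρ : E := projAlong E (η, ν) with hρ
  -- Positivity at any nonzero frequency of `E` bounds `L(ν)` from below; `ρ` itself cannot be used,
  -- since it is not yet known to be nonzero.
  obtain ⟨ξ, hξE, hξ0⟩ := Submodule.exists_mem_ne_zero_of_ne_bot hE0
  have hξ : (⟨ξ, hξE⟩ : E) ≠ 0 := fun h => hξ0 (congrArg Subtype.val h)
  have hu1 : 0 < vecNorm u :=
    lt_of_le_of_ne (vecNorm_nonneg u) fun h => hu0 (vecNorm_eq_zero.1 h.symm)
  have h1 : c * vecNorm u ≤ N ^ 2 * C * vecNorm (symbol A ν *ᵥ u) := by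
    have h2 := hS.positive _ hξ u
    rw [← vecNorm_sq, ← Matrix.mulVec_mulVec] at h2
    have h3 := h2.trans ((Complex.re_le_norm _).trans (norm_herm_le _ _))
    have h4 := h3.trans (mul_le_mul_of_nonneg_right
      (vecNorm_mulVec_le hC (hS.bounded _ hξ) (symbol A ν *ᵥ u)) hu1.le)
    refine le_of_mul_le_mul_right ?_ hu1
    calc c * vecNorm u * vecNorm u = c * vecNorm u ^ 2 := by ring
      _ ≤ _ := h4
  -- On the kernel, `τ L(ν) u = - L(ρ) u`, and `L(ρ)` is of size `‖ρ‖`.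
  have h2 : |τ| * vecNorm (symbol A ν *ᵥ u) ≤ N ^ 2 * ((d + 1) * (‖ρ‖ * M)) * vecNorm u := by
    have h3 : symbol A (ρ : Freq d) *ᵥ u = (-(τ : ℂ)) • (symbol A ν *ᵥ u) := by
      rw [hτ, symbol_add, symbol_smul, Matrix.add_mulVec, Matrix.smul_mulVec] at hu
      rw [neg_smul]
      exact eq_neg_of_add_eq_zero_left hu
    have h4 := vecNorm_mulVec_le (A := symbol A (ρ : Freq d)) (by positivity)
      (norm_symbol_entry_le hAM (le_refl ‖(ρ : Freq d)‖)) u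
    rw [h3, vecNorm_smul, norm_neg, Complex.norm_real] at h4
    exact h4
  have h3 : |τ| ≤ N ^ 2 * C * (N ^ 2 * ((d + 1) * M)) / c * ‖ρ‖ := by
    rw [div_mul_eq_mul_div, le_div_iff₀ hc]
    refine le_of_mul_le_mul_right ?_ hu1
    calc |τ| * c * vecNorm u = |τ| * (c * vecNorm u) := by ring
      _ ≤ |τ| * (N ^ 2 * C * vecNorm (symbol A ν *ᵥ u)) := by gcongr
      _ = N ^ 2 * C * (|τ| * vecNorm (symbol A ν *ᵥ u)) := by ring
      _ ≤ N ^ 2 * C * (N ^ 2 * ((d + 1) * (‖ρ‖ * M)) * vecNorm u) := by gcongr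
      _ = _ := by ring
  calc (1 : ℝ) = ‖(ρ : Freq d) + τ • ν‖ := by rw [← hτ, hη]
    _ ≤ ‖ρ‖ + |τ| * ‖ν‖ := (norm_add_le _ _).trans (by rw [norm_smul, Real.norm_eq_abs]; rfl)
    _ ≤ ‖ρ‖ + N ^ 2 * C * (N ^ 2 * ((d + 1) * M)) / c * ‖ρ‖ * R := by gcongr
    _ = _ := by ring

/-- This is where `1 ≤ d` enters: for `E = ⊥` a symmetrizer on `E` carries no information. -/
theorem ne_bot_of_isCompl_span_singleton (hd : 1 ≤ d) {E : Submodule ℝ (Freq d)} {ν : Freq d}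
    (hE : IsCompl E (Submodule.span ℝ {ν})) : E ≠ ⊥ := by
  rintro rfl
  have h1 := hE.sup_eq_top
  rw [bot_sup_eq] at h1
  have h2 := finrank_span_le_card (R := ℝ) {ν}
  rw [h1, finrank_top, finrank_euclideanSpace_fin] at h2
  simp at h2
  omega

theorem IsUniformSymmetrizer.exists_isUniformFullSymmetrizer (hd : 1 ≤ d)
    {𝒜 : Set (EuclideanSpace ℝ (Fin m))}
    (h𝒜 : IsOpen 𝒜) {A : EuclideanSpace ℝ (Fin m) → Fin (d + 1) → CMat N} {M : ℝ} (hM : 0 ≤ M)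
    (hAM : ∀ a ∈ 𝒜, ∀ k i j, ‖A a k i j‖ ≤ M)
    (hA : ∀ k i j, RegOn r (fun a => A a k i j) 𝒜)
    {E : Submodule ℝ (Freq d)} {ν : EuclideanSpace ℝ (Fin m) → Freq d} (hν : RegOn r ν 𝒜)
    (hE : ∀ a ∈ 𝒜, IsCompl E (Submodule.span ℝ {ν a}))
    {K : Set (Freq d)} (hK : IsCompact K) (hKE : ∀ v ∈ K, v ∉ E) (hνK : ∀ a ∈ 𝒜, ν a ∈ K)
    {S : EuclideanSpace ℝ (Fin m) → E → CMat N} (hS : IsUniformSymmetrizer 𝒜 E A ν S)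
    (hreg : ∀ i j, RegOn r (fun x : EuclideanSpace ℝ (Fin m) × E => S x.1 x.2 i j)
      (𝒜 ×ˢ shell _)) :
    ∃ S' : EuclideanSpace ℝ (Fin m) → Freq d → CMat N,
      IsUniformFullSymmetrizer 𝒜 A ν S' ∧ HomogRegularOn r 𝒜 S' := by
  obtain ⟨C, c, hc, hS⟩ := hS
  obtain ⟨R, hR⟩ := hK.isBounded.exists_norm_le
  have hS' : ∀ a ∈ 𝒜, IsSymmetrizer E (A a) (ν a) (S a) |C| c := fun a ha =>
    ⟨fun ξ hξ i j => ((hS a ha).bounded ξ hξ i j).trans (le_abs_self C), (hS a ha).homog,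
      (hS a ha).selfAdjoint, (hS a ha).selfAdjoint_dir, (hS a ha).positive⟩
  have hC : 0 ≤ |C| := abs_nonneg C
  set b : ℝ := 1 + N ^ 2 * |C| * (N ^ 2 * ((d + 1) * M)) / c * |R| with hb
  have hb0 : 0 < b := by positivity
  -- Chosen so that `‖ρ‖ ≥ b⁻¹`, which holds at characteristic frequencies, gives `‖ρ‖ ^ 2 / δ - 1 ≥
  -- 1`, where the cutoff equals `1`.
  set δ : ℝ := b⁻¹ ^ 2 / 2 with hδdef
  have hδ : 0 < δ := by positivity
  have hTb : ∀ a ∈ 𝒜, ∀ ξ : Freq d, ξ ≠ 0 → ∀ i j,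
      ‖gluedSymmetrizer E δ A ν S (a, ‖ξ‖⁻¹ • ξ) i j‖ ≤ |C| + (d + 1) * (1 * M) :=
    fun a ha ξ hξ i j => norm_gluedSymmetrizer_le hC (hAM a ha) (hS' a ha)
      (norm_inv_norm_smul hξ) i j
  refine ⟨fun a ξ => gluedSymmetrizer E δ A ν S (a, ‖ξ‖⁻¹ • ξ), ⟨⟨|C| + (d + 1) * (1 * M),
    fun a ha => ⟨hTb a ha, fun ξ hξ t ht => ?_, fun ξ hξ => ?_⟩⟩, c, hc, fun a ha ξ hξ u hu => ?_⟩,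
    fun i j => ?_⟩
  · simp only [inv_norm_smul_smul ξ ht]
  · have h1 := isHermitian_gluedSymmetrizer_mul (δ := δ) (hS a ha) (hKE _ (hνK a ha)) (hE a ha)
      (‖ξ‖⁻¹ • ξ)
    have e : symbol (A a) ξ = ((‖ξ‖ : ℝ) : ℂ) • symbol (A a) (‖ξ‖⁻¹ • ξ) := by
      rw [← symbol_smul, norm_smul_inv_norm_smul hξ]
    rw [e, mul_smul_comm, Matrix.IsHermitian, Matrix.conjTranspose_smul, h1.eq]
    simp
  · by_cases hu0 : u = 0
    · subst hu0
      simp [normSqVec, herm]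
    set η : Freq d := ‖ξ‖⁻¹ • ξ with hη
    have hη1 : ‖η‖ = 1 := norm_inv_norm_smul hξ
    have huη : symbol (A a) η *ᵥ u = 0 := by
      rw [hη, symbol_smul, Matrix.smul_mulVec, hu, smul_zero]
    have h1 := le_norm_projAlong hM (hAM a ha) (ne_bot_of_isCompl_span_singleton hd (hE a ha))
      ((hR _ (hνK a ha)).trans (le_abs_self R)) hC hc (hS' a ha) (hKE _ (hνK a ha)) (hE a ha)
      hη1 hu0 huη
    set ρ : E := projAlong E (η, ν a) with hρ
    have h2 : b⁻¹ ≤ ‖ρ‖ := (inv_le_iff_one_le_mul₀' hb0).2 h1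
    have hρ0 : ρ ≠ 0 := norm_pos_iff.1 ((inv_pos.2 hb0).trans_le h2)
    have h3 : Real.smoothTransition (‖ρ‖ ^ 2 / δ - 1) = 1 := by
      refine Real.smoothTransition.one_of_one_le ?_
      rw [le_sub_iff_add_le, le_div_iff₀ hδ]
      have := pow_le_pow_left₀ (inv_pos.2 hb0).le h2 2
      rw [hδdef]
      linarith
    have h4 : gluedSymmetrizer E δ A ν S (a, η) = S a ρ := by
      rw [gluedSymmetrizer]
      simp only [← hρ, h3]
      simp
    simp only [← hη, h4]
    exact (hS a ha).positive ρ hρ0 u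
  · exact RegOn.on (h𝒜.prod (isOpen_shell _)) (RegOn.comp_normalize_snd
      (regOn_gluedSymmetrizer h𝒜 hAM hA hν hK hKE hνK (fun a ha => (hS a ha).homog)
        (fun a ha => (hS a ha).bounded) hreg hδ i j)) fun x hx =>
      hTb _ hx.1 _ (ne_zero_of_mem_shell hx.2) i j

end Direct

theorem mainTheorem3 {m d N : ℕ} (hd : 1 ≤ d)
    (𝒜 : Set (EuclideanSpace ℝ (Fin m))) (h𝒜 : IsOpen 𝒜)
    (A : EuclideanSpace ℝ (Fin m) → Fin (d + 1) → CMat N)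
    (ν : EuclideanSpace ℝ (Fin m) → Freq d)
    (E : Submodule ℝ (Freq d)) (hE : UniformDecomposition 𝒜 E ν)
    (hAbdd : ∃ M : ℝ, ∀ a ∈ 𝒜, ∀ k i j, ‖A a k i j‖ ≤ M)
    (r : Regularity)
    (hA : ∀ k i j, r.On (fun a => A a k i j) 𝒜)
    (hν : r.On ν 𝒜) :
    ((∃ S : EuclideanSpace ℝ (Fin m) → E → CMat N,
        IsUniformSymmetrizer 𝒜 E A ν S ∧ HomogRegularOn r 𝒜 S) →
      ∃ S : EuclideanSpace ℝ (Fin m) → Freq d → CMat N,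
        IsUniformFullSymmetrizer 𝒜 A ν S ∧ HomogRegularOn r 𝒜 S) ∧
    ((∀ a ∈ 𝒜, IsHyperbolicInDirection (A a) 0 (ν a)) →
      (∃ S : EuclideanSpace ℝ (Fin m) → Freq d → CMat N,
        IsUniformFullSymmetrizer 𝒜 A ν S ∧ HomogRegularOn r 𝒜 S) →
      ∃ S : EuclideanSpace ℝ (Fin m) → E → CMat N,
        IsUniformSymmetrizer 𝒜 E A ν S ∧ HomogRegularOn r 𝒜 S) := by
  obtain ⟨hcompl, K, hK, hKE, hνK⟩ := hE
  obtain ⟨M, hM⟩ := hAbdd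
  have hAM : ∀ a ∈ 𝒜, ∀ k i j, ‖A a k i j‖ ≤ |M| := fun a ha k i j =>
    (hM a ha k i j).trans (le_abs_self M)
  have hKE' : ∀ v ∈ K, v ∉ E := fun v hv => Set.disjoint_left.1 hKE hv
  have hA' : ∀ k i j, RegOn r (fun a => A a k i j) 𝒜 := fun k i j => (hA k i j).regOn h𝒜
  have hν' : RegOn r ν 𝒜 := hν.regOn h𝒜
  refine ⟨?_, fun hH => ?_⟩
  · rintro ⟨S, hS, hreg⟩
    exact hS.exists_isUniformFullSymmetrizer hd h𝒜 (abs_nonneg M) hAM hA' hν' hcompl hK hKE' hνK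
      fun i j => (hreg i j).regOn (h𝒜.prod (isOpen_shell _))
  · rintro ⟨S, hS, hreg⟩
    exact hS.exists_isUniformSymmetrizer h𝒜 (abs_nonneg M) hAM hA' hν' hK hKE' hνK hH
      fun i j => (hreg i j).regOn (h𝒜.prod (isOpen_shell _))
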